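/- **Setting.** Let $\mathcal X$ be a finite-dimensional real normed space with dual $\mathcal X^*$ and dual norm $\|\cdot\|_*$. Let $F_1,F_2:\mathcal X\to\mathcal X^*$ be monotone and Lipschitz, and let $g_1,g_2:\mathcal X\to(-\infty,\infty]$ be proper, convex and lower semicontinuous. Put $\mathcal Z=\operatorname{dom}g_1\cap\operatorname{dom}g_2$, $H^{(F,g)}(x,y)=\langle F(y),x-y\rangle+g(x)-g(y)$, $\mathcal S_2=\operatorname{zer}(F_2+\partial g_2)$, and let $\mathcal S_1$ be the set of $x\in\mathcal S_2$ (with $g_1(x)<\infty$) such that $\langle F_1(x),z-x\rangle+g_1(z)-g_1(x)\ge 0$ for all $z\in\mathcal S_2$. Assume that $\mathcal S_1\ne\emptyset$; that $\mathcal Z$ is closed and $\sup_{(x,y)\in\mathcal B\times\mathcal C}|g_1(x)-g_1(y)|<\infty$ for all compact $\mathcal B,\mathcal C\subseteq\mathcal Z$; and that $\mathcal S_1=\operatorname{zer}(F_1+\partial g_1+\mathrm{NC}_{\mathcal S_2})$, where $\mathrm{NC}_{\mathcal S_2}$ is the normal cone of $\mathcal S_2$. Define the gaps $\Theta_{\rm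 Feas}(x|\mathcal C)=\sup_{y\in\mathcal C}H^{(F_2,g_2)}(x,y)$ and $\Theta_{\rm Opt}(x|\mathcal C\cap\mathcal S_2)=\sup_{y\in\mathcal C\cap\mathcal S_2}H^{(F_1,g_1)}(x,y)$, and $$h(u)=\sup_{x\in\mathcal S_2}\ \sup_{y\in\operatorname{dom}g_2}\{H^{(F_2,g_2)}(x,y)+\langle u,y\rangle\}-\sup_{x\in\mathcal S_2}\langle u,x\rangle .$$ The set $\mathcal S_2$ is $(\kappa,\rho)$-weakly sharp ($\kappa>0$, $\rho\ge1$) if $H^{(F_2,g_2)}(z,z^*)\ge\frac\kappa\rho\operatorname{dist}(z,\mathcal S_2)^\rho$ for all $z^*\in\mathcal S_2$, $z\in\operatorname{dom}g_2$. Let $\mathsf d:\mathcal X\to(-\infty,\infty]$ be proper, convex, lower semicontinuous, finite on $\mathcal Z$, continuous and $1$-strongly convex (with respect to $\|\cdot\|$) on its domain, let $\mathsf d'$ be a continuous selection of $\partial\mathsf d$ on $\operatorname{dom}\partial\mathsf d$, and let $D(x,z)=\mathsf d(x)-\mathsf d(z)-\langle\mathsf d'(z),x-z\rangle$. Fix $\alpha\in(0,1)$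 and $x_0\in\mathcal Z\cap\operatorname{dom}\partial\mathsf d$. **Algorithm (hierarchical mirror-prox with variance reduction).** Given $K\ge1$, step sizes $\tau_s>0$ and nonincreasing $\beta_s>0$, put $V_s=\beta_sF_1+F_2$, $G_s=\beta_sg_1+g_2$. An oracle $V_s^\xi$ is available such that for all $x,y\in\mathcal Z$ there is a distribution $Q_{x,y}$ (which may depend on $s$, measurably on $(x,y)$) with $\mathbb E_{\xi\sim Q_{x,y}}V_s^\xi(x)=V_s(x)$, $\mathbb E_{\xi\sim Q_{x,y}}V_s^\xi(y)=V_s(y)$ and $\mathbb E_{\xi\sim Q_{x,y}}\|V_s^\xi(x)-V_s^\xi(y)\|_*^2\le L_s^2\|x-y\|^2$, $L_s>0$. Start with $x_0^0=w^0=\bar w^0=x_0$. For $s=0,1,\dots$ and $k=0,\dots,K-1$ let $$y_{k+1}^s=\operatorname*{argmin}_z\{\tau_sG_s(z)+\tau_s\langle V_s(w^s),z\rangle+\alpha D(z,x_k^s)+(1-\alpha)D(z,\bar w^s)\},$$ sample $\xi_k^s\sim Q_{y_{k+1}^s,w^s}$ given the past, put $A_{k+1}^s=V_s(w^s)+V_s^{\xi_k^s}(y_{k+1}^s)-V_s^{\xi_k^s}(w^s)$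 and $$x_{k+1}^s=\operatorname*{argmin}_z\{\tau_sG_s(z)+\tau_s\langle A_{k+1}^s,z\rangle+\alpha D(z,x_k^s)+(1-\alpha)D(z,\bar w^s)\}.$$ At the end of the epoch, $w^{s+1}=\frac1K\sum_{k=1}^Kx_k^s$, $\mathsf d'(\bar w^{s+1})=\frac1K\sum_{k=1}^K\mathsf d'(x_k^s)$, $x_0^{s+1}=x_K^s$. The iterates $x_k^s,\bar w^s$ are assumed to lie in $\operatorname{dom}\partial\mathsf d$. Suppose $\tau_s\le\sqrt{1-\alpha}/(2L_s)$ for all $s$. Let $\mathcal U_1\subseteq\operatorname{dom}g_1$ and $\mathcal U_2\subseteq\mathcal Z$ be compact with $\mathcal U_1\cap\mathcal S_1\ne\emptyset$ and $\mathcal U_2\cap\mathcal S_2\neq\emptyset$. Fix $x^*\in\mathcal S_1$ and a corresponding $p^*\in\mathrm{NC}_{\mathcal S_2}(x^*)$, that is, $-F_1(x^*)-p^*\in\partial g_1(x^*)$. Put $\mathcal E^0(x)=(\alpha+(1-\alpha)K)D(x,x_0)$, $T_S=\sum_{s=0}^{S-1}\tau_s$, $\hat x^S=\frac1{KT_S}\sum_{s=0}^{S-1}\tau_s\sum_{k=0}^{K-1}y_{k+1}^s$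 and $R^2=\sup_{\mathcal U_2}\mathcal E^0+\sup_{\mathcal U_2}D(\cdot,x_0)+\mathcal E^0(x^*)$. **Theorem.** There is $B>0$ (independent of $\alpha,\tau,\beta,K,S$, the oracle and the run) with $\Theta_{\rm Opt}(x|\mathcal U_1\cap\mathcal S_2)\ge-B\operatorname{dist}(x,\mathcal S_2)$ for all $x\in\mathcal X$, and the following hold. (a) If $\sum_{s\ge0}\tau_sh(\beta_sp^*)<\infty$, there are $c_1,C_{\mathcal U_2}>0$, independent of $K$, $S$, the oracle and the run, such that for all $K,S\ge1$, with $C_{\mathcal U_1}=c_1K$, the gaps at $\hat x^S$ are finite and integrable, $\operatorname{dist}(\hat x^S,\mathcal S_2)$ is integrable, $$\mathbb E[\Theta_{\rm Feas}(\hat x^S|\mathcal U_2)]\le W_{\rm Feas}:=\frac{R^2}{KT_S}+\frac{\sum_{s<S}\tau_sh(\beta_sp^*)}{2T_S}+\frac{\sum_{s<S}\beta_s\tau_s}{T_S}C_{\mathcal U_2},$$ $$-B\,\mathbb E[\operatorname{dist}(\hat x^S,\mathcal S_2)]\le\mathbb E[\Theta_{\rm Opt}(\hat x^S|\mathcal U_1\cap\mathcal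 S_2)],$$ and, if $x^*$ lies in the relative interior of $\operatorname{dom}\mathsf d$ (which is automatic when $\mathsf d$ is finite on $\mathcal X$), $$\mathbb E[\Theta_{\rm Opt}(\hat x^S|\mathcal U_1\cap\mathcal S_2)]\le\frac{C_{\mathcal U_1}}{\beta_SKT_S}+\frac{\sup_{\mathcal U_1\cap\mathcal S_2}D(\cdot,x_0)}{KT_S}+\frac{\mathcal E^0(x^*)}{2K\beta_S^2T_S}+\frac{\sum_{s<S}\tau_sh(\beta_sp^*)}{2\beta_S^2T_S}.$$ If $\mathcal S_2$ is $(\kappa,\rho)$-weakly sharp, then also $-B\,[\rho\kappa^{-1}W_{\rm Feas}]^{1/\rho}\le\mathbb E[\Theta_{\rm Opt}(\hat x^S|\mathcal U_1\cap\mathcal S_2)]$. (b) Let $\mathcal S_2$ be $(\kappa,\rho)$-weakly sharp with $\rho>1$, $\rho^*=\rho/(\rho-1)$, $\delta\in(0,1/2)$, $\delta\rho^*>1$, $\tau_s=\bar\tau>0$, and $\beta_s=(K(s+1))^{-\delta}$. Put $\tilde h_\rho=\frac{1}{\rho^*}\kappa^{-1/(\rho-1)}\|p^*\|_*^{\rho^*}\left(1+\frac1{\delta\rho^*-1}\right)$.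 There are $c_1,C_{\mathcal U_2}>0$, independent of $K$, $S$, the oracle and the run, such that for all $K,S\ge1$, with $C_{\mathcal U_1}=c_1K$, the gaps at $\hat x^S$ are finite and integrable, $$\mathbb E[\Theta_{\rm Feas}(\hat x^S|\mathcal U_2)]\le\frac{R^2}{\bar\tau KS}+\frac{4C_{\mathcal U_2}}{(KS)^\delta}+\frac{\tilde h_\rho}{2KS},$$ and, if $x^*$ lies in the relative interior of $\operatorname{dom}\mathsf d$, $$\mathbb E[\Theta_{\rm Opt}(\hat x^S|\mathcal U_1\cap\mathcal S_2)]\le\frac{C_{\mathcal U_1}}{\bar\tau(KS)^{1-\delta}}+\frac{\sup_{\mathcal U_1\cap\mathcal S_2}D(\cdot,x_0)}{\bar\tau KS}+\frac{\mathcal E^0(x^*)}{2\bar\tau(KS)^{1-2\delta}}+\frac{\tilde h_\rho}{2(KS)^{1-2\delta}}.$$ -/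

import Mathlib

open MeasureTheory ProbabilityTheory Topology

universe u v w

namespace HierMP

noncomputable section

/-! ### Convex analysis for extended-real-valued functions -/

section Convex

variable {X : Type*} [NormedAddCommGroup X] [NormedSpace ℝ X]

/-- Effective domain of a function that never takes the value `-∞`. -/
def edom (g : X → EReal) : Set X := {x | g x ≠ ⊤}

/-- `g ∈ Γ₀(X)`: proper, convex (convex epigraph) and lower semicontinuous. -/
structure IsGammaZero (g : X → EReal) : Prop where
  ne_bot : ∀ x, g x ≠ ⊥
  proper : (edom g).Nonempty
  convex : Convex ℝ {p : X × ℝ | g p.1 ≤ (p.2 : EReal)}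
  lsc : LowerSemicontinuous g

/-- Subdifferential of `g` at `x` (empty outside `edom g` for proper `g`). -/
def subdiff (g : X → EReal) (x : X) : Set (StrongDual ℝ X) :=
  {u | ∀ z, g x + ((u (z - x) : ℝ) : EReal) ≤ g z}

/-- Domain of the subdifferential. -/
def subdiffDom (g : X → EReal) : Set X := {x | (subdiff g x).Nonempty}

/-- Normal cone of `S` at `x`; it is empty for `x ∉ S`. -/
def normalCone (S : Set X) (x : X) : Set (StrongDual ℝ X) :=
  {p | x ∈ S ∧ ∀ z ∈ S, p (z - x) ≤ 0}

/-- Monotone operator `X → X*`. -/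
def IsMonotoneOp (F : X → StrongDual ℝ X) : Prop :=
  ∀ x y, 0 ≤ (F x - F y) (x - y)

/-- The bifunction `H^{(F,g)}(x,y) = ⟨F(y), x - y⟩ + g(x) - g(y)`. -/
def bifun (F : X → StrongDual ℝ X) (g : X → EReal) (x y : X) : EReal :=
  ((F y (x - y) : ℝ) : EReal) + g x - g y

/-- Restricted dual gap function `Θ(x | F, g, C) = sup_{y ∈ C} H^{(F,g)}(x,y)`. -/
def gap (F : X → StrongDual ℝ X) (g : X → EReal) (C : Set X) (x : X) : EReal :=
  ⨆ y ∈ C, bifun F g x y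

/-- `φ^{(F,g)}(x,u) = sup_{y ∈ dom g} (H^{(F,g)}(x,y) + ⟨y,u⟩)`. -/
def fitz (F : X → StrongDual ℝ X) (g : X → EReal) (x : X) (u : StrongDual ℝ X) : EReal :=
  ⨆ y ∈ edom g, (bifun F g x y + ((u y : ℝ) : EReal))

/-- Support function of `S`. -/
def supp (u : StrongDual ℝ X) (S : Set X) : EReal := ⨆ x ∈ S, ((u x : ℝ) : EReal)

/-- Bregman divergence `D(x,z) = d(x) - d(z) - ⟨d'(z), x - z⟩`
(used for `x ∈ dom d` and `z ∈ dom ∂d`). -/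
def breg (d : X → EReal) (d' : X → StrongDual ℝ X) (x z : X) : ℝ :=
  (d x).toReal - (d z).toReal - d' z (x - z)

/-- `d` is a distance-generating function for the feasible set `Z`, with continuous selection
`d'` of its subdifferential. -/
structure IsDGF (Z : Set X) (d : X → EReal) (d' : X → StrongDual ℝ X) : Prop where
  gamma : IsGammaZero d
  feasible : Z ⊆ edom d
  strong : StrongConvexOn (edom d) 1 (fun x => (d x).toReal)
  cont : ContinuousOn (fun x => (d x).toReal) (edom d)
  selection : ∀ x ∈ subdiffDom d, d' x ∈ subdiff d x
  selection_cont : ContinuousOn d' (subdiffDom d)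

end Convex

/-! ### The hierarchical variational inequality -/

/-- Data of a hierarchical variational inequality. -/
structure HVI (X : Type*) [NormedAddCommGroup X] [NormedSpace ℝ X] where
  F₁ : X → StrongDual ℝ X
  F₂ : X → StrongDual ℝ X
  g₁ : X → EReal
  g₂ : X → EReal

namespace HVI

variable {X : Type*} [NormedAddCommGroup X] [NormedSpace ℝ X] (P : HVI X)

/-- The common domain `dom g₁ ∩ dom g₂`. -/
def Z : Set X := edom P.g₁ ∩ edom P.g₂

/-- Lower-level solution set `S₂ = zer(F₂ + ∂g₂)`. -/
def S₂ : Set X := {x | -P.F₂ x ∈ subdiff P.g₂ x}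

/-- Solution set `S₁` of the hierarchical problem: points `x ∈ S₂` (with `g₁ x` finite) such that
`⟨F₁(x), z - x⟩ + g₁(z) - g₁(x) ≥ 0` for all `z ∈ S₂`. -/
def S₁ : Set X :=
  {x | x ∈ P.S₂ ∧ P.g₁ x ≠ ⊤ ∧ ∀ z ∈ P.S₂, P.g₁ x ≤ ((P.F₁ x (z - x) : ℝ) : EReal) + P.g₁ z}

/-- `p` certifies `x ∈ zer(F₁ + ∂g₁ + NC_{S₂})`: `p ∈ NC_{S₂}(x)` and `-F₁(x) - p ∈ ∂g₁(x)`. -/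
def IsMultiplier (x : X) (p : StrongDual ℝ X) : Prop :=
  p ∈ normalCone P.S₂ x ∧ -P.F₁ x - p ∈ subdiff P.g₁ x

/-- Standing assumptions on the data. -/
structure Standing : Prop where
  solvable : P.S₁.Nonempty
  gamma₁ : IsGammaZero P.g₁
  gamma₂ : IsGammaZero P.g₂
  mono₁ : IsMonotoneOp P.F₁
  mono₂ : IsMonotoneOp P.F₂
  lip₁ : ∃ L, LipschitzWith L P.F₁
  lip₂ : ∃ L, LipschitzWith L P.F₂

/-- Closed common domain, and finite variation of `g₁` over products of compact subsets of it. -/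
def FiniteVariation : Prop :=
  IsClosed P.Z ∧ ∀ B C : Set X, IsCompact B → IsCompact C → B ⊆ P.Z → C ⊆ P.Z →
    BddAbove {t : ℝ | ∃ x ∈ B, ∃ y ∈ C, t = |(P.g₁ x).toReal - (P.g₁ y).toReal|}

/-- Constraint qualification `S₁ = zer(F₁ + ∂g₁ + NC_{S₂})`. -/
def CQ : Prop := P.S₁ = {x | ∃ p, P.IsMultiplier x p}

/-- Feasibility gap `Θ_Feas(x | C)`. -/
def gapFeas (C : Set X) (x : X) : EReal := gap P.F₂ P.g₂ C x

/-- Optimality gap `Θ_Opt(x | C ∩ S₂)`. -/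
def gapOpt (C : Set X) (x : X) : EReal := gap P.F₁ P.g₁ (C ∩ P.S₂) x

/-- `h(u) = sup_{x ∈ S₂} φ^{(F₂,g₂)}(x,u) - supp(u | S₂)`. -/
def h (u : StrongDual ℝ X) : EReal := (⨆ x ∈ P.S₂, fitz P.F₂ P.g₂ x u) - supp u P.S₂

/-- The lower-level solution set is `(κ,ρ)`-weakly sharp. -/
def WeaklySharp (κ ρ : ℝ) : Prop :=
  0 < κ ∧ 1 ≤ ρ ∧ ∀ zs ∈ P.S₂, ∀ z ∈ edom P.g₂,
    ((κ / ρ * Metric.infDist z P.S₂ ^ ρ : ℝ) : EReal) ≤ bifun P.F₂ P.g₂ z zs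

/-- The regularized operator `βF₁ + F₂`. -/
def V (β : ℝ) (x : X) : StrongDual ℝ X := β • P.F₁ x + P.F₂ x

/-- The function `βg₁ + g₂` on the common domain (it is `+∞` elsewhere for `β > 0`). -/
def G (β : ℝ) (x : X) : ℝ := β * (P.g₁ x).toReal + (P.g₂ x).toReal

/-- `y = argmin_z { τ(βg₁ + g₂)(z) + τ⟨v,z⟩ + αD(z,a) + (1-α)D(z,b) }`. The objective is `+∞`
outside `dom g₁ ∩ dom g₂` (which is contained in `dom d`), so it is minimized over this set. -/
def IsMirrorStep (d : X → EReal) (d' : X → StrongDual ℝ X) (α τ β : ℝ) (v : StrongDual ℝ X)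
    (a b y : X) : Prop :=
  y ∈ P.Z ∧ IsMinOn
    (fun z => τ * P.G β z + τ * v z + α * breg d d' z a + (1 - α) * breg d d' z b) P.Z y

end HVI

/-! ### Stochastic oracle and algorithm -/

section Algorithm

variable {X : Type u} [NormedAddCommGroup X] [NormedSpace ℝ X]

/-- Variance-reduced stochastic oracle for the operators `V s`, on the set `Z`. For each pair
`(x,y)` it has a distribution `Q s (x,y)` of the sample (measurable in `(x,y)`), under which the
oracle is unbiased at `x` and at `y`, and `L s`-Lipschitz in mean square between them. -/
structure StochasticOracle [MeasurableSpace X] (Z : Set X) (V : ℕ → X → StrongDual ℝ X) where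
  Ξ : Type v
  [mΞ : MeasurableSpace Ξ]
  Vξ : ℕ → Ξ → X → StrongDual ℝ X
  Q : ℕ → Kernel (X × X) Ξ
  L : ℕ → ℝ
  measurable_Vξ : ∀ s, Measurable (fun q : Ξ × X => Vξ s q.1 q.2)
  markov : ∀ s, IsMarkovKernel (Q s)
  L_pos : ∀ s, 0 < L s
  unbiased_left : ∀ s, ∀ x ∈ Z, ∀ y ∈ Z,
    Integrable (fun ζ => Vξ s ζ x) (Q s (x, y)) ∧ ∫ ζ, Vξ s ζ x ∂(Q s (x, y)) = V s x
  unbiased_right : ∀ s, ∀ x ∈ Z, ∀ y ∈ Z,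
    Integrable (fun ζ => Vξ s ζ y) (Q s (x, y)) ∧ ∫ ζ, Vξ s ζ y ∂(Q s (x, y)) = V s y
  mean_lipschitz : ∀ s, ∀ x ∈ Z, ∀ y ∈ Z,
    ∫⁻ ζ, ‖Vξ s ζ x - Vξ s ζ y‖ₑ ^ 2 ∂(Q s (x, y)) ≤ ENNReal.ofReal (L s ^ 2 * ‖x - y‖ ^ 2)

attribute [instance] StochasticOracle.mΞ

/-- The information available when `ξ_k^s` is drawn: all samples and iterates of the earlier
inner steps (in lexicographic order), together with `y_{k+1}^s`. -/
@[reducible] def history {Ω Ξ : Type*} [MeasurableSpace X] [MeasurableSpace Ξ] (K : ℕ)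
    (ξ : ℕ → ℕ → Ω → Ξ) (x y : ℕ → ℕ → Ω → X) (s k : ℕ) : MeasurableSpace Ω :=
  (⨆ (t : ℕ) (j : ℕ) (_ : (t < s ∧ j < K) ∨ (t = s ∧ j < k)),
    (MeasurableSpace.comap (ξ t j) inferInstance ⊔
      MeasurableSpace.comap (x t (j + 1)) inferInstance ⊔
      MeasurableSpace.comap (y t (j + 1)) inferInstance)) ⊔
    MeasurableSpace.comap (y s (k + 1)) inferInstance

/-- A run of the hierarchical mirror-prox method with variance reduction: epochs `s = 0,1,…`,
inner steps `k = 0,…,K-1`, step sizes `τ s`, regularization `β s`, starting point `x₀`. -/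
structure MirrorProxRun [MeasurableSpace X] (P : HVI X) (d : X → EReal) (d' : X → StrongDual ℝ X)
    (α : ℝ) (τ β : ℕ → ℝ) (x₀ : X) (K : ℕ)
    (O : StochasticOracle.{u, v} P.Z (fun s => P.V (β s))) where
  Ω : Type w
  [mΩ : MeasurableSpace Ω]
  μ : Measure Ω
  prob : IsProbabilityMeasure μ
  ξ : ℕ → ℕ → Ω → O.Ξ
  x : ℕ → ℕ → Ω → X
  y : ℕ → ℕ → Ω → X
  w : ℕ → Ω → X
  wbar : ℕ → Ω → X
  measurable_ξ : ∀ s k, k < K → Measurable (ξ s k)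
  measurable_x : ∀ s k, k ≤ K → Measurable (x s k)
  measurable_y : ∀ s k, k < K → Measurable (y s (k + 1))
  /- initialization -/
  init_x : ∀ ω, x 0 0 ω = x₀
  init_w : ∀ ω, w 0 ω = x₀
  init_wbar : ∀ ω, wbar 0 ω = x₀
  /- the divergences in the proximal steps are defined -/
  x_mem : ∀ s k ω, k ≤ K → x s k ω ∈ subdiffDom d
  wbar_mem : ∀ s ω, wbar s ω ∈ subdiffDom d
  /- extrapolation step -/
  step_y : ∀ s k ω, k < K →
    P.IsMirrorStep d d' α (τ s) (β s) (P.V (β s) (w s ω)) (x s k ω) (wbar s ω) (y s (k + 1) ω)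
  /- given the past, the sample `ξ_k^s` has distribution `Q_{y_{k+1}^s, w^s}` -/
  sample : ∀ s k, k < K → ∀ (A : Set O.Ξ) (E : Set Ω), MeasurableSet A →
    MeasurableSet[history K ξ x y s k] E →
    μ (E ∩ ξ s k ⁻¹' A) = ∫⁻ ω in E, O.Q s (y s (k + 1) ω, w s ω) A ∂μ
  /- update step with the variance-reduced direction -/
  step_x : ∀ s k ω, k < K →
    P.IsMirrorStep d d' α (τ s) (β s)
      (P.V (β s) (w s ω) + O.Vξ s (ξ s k ω) (y s (k + 1) ω) - O.Vξ s (ξ s k ω) (w s ω))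
      (x s k ω) (wbar s ω) (x s (k + 1) ω)
  /- end of the epoch -/
  epoch_w : ∀ s ω, w (s + 1) ω = (K : ℝ)⁻¹ • ∑ k ∈ Finset.Icc 1 K, x s k ω
  epoch_wbar : ∀ s ω, d' (wbar (s + 1) ω) = (K : ℝ)⁻¹ • ∑ k ∈ Finset.Icc 1 K, d' (x s k ω)
  epoch_x : ∀ s ω, x (s + 1) 0 ω = x s K ω

attribute [instance] MirrorProxRun.mΩ

/-- `T_S = ∑_{s<S} τ_s`. -/
def sumStep (τ : ℕ → ℝ) (S : ℕ) : ℝ := ∑ s ∈ Finset.range S, τ s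

/-- Ergodic average `x̂^S = (K T_S)⁻¹ ∑_{s<S} τ_s ∑_{k<K} y_{k+1}^s`. -/
def ergodic {Ω : Type*} (τ : ℕ → ℝ) (K : ℕ) (y : ℕ → ℕ → Ω → X) (S : ℕ) (ω : Ω) : X :=
  (K * sumStep τ S)⁻¹ •
    ∑ s ∈ Finset.range S, τ s • ∑ k ∈ Finset.range K, y s (k + 1) ω

/-- An extended-real random variable that is finite everywhere and integrable. -/
def HasExpectation {Ω : Type*} [MeasurableSpace Ω] (μ : Measure Ω) (f : Ω → EReal) : Prop :=
  (∀ ω, f ω ≠ ⊤ ∧ f ω ≠ ⊥) ∧ Integrable (fun ω => (f ω).toReal) μ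

/-- Expectation of a finite extended-real random variable. -/
def expect {Ω : Type*} [MeasurableSpace Ω] (μ : Measure Ω) (f : Ω → EReal) : ℝ :=
  ∫ ω, (f ω).toReal ∂μ

/-- Initial energy `𝓔⁰(x) = (α + (1-α)K) D(x,x₀)`: the energy
`αD(x,x_0^s) + (1-α)∑_{j=1}^K D(x,x_j^{s-1})` at `s = 0`, as `x_j^{-1} = x_0^0 = x₀`. -/
def energy₀ (d : X → EReal) (d' : X → StrongDual ℝ X) (α : ℝ) (x₀ : X) (K : ℕ) (x : X) : ℝ :=
  α * breg d d' x x₀ + (1 - α) * ∑ _j ∈ Finset.Icc 1 K, breg d d' x x₀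

/-- `R²(x*,x₀) = sup_{U₂} 𝓔⁰ + sup_{U₂} D(·,x₀) + 𝓔⁰(x*)`. -/
def Rsq (d : X → EReal) (d' : X → StrongDual ℝ X) (α : ℝ) (x₀ : X) (U₂ : Set X) (K : ℕ)
    (xs : X) : ℝ :=
  sSup (energy₀ d d' α x₀ K '' U₂) + sSup ((fun x => breg d d' x x₀) '' U₂)
    + energy₀ d d' α x₀ K xs

/-- The feasibility bound `W_Feas`, with constant `C = C_{U₂}`. -/
def WFeas (P : HVI X) (d : X → EReal) (d' : X → StrongDual ℝ X) (α : ℝ) (τ β : ℕ → ℝ) (x₀ : X)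
    (U₂ : Set X) (xs : X) (ps : StrongDual ℝ X) (C : ℝ) (K S : ℕ) : ℝ :=
  Rsq d d' α x₀ U₂ K xs / (K * sumStep τ S)
    + (∑ s ∈ Finset.range S, τ s * (P.h (β s • ps)).toReal) / (2 * sumStep τ S)
    + (∑ s ∈ Finset.range S, β s * τ s) / sumStep τ S * C

/-- The optimality bound `W_Opt`, with constant `C = C_{U₁}`. -/
def WOpt (P : HVI X) (d : X → EReal) (d' : X → StrongDual ℝ X) (α : ℝ) (τ β : ℕ → ℝ) (x₀ : X)
    (U₁ : Set X) (xs : X) (ps : StrongDual ℝ X) (C : ℝ) (K S : ℕ) : ℝ :=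
  C / (β S * K * sumStep τ S)
    + sSup ((fun x => breg d d' x x₀) '' (U₁ ∩ P.S₂)) / (K * sumStep τ S)
    + energy₀ d d' α x₀ K xs / (2 * K * β S ^ 2 * sumStep τ S)
    + (∑ s ∈ Finset.range S, τ s * (P.h (β s • ps)).toReal) / (2 * β S ^ 2 * sumStep τ S)

/-- With `ρ* = ρ/(ρ-1)`, the constant
`h̃_ρ = (1/ρ*) κ^{-1/(ρ-1)} ‖p‖^{ρ*} (1 + 1/(δρ* - 1))`. -/
def hTilde (κ ρ δ : ℝ) (p : StrongDual ℝ X) : ℝ :=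
  (ρ - 1) / ρ * κ ^ (-(1 / (ρ - 1))) * ‖p‖ ^ (ρ / (ρ - 1))
    * (1 + 1 / (δ * (ρ / (ρ - 1)) - 1))

end Algorithm

end

end HierMP

open HierMP

namespace HierMP

/-! ### Convex analysis -/

section ConvexAnalysis

variable {X : Type*} [NormedAddCommGroup X] [NormedSpace ℝ X]

/-! Fix a comparison point z. In one inner iteration, strong convexity of `d`, averaging in the dual
and Young's inequality bound the regularized residual ⟨V_s(y), y − z⟩ + G_s(y) − G_s(z) by a
decrease of divergence, a stochastic error, and an excess: sampling variance minus (1−α)/4 ‖y − w‖²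
(`HVI.innerStep_le`). The step-size rule means τ²L² ≤ (1−α)/4, so the expected excess is at most
−(1−α)/8 E‖y − w‖². Over an epoch the energy αD(z, x_0^s) + (1−α) Σ_j D(z, x_j^{s−1}) telescopes
(`MirrorProxRun.epoch_le`).

At z = x* the residual is at least −h(β_s p*), because x* competes in the supremum defining `h` and
p* attains its support function there. Hence the expected energies and the second moments of the
iterates are bounded by multiples of 𝓔⁰(x*) + K Σ τ_s h(β_s p*), which is O(K) when that series
converges.

A gap puts a supremum over z inside the expectation, where the error is no longer centred. Expanding
z − x* in a basis leaves finitely many scalar martingales; their variances are controlled by the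
weighted displacements, and Young's inequality absorbs them into the negative excess. What remains
does not depend on K or on the oracle (`MirrorProxRun.exists_noise_bound`).

By monotonicity the residual dominates βH₁ + H₂, with H_i the bifunction of (F_i, g_i). For
feasibility, the weights are 1 and −H₁ is at most c(1 + ‖y − x*‖), which costs the term Σ β_s τ_s.
For optimality, H₂ ≥ 0 at z ∈ S₂, so the weights 1/β_s isolate H₁. These weights are nondecreasing,
and Abel summation then needs energies bounded uniformly in z; when x* is in the relative interior,
D(z, ·) ≤ c + c′D(x*, ·) supplies this. Convexity passes to the ergodic average.

A multiplier at a point of U₁ ∩ S₁ yields the lower bound on the optimality gap. Weak sharpness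
converts feasibility gap into distance by Jensen's inequality, and bounds h(βp*) by a multiple of
β^{ρ*}, summable along β_s when δρ* > 1. In the optimality bounds the term with C_{U₁} already
suffices; the other displayed terms are nonnegative. -/

theorem IsGammaZero.coe_toReal {g : X → EReal} (hg : IsGammaZero g) {x : X} (hx : x ∈ edom g) :
    ((g x).toReal : EReal) = g x :=
  EReal.coe_toReal hx (hg.ne_bot x)

theorem IsGammaZero.convexOn {g : X → EReal} (hg : IsGammaZero g) :
    ConvexOn ℝ (edom g) (fun x => (g x).toReal) := by
  have key : ∀ x ∈ edom g, ∀ y ∈ edom g, ∀ a b : ℝ, 0 ≤ a → 0 ≤ b → a + b = 1 →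
      g (a • x + b • y) ≤ ((a * (g x).toReal + b * (g y).toReal : ℝ) : EReal) := by
    intro x hx y hy a b ha hb hab
    have := hg.convex (x := (x, (g x).toReal)) (y := (y, (g y).toReal))
      (by simp [hg.coe_toReal hx]) (by simp [hg.coe_toReal hy]) ha hb hab
    simpa using this
  refine ⟨fun x hx y hy a b ha hb hab => ?_, fun x hx y hy a b ha hb hab => ?_⟩
  · exact ne_top_of_le_ne_top (EReal.coe_ne_top _) (key x hx y hy a b ha hb hab)
  · have h := key x hx y hy a b ha hb hab
    have := EReal.toReal_le_toReal h (hg.ne_bot _) (EReal.coe_ne_top _)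
    rwa [EReal.toReal_coe] at this

theorem IsGammaZero.mem_edom_of_mem_subdiff {g : X → EReal} (hg : IsGammaZero g) {x : X}
    {u : StrongDual ℝ X} (hu : u ∈ subdiff g x) : x ∈ edom g := by
  obtain ⟨z, hz⟩ := hg.proper
  intro hx
  have := hu z
  rw [hx, EReal.top_add_coe, top_le_iff] at this
  exact hz this

theorem IsGammaZero.le_of_mem_subdiff {g : X → EReal} (hg : IsGammaZero g) {x z : X}
    {u : StrongDual ℝ X} (hu : u ∈ subdiff g x) (hz : z ∈ edom g) :
    (g x).toReal + u (z - x) ≤ (g z).toReal := by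
  have h := hu z
  rw [← hg.coe_toReal hz, ← hg.coe_toReal (hg.mem_edom_of_mem_subdiff hu)] at h
  exact_mod_cast h

theorem IsGammaZero.measurable_toReal [MeasurableSpace X] [BorelSpace X] {g : X → EReal}
    (hg : IsGammaZero g) : Measurable (fun x => (g x).toReal) :=
  hg.lsc.measurable.ereal_toReal

/-- Let t → 0. Variational inequalities below come from a segment estimate divided by `t`, which
leaves a remainder linear in `t`. -/
theorem nonneg_of_forall_add_mul_nonneg {a b : ℝ}
    (h : ∀ t : ℝ, 0 < t → t ≤ 1 → 0 ≤ a + t * b) : 0 ≤ a := by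
  by_contra ha
  push Not at ha
  have hb : 0 < |b| + 1 := by positivity
  -- This `t` keeps t·b at most −a/2, so that a + t·b ≤ a/2 < 0.
  have ht : 0 < min 1 (-a / (2 * (|b| + 1))) := lt_min one_pos (by apply div_pos <;> linarith)
  have h1 := h _ ht (min_le_left _ _)
  have h2 : min 1 (-a / (2 * (|b| + 1))) * b ≤ -a / (2 * (|b| + 1)) * (|b| + 1) := by
    refine (mul_le_mul_of_nonneg_left (le_abs_self b) ht.le).trans ?_
    exact mul_le_mul (min_le_right _ _) (by linarith) (abs_nonneg b)
      (by apply div_nonneg <;> linarith)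
  have h3 : -a / (2 * (|b| + 1)) * (|b| + 1) = -a / 2 := by field_simp
  linarith

/-! ### Distance-generating functions: density, optimality conditions, mirror averages. -/

section DGF

variable {Z : Set X} {d : X → EReal} {d' : X → StrongDual ℝ X}

theorem IsDGF.subdiffDom_subset (hd : IsDGF Z d d') : subdiffDom d ⊆ edom d :=
  fun _ hx => hd.gamma.mem_edom_of_mem_subdiff hx.choose_spec

theorem IsDGF.le_toReal (hd : IsDGF Z d d') {x z : X} (hx : x ∈ edom d) (hz : z ∈ subdiffDom d) :
    (d z).toReal + d' z (x - z) ≤ (d x).toReal :=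
  hd.gamma.le_of_mem_subdiff (hd.selection z hz) hx

/-- Compare strong convexity and the subgradient inequality at the point z + t(x − z), divide by t
and let t → 0. -/
theorem IsDGF.half_sq_le_breg (hd : IsDGF Z d d') {x z : X} (hx : x ∈ edom d)
    (hz : z ∈ subdiffDom d) : ‖x - z‖ ^ 2 / 2 ≤ breg d d' x z := by
  have hz' := hd.subdiffDom_subset hz
  suffices h : 0 ≤ breg d d' x z - ‖x - z‖ ^ 2 / 2 by linarith
  refine nonneg_of_forall_add_mul_nonneg (b := ‖x - z‖ ^ 2 / 2) fun t ht ht1 => ?_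
  have h1 := hd.strong.2 hx hz' ht.le (by linarith : 0 ≤ 1 - t) (by ring)
  have hmem := hd.strong.1 hx hz' ht.le (by linarith : 0 ≤ 1 - t) (by ring)
  have h2 := hd.le_toReal hmem hz
  have h3 : t • x + (1 - t) • z - z = t • (x - z) := by module
  rw [h3, map_smul] at h2
  simp only [smul_eq_mul] at h1 h2
  have h4 : 0 ≤ t * (breg d d' x z - ‖x - z‖ ^ 2 / 2 + t * (‖x - z‖ ^ 2 / 2)) := by
    unfold breg
    linarith
  exact nonneg_of_mul_nonneg_right h4 ht

theorem IsDGF.breg_nonneg (hd : IsDGF Z d d') {x z : X} (hx : x ∈ edom d)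
    (hz : z ∈ subdiffDom d) : 0 ≤ breg d d' x z :=
  le_trans (by positivity) (hd.half_sq_le_breg hx hz)

/-- The squared norm is controlled by the squared coordinates in a basis. -/
theorem norm_sq_le_sum_coord_sq {ι : Type*} [Fintype ι] (b : Module.Basis ι ℝ X) (x : X) :
    ‖x‖ ^ 2 ≤ (∑ i, ‖b i‖ ^ 2) * ∑ i, (b.coord i x) ^ 2 := by
  have h1 : ‖x‖ ≤ ∑ i, ‖b i‖ * |b.coord i x| := by
    conv_lhs => rw [← b.sum_repr x]
    refine (norm_sum_le _ _).trans (le_of_eq (Finset.sum_congr rfl fun i _ => ?_))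
    rw [norm_smul, mul_comm, Real.norm_eq_abs, Module.Basis.coord_apply]
  calc ‖x‖ ^ 2 ≤ (∑ i, ‖b i‖ * |b.coord i x|) ^ 2 := by gcongr
    _ ≤ (∑ i, ‖b i‖ ^ 2) * ∑ i, |b.coord i x| ^ 2 := Finset.sum_mul_sq_le_sq_mul_sq _ _ _
    _ = _ := by simp

/-- Points of subdifferentiability are dense in the domain, with convergence of values. -/
theorem IsDGF.exists_subdiffDom_near [FiniteDimensional ℝ X] (hd : IsDGF Z d d') {a : X}
    (ha : a ∈ subdiffDom d) {z : X} (hz : z ∈ edom d) {η : ℝ} (hη : 0 < η) :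
    ∃ u ∈ subdiffDom d, ‖u - z‖ < η ∧ |(d u).toReal - (d z).toReal| < η := by
  obtain ⟨r₀, hr₀, hcont⟩ := Metric.continuousWithinAt_iff.1 (hd.cont z hz) η hη
  obtain ⟨r, hr, hrη, hrr₀⟩ : ∃ r > 0, r < η ∧ r < r₀ :=
    ⟨min η r₀ / 2, by positivity, by linarith [min_le_left η r₀, lt_min hη hr₀],
      by linarith [min_le_right η r₀, lt_min hη hr₀]⟩
  set b := Module.finBasis ℝ X
  -- The given norm may be nonsmooth, so the proximal penalty is a coordinate square, whose gradient
  -- is explicit; `C` is chosen so that C·q dominates the squared norm.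
  set q : X → ℝ := fun v => ∑ i, (b.coord i v) ^ 2 with hq
  set C : ℝ := ∑ i, ‖b i‖ ^ 2 + 1 with hC
  have hCpos : 0 < C := by positivity
  have hqn : ∀ v, ‖v‖ ^ 2 / C ≤ q v := fun v => by
    rw [div_le_iff₀ hCpos]
    have : 0 ≤ q v := Finset.sum_nonneg fun i _ => sq_nonneg _
    nlinarith [norm_sq_le_sum_coord_sq b v]
  have hcoord : ∀ i, Continuous (b.coord i) := fun i => LinearMap.continuous_of_finiteDimensional _
  have hqc : Continuous q := continuous_finsetSum _ fun i _ => (hcoord i).pow 2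
  set A : ℝ := (d a).toReal + d' a (z - a) with hA
  -- Outside the ball of radius `r` this penalty outweighs the affine minorant of `d` at `a`, so a
  -- minimizer over the compact ball is a global one.
  set M : ℝ := (‖d' a‖ + (|(d z).toReal - A| + 1) / r) / r with hM
  have hMpos : 0 < M := by positivity
  have hlow : ∀ p ∈ edom d, A - ‖d' a‖ * ‖p - z‖ ≤ (d p).toReal := fun p hp => by
    have h1 := hd.le_toReal hp ha
    have h2 : d' a (p - a) = d' a (z - a) + d' a (p - z) := by rw [← map_add]; congr 1; abel
    have h3 := (abs_le.1 ((d' a).le_opNorm (p - z))).1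
    linarith
  set f : X → EReal := fun p => d p + ((M * C * q (p - z) : ℝ) : EReal) with hf
  have hflsc : LowerSemicontinuous f := by
    refine hd.gamma.lsc.add' ?_ fun x => ?_
    · exact (continuous_coe_real_ereal.comp (by fun_prop)).lowerSemicontinuous
    · exact EReal.continuousAt_add (Or.inr (EReal.coe_ne_bot _)) (Or.inr (EReal.coe_ne_top _))
  obtain ⟨p, hpb, hpmin⟩ := LowerSemicontinuousOn.exists_isMinOn
    (s := Metric.closedBall z r) ⟨z, by simp [hr.le]⟩ (isCompact_closedBall z r)
    (hflsc.lowerSemicontinuousOn _)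
  have hq0 : q 0 = 0 := by simp [hq]
  have hpz : f p ≤ d z := by
    have := hpmin (show z ∈ Metric.closedBall z r by simp [hr.le])
    simpa [hf, hq0] using this
  have hpd : p ∈ edom d := fun h => by
    have : f p = ⊤ := by simp only [hf, h, EReal.top_add_coe]
    rw [this, top_le_iff] at hpz
    exact hz hpz
  have hfr : ∀ x ∈ edom d, f x = (((d x).toReal + M * C * q (x - z) : ℝ) : EReal) := fun x hx => by
    rw [EReal.coe_add, hd.gamma.coe_toReal hx]
  have hmin : ∀ x ∈ edom d, (d p).toReal + M * C * q (p - z) ≤ (d x).toReal + M * C * q (x - z) := by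
    intro x hx
    by_cases hxb : x ∈ Metric.closedBall z r
    · have := hpmin hxb
      rw [Set.mem_ofPred_eq, hfr p hpd, hfr x hx] at this
      exact_mod_cast this
    · rw [hfr p hpd, ← hd.gamma.coe_toReal hz] at hpz
      have hpz' : (d p).toReal + M * C * q (p - z) ≤ (d z).toReal := by exact_mod_cast hpz
      have ht : r < ‖x - z‖ := by simpa [dist_eq_norm] using hxb
      have h1 := hlow x hx
      have h2 : M * ‖x - z‖ ^ 2 ≤ M * C * q (x - z) := by
        have := hqn (x - z)
        rw [div_le_iff₀ hCpos] at this
        nlinarith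
      have h3 : M * r = ‖d' a‖ + (|(d z).toReal - A| + 1) / r := by rw [hM]; field_simp
      have h4 : M * r * ‖x - z‖ ≤ M * ‖x - z‖ ^ 2 := by
        rw [pow_two, mul_assoc]; gcongr
      have h5 : |(d z).toReal - A| + 1 ≤ (|(d z).toReal - A| + 1) / r * ‖x - z‖ := by
        rw [div_mul_eq_mul_div, le_div_iff₀ hr]; gcongr
      rw [h3, add_mul] at h4
      linarith [le_abs_self ((d z).toReal - A)]
  -- Optimality of `p` along segments shows that minus the gradient of the penalty is a subgradient
  -- of `d` at `p`.
  have hsub : p ∈ subdiffDom d := by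
    set u : StrongDual ℝ X := -(2 * (M * C)) •
      ∑ i, (b.coord i (p - z)) • LinearMap.toContinuousLinearMap (b.coord i) with hu
    refine ⟨u, fun x => ?_⟩
    by_cases hx : x ∈ edom d
    · rw [← hd.gamma.coe_toReal hx, ← hd.gamma.coe_toReal hpd]
      have hux : u (x - p) = -(2 * (M * C)) * ∑ i, b.coord i (p - z) * b.coord i (x - p) := by
        simp [hu]
      suffices h : 0 ≤ (d x).toReal - (d p).toReal - u (x - p) by
        have h' : (d p).toReal + u (x - p) ≤ (d x).toReal := by linarith
        exact_mod_cast h'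
      refine nonneg_of_forall_add_mul_nonneg (b := M * C * q (x - p)) fun t ht ht1 => ?_
      have hmem := hd.strong.1 hx hpd ht.le (by linarith : 0 ≤ 1 - t) (by ring)
      have h1 := hmin _ hmem
      have h2 := hd.gamma.convexOn.2 hx hpd ht.le (by linarith : 0 ≤ 1 - t) (by ring)
      have h3 : q (t • x + (1 - t) • p - z) = q (p - z)
          + 2 * t * (∑ i, b.coord i (p - z) * b.coord i (x - p)) + t ^ 2 * q (x - p) := by
        have : t • x + (1 - t) • p - z = (p - z) + t • (x - p) := by module
        rw [this]
        simp only [hq, map_add, map_smul, smul_eq_mul, Finset.mul_sum, ← Finset.sum_add_distrib]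
        exact Finset.sum_congr rfl fun i _ => by ring
      simp only [smul_eq_mul] at h2
      rw [h3] at h1
      have h4 : 0 ≤ t * ((d x).toReal - (d p).toReal - u (x - p) + t * (M * C * q (x - p))) := by
        rw [hux]; linarith
      exact nonneg_of_mul_nonneg_right h4 ht
    · have : d x = ⊤ := by simpa [edom] using hx
      rw [this]; exact le_top
  have hpr : ‖p - z‖ ≤ r := by simpa [dist_eq_norm] using hpb
  refine ⟨p, hsub, by linarith, ?_⟩
  have := hcont hpd (by rw [dist_eq_norm]; linarith)
  rwa [Real.dist_eq] at this

/-- First-order optimality of a composite minimizer, with the continuous selection `d'`. -/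
theorem IsDGF.le_add_of_isMinOn [FiniteDimensional ℝ X] (hd : IsDGF Z d d') {C : Set X}
    (hC : C ⊆ edom d) {ψ : X → ℝ} (hψ : ConvexOn ℝ C ψ) {y z : X} (hyC : y ∈ C) (hzC : z ∈ C)
    (hy : y ∈ subdiffDom d) (hmin : IsMinOn (fun z => ψ z + (d z).toReal) C y) :
    ψ y ≤ ψ z + d' y (z - y) := by
  -- The summands collect three errors: the change of `d` from `zt` to `u`, the displacement `u -
  -- zt` seen by `d' y`, and the variation of `d'` between `u` and `y`.
  set c : ℝ := 1 + ‖d' y‖ + (‖z - y‖ + 1) with hc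
  have hcpos : 0 < c := by positivity
  suffices h : ∀ ε : ℝ, 0 < ε → ψ y ≤ ψ z + d' y (z - y) + ε * c by
    refine le_of_forall_pos_le_add fun ε hε => ?_
    have := h (ε / c) (by positivity)
    rwa [div_mul_cancel₀ _ hcpos.ne'] at this
  intro ε hε
  obtain ⟨ρ, hρ, hcont⟩ := Metric.continuousWithinAt_iff.1 (hd.selection_cont y hy) ε hε
  obtain ⟨t, ht, ht1, htε, htρ⟩ : ∃ t : ℝ, 0 < t ∧ t ≤ 1 ∧ t ≤ ε ∧ t * (‖z - y‖ + 1) < ρ := by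
    have hp : 0 < ρ / (2 * (‖z - y‖ + 1)) := by positivity
    refine ⟨min (min 1 ε) (ρ / (2 * (‖z - y‖ + 1))), by positivity,
      (min_le_left _ _).trans (min_le_left _ _), (min_le_left _ _).trans (min_le_right _ _), ?_⟩
    calc _ ≤ ρ / (2 * (‖z - y‖ + 1)) * (‖z - y‖ + 1) := by gcongr; exact min_le_right _ _
      _ = ρ / 2 := by field_simp
      _ < ρ := by linarith
  set zt := t • z + (1 - t) • y with hzt
  have hztC : zt ∈ C := hψ.1 hzC hyC ht.le (by linarith) (by ring)
  -- Minimality needs an upper bound for d(zt) − d(y), whereas the subgradient at `y` gives only a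
  -- lower one. The subgradient at a point near `zt` gives it, and continuity replaces `d' u` by `d'
  -- y`. The point `zt` itself may have no subgradient; moving by t² costs only o(t).
  obtain ⟨u, hu, huz, hdu⟩ := hd.exists_subdiffDom_near hy (hC hztC) (η := t ^ 2) (by positivity)
  have huy : u - y = t • (z - y) + (u - zt) := by rw [hzt]; module
  have hnorm : ‖u - y‖ ≤ t * (‖z - y‖ + 1) := by
    rw [huy]
    refine (norm_add_le _ _).trans ?_
    rw [norm_smul, Real.norm_of_nonneg ht.le]
    nlinarith
  have hdist := hcont hu (by rw [dist_eq_norm]; linarith)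
  rw [dist_eq_norm] at hdist
  have h1 : ψ y + (d y).toReal ≤ ψ zt + (d zt).toReal := hmin hztC
  have h2 := hψ.2 hzC hyC ht.le (by linarith : 0 ≤ 1 - t) (by ring)
  have h3 := hd.le_toReal (hC hyC) hu
  have h4 : d' u (y - u) = -d' u (u - y) := by rw [← map_neg, neg_sub]
  have h5 : d' u (u - y) = d' y (u - y) + (d' u - d' y) (u - y) := by simp
  have h6 : (d' u - d' y) (u - y) ≤ ε * (t * (‖z - y‖ + 1)) :=
    (le_abs_self _).trans (((d' u - d' y).le_opNorm _).trans (by gcongr))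
  have h7 : d' y (u - y) = t * d' y (z - y) + d' y (u - zt) := by
    rw [huy, map_add, map_smul, smul_eq_mul]
  have h8 : d' y (u - zt) ≤ ‖d' y‖ * t ^ 2 :=
    (le_abs_self _).trans (((d' y).le_opNorm _).trans (by gcongr))
  have h9 := (abs_lt.1 hdu).1
  simp only [smul_eq_mul] at h2
  have h10 : t ^ 2 ≤ t * ε := by rw [pow_two]; gcongr
  have h11 : ‖d' y‖ * t ^ 2 ≤ ‖d' y‖ * (t * ε) := by gcongr
  have h12 : t * ψ y ≤ t * (ψ z + d' y (z - y) + ε * c) := by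
    rw [hc]
    rw [← hzt] at h2
    linarith
  exact le_of_mul_le_mul_left h12 ht

/-- Quadratic growth at a composite minimizer. -/
theorem IsDGF.half_sq_add_le_of_isMinOn (hd : IsDGF Z d d') {C : Set X}
    (hC : C ⊆ edom d) {ψ : X → ℝ} (hψ : ConvexOn ℝ C ψ) {y z : X} (hyC : y ∈ C) (hzC : z ∈ C)
    (hmin : IsMinOn (fun z => ψ z + (d z).toReal) C y) :
    ψ y + (d y).toReal + ‖z - y‖ ^ 2 / 2 ≤ ψ z + (d z).toReal := by
  suffices h : 0 ≤ ψ z + (d z).toReal - (ψ y + (d y).toReal) - ‖z - y‖ ^ 2 / 2 by linarith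
  refine nonneg_of_forall_add_mul_nonneg (b := ‖z - y‖ ^ 2 / 2) fun t ht ht1 => ?_
  have hmem := hψ.1 hzC hyC ht.le (by linarith : 0 ≤ 1 - t) (by ring)
  have h1 : ψ y + (d y).toReal ≤ _ := hmin hmem
  have h2 := hψ.2 hzC hyC ht.le (by linarith : 0 ≤ 1 - t) (by ring)
  have h3 := hd.strong.2 (hC hzC) (hC hyC) ht.le (by linarith : 0 ≤ 1 - t) (by ring)
  simp only [smul_eq_mul] at h1 h2 h3
  have h4 : 0 ≤ t * (ψ z + (d z).toReal - (ψ y + (d y).toReal) - ‖z - y‖ ^ 2 / 2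
      + t * (‖z - y‖ ^ 2 / 2)) := by linarith
  exact nonneg_of_mul_nonneg_right h4 ht

/-- Averaging in the dual: the divergence to the mirror average `b` of points `p k` is controlled
by the average divergence, with a gain measured at the primal average. -/
theorem IsDGF.breg_mirrorAverage_le (hd : IsDGF Z d d') {K : ℕ} (hK : 1 ≤ K) {p : ℕ → X}
    (hp : ∀ k ∈ Finset.Icc 1 K, p k ∈ subdiffDom d) {b z : X} (hb : b ∈ subdiffDom d)
    (hbp : d' b = (K : ℝ)⁻¹ • ∑ k ∈ Finset.Icc 1 K, d' (p k)) :
    breg d d' z b + ‖b - (K : ℝ)⁻¹ • ∑ k ∈ Finset.Icc 1 K, p k‖ ^ 2 / 2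
      ≤ (K : ℝ)⁻¹ * ∑ k ∈ Finset.Icc 1 K, breg d d' z (p k) := by
  have hK' : (0 : ℝ) < K := by exact_mod_cast hK
  -- Three-point identity: the linear terms d′(p_k)(b − z) add up to K d′(b)(b − z) by the choice of
  -- `b`, so the sum splits exactly. The leftover divergences D(b, p_k) produce the gain.
  have hsum : ∑ k ∈ Finset.Icc 1 K, breg d d' z (p k)
      = K * breg d d' z b + ∑ k ∈ Finset.Icc 1 K, breg d d' b (p k) := by
    have h1 : ∑ k ∈ Finset.Icc 1 K, d' (p k) (b - z) = K * d' b (b - z) := by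
      rw [hbp]
      simp
      field_simp
    have h2 : ∀ k, breg d d' z (p k)
        = breg d d' b (p k) + d' (p k) (b - z) + ((d z).toReal - (d b).toReal) := fun k => by
      have : d' (p k) (b - z) = d' (p k) (b - p k) - d' (p k) (z - p k) := by
        rw [← map_sub]; congr 1; abel
      unfold breg
      rw [this]; ring
    simp only [h2, Finset.sum_add_distrib, h1, Finset.sum_const, Nat.card_Icc, nsmul_eq_mul]
    have h3 : d' b (b - z) = -d' b (z - b) := by rw [← map_neg, neg_sub]
    rw [h3]
    unfold breg
    simp only [Nat.add_sub_cancel]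
    ring
  have hnorm : K * ‖b - (K : ℝ)⁻¹ • ∑ k ∈ Finset.Icc 1 K, p k‖
      ≤ ∑ k ∈ Finset.Icc 1 K, ‖b - p k‖ := by
    have : (K : ℝ) • (b - (K : ℝ)⁻¹ • ∑ k ∈ Finset.Icc 1 K, p k)
        = ∑ k ∈ Finset.Icc 1 K, (b - p k) := by
      rw [smul_sub, smul_smul, mul_inv_cancel₀ hK'.ne', one_smul, Finset.sum_sub_distrib]
      simp [Nat.cast_smul_eq_nsmul]
    calc _ = ‖(K : ℝ) • (b - (K : ℝ)⁻¹ • ∑ k ∈ Finset.Icc 1 K, p k)‖ := by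
          rw [norm_smul, Real.norm_of_nonneg hK'.le]
      _ ≤ _ := by rw [this]; exact norm_sum_le _ _
  have hsq : (∑ k ∈ Finset.Icc 1 K, ‖b - p k‖) ^ 2 ≤ K * ∑ k ∈ Finset.Icc 1 K, ‖b - p k‖ ^ 2 := by
    simpa using sq_sum_le_card_mul_sum_sq (s := Finset.Icc 1 K) (f := fun k => ‖b - p k‖)
  have hbr : ∑ k ∈ Finset.Icc 1 K, ‖b - p k‖ ^ 2 ≤ 2 * ∑ k ∈ Finset.Icc 1 K, breg d d' b (p k) := by
    rw [Finset.mul_sum]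
    exact Finset.sum_le_sum fun k hk => by
      linarith [hd.half_sq_le_breg (hd.subdiffDom_subset hb) (hp k hk)]
  have hfin : K * ‖b - (K : ℝ)⁻¹ • ∑ k ∈ Finset.Icc 1 K, p k‖ ^ 2
      ≤ 2 * ∑ k ∈ Finset.Icc 1 K, breg d d' b (p k) := by
    have h1 : (K * ‖b - (K : ℝ)⁻¹ • ∑ k ∈ Finset.Icc 1 K, p k‖) ^ 2
        ≤ K * (2 * ∑ k ∈ Finset.Icc 1 K, breg d d' b (p k)) :=
      (pow_le_pow_left₀ (by positivity) hnorm 2).trans (hsq.trans (by gcongr))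
    rw [mul_pow, pow_two, mul_assoc] at h1
    exact le_of_mul_le_mul_left h1 hK'
  rw [hsum, mul_add, inv_mul_cancel_left₀ hK'.ne', add_le_add_iff_left, inv_mul_eq_div,
    le_div_iff₀ hK']
  linarith

end DGF

end ConvexAnalysis

/-! ### The hierarchical problem: real-valued bounds -/

section Deterministic

variable {X : Type*} [NormedAddCommGroup X] [NormedSpace ℝ X]

theorem IsGammaZero.bifun_eq {g : X → EReal} (hg : IsGammaZero g) (F : X → StrongDual ℝ X)
    {x y : X} (hx : x ∈ edom g) (hy : y ∈ edom g) :
    bifun F g x y = ((F y (x - y) + (g x).toReal - (g y).toReal : ℝ) : EReal) := by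
  rw [bifun, EReal.coe_sub, EReal.coe_add, hg.coe_toReal hx, hg.coe_toReal hy]

theorem IsMonotoneOp.apply_sub_le {F : X → StrongDual ℝ X} (hF : IsMonotoneOp F) (x y : X) :
    F y (x - y) ≤ F x (x - y) := by
  have := hF x y
  simp only [sub_apply] at this
  linarith

namespace HVI

variable {P : HVI X}

theorem Standing.convex_Z (hP : P.Standing) : Convex ℝ P.Z :=
  hP.gamma₁.convexOn.1.inter hP.gamma₂.convexOn.1

theorem Standing.convexOn_G (hP : P.Standing) {β : ℝ} (hβ : 0 ≤ β) : ConvexOn ℝ P.Z (P.G β) :=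
  ((hP.gamma₁.convexOn.subset Set.inter_subset_left hP.convex_Z).smul hβ).add
    (hP.gamma₂.convexOn.subset Set.inter_subset_right hP.convex_Z)

theorem Standing.S₂_subset (hP : P.Standing) : P.S₂ ⊆ edom P.g₂ :=
  fun _ hx => hP.gamma₂.mem_edom_of_mem_subdiff hx

theorem Standing.S₁_subset_Z (hP : P.Standing) : P.S₁ ⊆ P.Z :=
  fun _ hx => ⟨hx.2.1, hP.S₂_subset hx.1⟩

/-- At lower-level solutions the lower-level bifunction is nonnegative. -/
theorem Standing.bifun₂_nonneg (hP : P.Standing) {x z : X} (hx : x ∈ edom P.g₂)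
    (hz : z ∈ P.S₂) : 0 ≤ P.F₂ z (x - z) + (P.g₂ x).toReal - (P.g₂ z).toReal := by
  have := hP.gamma₂.le_of_mem_subdiff hz hx
  simp only [neg_apply] at this
  linarith

theorem IsMultiplier.mem_S₂ {x : X} {p : StrongDual ℝ X} (h : P.IsMultiplier x p) : x ∈ P.S₂ :=
  h.1.1

theorem IsMultiplier.mem_Z (hP : P.Standing) {x : X} {p : StrongDual ℝ X}
    (h : P.IsMultiplier x p) : x ∈ P.Z :=
  ⟨hP.gamma₁.mem_edom_of_mem_subdiff h.2, hP.S₂_subset h.mem_S₂⟩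

theorem IsMultiplier.neg_apply_le (hP : P.Standing) {x y : X} {p : StrongDual ℝ X}
    (h : P.IsMultiplier x p) (hy : y ∈ edom P.g₁) :
    -p (y - x) ≤ P.F₁ x (y - x) + (P.g₁ y).toReal - (P.g₁ x).toReal := by
  have := hP.gamma₁.le_of_mem_subdiff h.2 hy
  simp only [neg_apply, sub_apply] at this
  linarith

/-- A normal vector attains its support function at its base point. -/
theorem IsMultiplier.supp_eq {x : X} {p : StrongDual ℝ X} (h : P.IsMultiplier x p) {β : ℝ}
    (hβ : 0 ≤ β) : supp (β • p) P.S₂ = ((β * p x : ℝ) : EReal) := by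
  refine le_antisymm (iSup₂_le fun z hz => ?_) (le_iSup₂_of_le x h.mem_S₂ (by simp))
  have := h.1.2 z hz
  rw [map_sub] at this
  have h2 : (β • p) z ≤ β * p x := by
    simp only [smul_apply, smul_eq_mul]; nlinarith
  exact_mod_cast h2

/-- Use the pair (x, y) as a competitor in the two suprema defining `h`; the subtracted support
function equals β p(x). -/
theorem IsMultiplier.le_toReal_h (hP : P.Standing) {x y : X} {p : StrongDual ℝ X}
    (h : P.IsMultiplier x p) {β : ℝ} (hβ : 0 ≤ β) (hh : P.h (β • p) ≠ ⊤) (hy : y ∈ edom P.g₂) :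
    P.F₂ y (x - y) + (P.g₂ x).toReal - (P.g₂ y).toReal + β * p (y - x)
      ≤ (P.h (β • p)).toReal := by
  have h1 : ((P.F₂ y (x - y) + (P.g₂ x).toReal - (P.g₂ y).toReal + β * p y : ℝ) : EReal)
      ≤ ⨆ x ∈ P.S₂, fitz P.F₂ P.g₂ x (β • p) := by
    refine le_iSup₂_of_le x h.mem_S₂ (le_iSup₂_of_le y hy ?_)
    rw [hP.gamma₂.bifun_eq _ (hP.S₂_subset h.mem_S₂) hy, ← EReal.coe_add]
    exact le_rfl
  have h2 : ((P.F₂ y (x - y) + (P.g₂ x).toReal - (P.g₂ y).toReal + β * p (y - x) : ℝ) : EReal)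
      ≤ P.h (β • p) := by
    unfold HVI.h
    rw [h.supp_eq hβ]
    calc _ = ((P.F₂ y (x - y) + (P.g₂ x).toReal - (P.g₂ y).toReal + β * p y : ℝ) : EReal)
          - ((β * p x : ℝ) : EReal) := by
          rw [← EReal.coe_sub, map_sub p]; congr 1; ring
      _ ≤ _ := EReal.sub_le_sub h1 le_rfl
  have := EReal.toReal_le_toReal h2 (EReal.coe_ne_bot _) hh
  rwa [EReal.toReal_coe] at this

theorem IsMultiplier.toReal_h_nonneg (hP : P.Standing) {x : X} {p : StrongDual ℝ X}
    (h : P.IsMultiplier x p) {β : ℝ} (hβ : 0 ≤ β) (hh : P.h (β • p) ≠ ⊤) :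
    0 ≤ (P.h (β • p)).toReal := by
  simpa using h.le_toReal_h hP hβ hh (hP.S₂_subset h.mem_S₂)

/-- The regularized primal residual at the solution is bounded below through `h`. -/
theorem IsMultiplier.neg_toReal_h_le (hP : P.Standing) {x y : X} {p : StrongDual ℝ X}
    (h : P.IsMultiplier x p) {β : ℝ} (hβ : 0 ≤ β) (hh : P.h (β • p) ≠ ⊤) (hy : y ∈ P.Z) :
    -(P.h (β • p)).toReal ≤ P.V β y (y - x) + P.G β y - P.G β x := by
  have h1 := h.le_toReal_h hP hβ hh hy.2
  have h2 := h.neg_apply_le hP hy.1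
  have h3 := hP.mono₁.apply_sub_le y x
  have h4 : P.F₂ y (x - y) = -P.F₂ y (y - x) := by rw [← map_neg, neg_sub]
  have h5 : β * -p (y - x) ≤ β * (P.F₁ y (y - x) + (P.g₁ y).toReal - (P.g₁ x).toReal) := by
    gcongr; linarith
  simp only [V, G, add_apply, smul_apply, smul_eq_mul]
  linarith

/-- The regularized residual dominates both gap integrands. -/
theorem Standing.regularized_le (hP : P.Standing) {β : ℝ} (hβ : 0 ≤ β) (y z : X) :
    β * (P.F₁ z (y - z) + (P.g₁ y).toReal - (P.g₁ z).toReal)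
      + (P.F₂ z (y - z) + (P.g₂ y).toReal - (P.g₂ z).toReal)
      ≤ P.V β y (y - z) + P.G β y - P.G β z := by
  have h3 := mul_le_mul_of_nonneg_left (hP.mono₁.apply_sub_le y z) hβ
  have h4 := hP.mono₂.apply_sub_le y z
  simp only [V, G, add_apply, smul_apply, smul_eq_mul]
  linarith

/-- The vectors −F₁(x) − p and −F₂(x) are subgradients of the two functions at x. The resulting
linear lower bound on `G` is what the moment estimates for the iterates need. -/
theorem IsMultiplier.G_sub_le (hP : P.Standing) {x y : X} {p : StrongDual ℝ X}
    (h : P.IsMultiplier x p) {β : ℝ} (hβ : 0 ≤ β) (hy : y ∈ P.Z) :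
    P.G β x - P.G β y ≤ (‖β • (P.F₁ x + p) + P.F₂ x‖) * ‖y - x‖ := by
  have h1 := mul_le_mul_of_nonneg_left (h.neg_apply_le hP hy.1) hβ
  have h2 := hP.bifun₂_nonneg hy.2 h.mem_S₂
  have h3 := (le_abs_self _).trans ((β • (P.F₁ x + p) + P.F₂ x).le_opNorm (y - x))
  simp only [add_apply, smul_apply, smul_eq_mul] at h3
  simp only [G]
  linarith

/-! ### Mirror steps -/

variable {d : X → EReal} {d' : X → StrongDual ℝ X} {α τ β : ℝ} {v : StrongDual ℝ X} {a b y : X}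

section

variable (P d d')

/-- The mirror-step objective without the distance-generating function. -/
noncomputable def mirrorPart (α τ β : ℝ) (v : StrongDual ℝ X) (a b z : X) : ℝ :=
  τ * P.G β z + τ * v z - α * ((d a).toReal + d' a (z - a))
    - (1 - α) * ((d b).toReal + d' b (z - b))

/-- The weights α and 1 − α add up to one, so `d` itself enters the objective exactly once and the
rest is affine plus τG. -/
theorem mirrorPart_add (α τ β : ℝ) (v : StrongDual ℝ X) (a b z : X) :
    P.mirrorPart d d' α τ β v a b z + (d z).toReal
      = τ * P.G β z + τ * v z + α * breg d d' z a + (1 - α) * breg d d' z b := by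
  unfold mirrorPart breg; ring

end

theorem Standing.convexOn_mirrorPart (hP : P.Standing) (hτ : 0 ≤ τ) (hβ : 0 ≤ β) :
    ConvexOn ℝ P.Z (P.mirrorPart d d' α τ β v a b) := by
  have h := (hP.convexOn_G hβ).smul hτ
  refine ⟨h.1, fun x hx z hz s t hs ht hst => ?_⟩
  have h1 := h.2 hx hz hs ht hst
  have h2 : s • x + t • z - a = s • (x - a) + t • (z - a) := by
    obtain rfl : t = 1 - s := by linarith
    module
  have h3 : s • x + t • z - b = s • (x - b) + t • (z - b) := by
    obtain rfl : t = 1 - s := by linarith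
    module
  unfold mirrorPart
  rw [h2, h3]
  simp only [map_add, map_smul, smul_eq_mul] at h1 ⊢
  obtain rfl : t = 1 - s := by linarith
  linarith

theorem IsMirrorStep.isMinOn (h : P.IsMirrorStep d d' α τ β v a b y) :
    IsMinOn (fun z => P.mirrorPart d d' α τ β v a b z + (d z).toReal) P.Z y := by
  simp only [mirrorPart_add]
  exact h.2

/-- The full divergence D(z, y) is gained, at the price of a subgradient of `d` at `y`; this form
serves the update points. -/
theorem IsMirrorStep.add_breg_le [FiniteDimensional ℝ X] (hP : P.Standing) (hd : IsDGF P.Z d d')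
    (hτ : 0 ≤ τ) (hβ : 0 ≤ β)
    (h : P.IsMirrorStep d d' α τ β v a b y) (hy : y ∈ subdiffDom d) {z : X} (hz : z ∈ P.Z) :
    τ * P.G β y + τ * v y + α * breg d d' y a + (1 - α) * breg d d' y b + breg d d' z y
      ≤ τ * P.G β z + τ * v z + α * breg d d' z a + (1 - α) * breg d d' z b := by
  have := hd.le_add_of_isMinOn hd.feasible (hP.convexOn_mirrorPart hτ hβ) h.1 hz hy h.isMinOn
  rw [← mirrorPart_add, ← mirrorPart_add]
  unfold breg
  linarith

/-- This form serves the extrapolation points, which are not assumed to lie in the domain of ∂d: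
quadratic growth needs no subgradient. -/
theorem IsMirrorStep.add_half_sq_le (hP : P.Standing) (hd : IsDGF P.Z d d')
    (hτ : 0 ≤ τ) (hβ : 0 ≤ β)
    (h : P.IsMirrorStep d d' α τ β v a b y) {z : X} (hz : z ∈ P.Z) :
    τ * P.G β y + τ * v y + α * breg d d' y a + (1 - α) * breg d d' y b + ‖z - y‖ ^ 2 / 2
      ≤ τ * P.G β z + τ * v z + α * breg d d' z a + (1 - α) * breg d d' z b := by
  have := hd.half_sq_add_le_of_isMinOn hd.feasible (hP.convexOn_mirrorPart hτ hβ) h.1 hz h.isMinOn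
  rw [← mirrorPart_add, ← mirrorPart_add]
  exact this

theorem apply_le_half_sq (u : StrongDual ℝ X) (τ : ℝ) (z : X) :
    τ * u z ≤ τ ^ 2 / 2 * ‖u‖ ^ 2 + ‖z‖ ^ 2 / 2 := by
  have h1 : |τ * u z| ≤ (|τ| * ‖u‖) * ‖z‖ := by
    rw [abs_mul, mul_assoc]; gcongr; exact u.le_opNorm z
  have h2 := two_mul_le_add_sq (|τ| * ‖u‖) ‖z‖
  rw [mul_pow, sq_abs] at h2
  linarith [le_abs_self (τ * u z)]

/-- One inner iteration of the variance-reduced mirror-prox method. The number `A` bounds the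
divergence to the mirror snapshot `b` with the gain measured at the snapshot `w`. -/
theorem innerStep_le [FiniteDimensional ℝ X] (hP : P.Standing) (hd : IsDGF P.Z d d')
    (hα0 : 0 ≤ α) (hα1 : α ≤ 1) (hτ : 0 ≤ τ) (hβ : 0 ≤ β) {w x' z : X} {ζy ζw : StrongDual ℝ X}
    {A : ℝ} (ha : a ∈ subdiffDom d) (hb : b ∈ subdiffDom d)
    (hA : breg d d' z b + ‖b - w‖ ^ 2 / 2 ≤ A)
    (hy : P.IsMirrorStep d d' α τ β (P.V β w) a b y)
    (hx : P.IsMirrorStep d d' α τ β (P.V β w + ζy - ζw) a b x') (hx' : x' ∈ subdiffDom d)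
    (hz : z ∈ P.Z) :
    τ * (P.V β y (y - z) + P.G β y - P.G β z) + breg d d' z x'
      ≤ α * breg d d' z a + (1 - α) * A + τ * (P.V β w + ζy - ζw - P.V β y) (z - y)
        + τ ^ 2 / 2 * ‖ζy - ζw‖ ^ 2 - (1 - α) / 4 * ‖y - w‖ ^ 2 := by
  have h1 := hx.add_breg_le hP hd hτ hβ hx' hz
  -- Testing the extrapolation step at `x'` makes the divergences D(x′, a) and D(x′, b) cancel
  -- against those in `h1`; the term ‖x′ − y‖²/2 gained here pays for the oracle difference in `h5`.
  have h2 := hy.add_half_sq_le hP hd hτ hβ hx.1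
  have h3 := hd.breg_nonneg (hd.feasible hy.1) ha
  have h4 := hd.half_sq_le_breg (hd.feasible hy.1) hb
  have h5 := apply_le_half_sq (ζy - ζw) τ (y - x')
  rw [norm_sub_rev y x'] at h5
  -- The divergence D(y, b) measures distance to the mirror snapshot; the gain in `hA` transfers it
  -- to the snapshot `w` where the oracle is evaluated, whence the factor 1/4.
  have h6 : ‖y - w‖ ^ 2 ≤ 2 * ‖y - b‖ ^ 2 + 2 * ‖b - w‖ ^ 2 := by
    have : ‖y - w‖ ≤ ‖y - b‖ + ‖b - w‖ := norm_sub_le_norm_sub_add_norm_sub _ _ _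
    nlinarith [sq_nonneg (‖y - b‖ - ‖b - w‖), norm_nonneg (y - w), norm_nonneg (y - b),
      norm_nonneg (b - w)]
  have h7 := mul_le_mul_of_nonneg_left hA (sub_nonneg.2 hα1)
  have h8 := mul_le_mul_of_nonneg_left h4 (sub_nonneg.2 hα1)
  have h9 := mul_le_mul_of_nonneg_left h6 (sub_nonneg.2 hα1)
  have h10 := mul_nonneg hα0 h3
  simp only [add_apply, sub_apply, map_sub]
    at h1 h2 h5 ⊢
  linarith

/-- Deterministic control of the extrapolation point. -/
theorem extrapolation_le (hP : P.Standing) (hd : IsDGF P.Z d d')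
    (hα0 : 0 ≤ α) (hα1 : α ≤ 1) (hτ : 0 ≤ τ) (hβ : 0 ≤ β) {w z : X}
    {A : ℝ} (ha : a ∈ subdiffDom d) (hb : b ∈ subdiffDom d)
    (hA : breg d d' z b ≤ A)
    (hy : P.IsMirrorStep d d' α τ β (P.V β w) a b y) (hz : z ∈ P.Z) :
    ‖y - z‖ ^ 2 / 2 + τ * (P.G β y - P.G β z)
      ≤ τ * ‖P.V β w‖ * ‖y - z‖ + α * breg d d' z a + (1 - α) * A := by
  have h2 := hy.add_half_sq_le hP hd hτ hβ hz
  have h3 := mul_nonneg hα0 (hd.breg_nonneg (hd.feasible hy.1) ha)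
  have h4 := mul_nonneg (sub_nonneg.2 hα1) (hd.breg_nonneg (hd.feasible hy.1) hb)
  have h7 := mul_le_mul_of_nonneg_left hA (sub_nonneg.2 hα1)
  have h8 : P.V β w z - P.V β w y ≤ ‖P.V β w‖ * ‖y - z‖ := by
    rw [← map_sub, norm_sub_rev]
    exact (le_abs_self _).trans ((P.V β w).le_opNorm _)
  have h9 := mul_le_mul_of_nonneg_left h8 hτ
  rw [norm_sub_rev z y] at h2
  linarith

end HVI

end Deterministic

set_option linter.unusedSectionVars false

/-! ### The sampling oracle along a run -/

section Stochastic

variable {X : Type u} [NormedAddCommGroup X] [NormedSpace ℝ X]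

theorem HVI.Standing.continuous_V {P : HVI X} (hP : P.Standing) (β : ℝ) : Continuous (P.V β) := by
  obtain ⟨L₁, h₁⟩ := hP.lip₁
  obtain ⟨L₂, h₂⟩ := hP.lip₂
  exact (h₁.continuous.const_smul β).add h₂.continuous

theorem HVI.Standing.exists_norm_V_le {P : HVI X} (hP : P.Standing) (β : ℝ) (a : X) :
    ∃ C : ℝ, 0 ≤ C ∧ ∀ x, ‖P.V β x‖ ≤ C * (1 + ‖x - a‖) := by
  obtain ⟨L₁, h₁⟩ := hP.lip₁
  obtain ⟨L₂, h₂⟩ := hP.lip₂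
  refine ⟨‖P.V β a‖ + (|β| * L₁ + L₂), by positivity, fun x => ?_⟩
  have e : P.V β x = P.V β a + (β • (P.F₁ x - P.F₁ a) + (P.F₂ x - P.F₂ a)) := by
    simp only [HVI.V, smul_sub]; abel
  have h3 : ‖P.V β x‖ ≤ ‖P.V β a‖ + (|β| * (L₁ * ‖x - a‖) + L₂ * ‖x - a‖) := by
    rw [e]
    refine (norm_add_le _ _).trans (add_le_add le_rfl ((norm_add_le _ _).trans ?_))
    rw [norm_smul, Real.norm_eq_abs]
    gcongr
    · exact h₁.norm_sub_le x a
    · exact h₂.norm_sub_le x a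
  have h4 : (0 : ℝ) ≤ (|β| * L₁ + L₂) := by positivity
  have := mul_nonneg (norm_nonneg (P.V β a)) (norm_nonneg (x - a))
  linarith

variable [FiniteDimensional ℝ X] [MeasurableSpace X] [BorelSpace X]

theorem measurable_dual_apply {Ω : Type*} {m : MeasurableSpace Ω} {φ : Ω → StrongDual ℝ X}
    {v : Ω → X} (hφ : Measurable φ) (hv : Measurable v) : Measurable fun ω => φ ω (v ω) :=
  (isBoundedBilinearMap_apply (𝕜 := ℝ) (E := X) (F := ℝ)).continuous.measurable.comp
    (hφ.prodMk hv)

/-- The mean operator is Lipschitz with the mean-square Lipschitz constant of the oracle. -/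
theorem StochasticOracle.norm_sub_le {Z : Set X} {V : ℕ → X → StrongDual ℝ X}
    (O : StochasticOracle.{u, v} Z V) (s : ℕ) {x y : X} (hx : x ∈ Z) (hy : y ∈ Z) :
    ‖V s x - V s y‖ ≤ O.L s * ‖x - y‖ := by
  have := O.markov s
  obtain ⟨i1, e1⟩ := O.unbiased_left s x hx y hy
  obtain ⟨i2, e2⟩ := O.unbiased_right s x hx y hy
  have h1 : ‖V s x - V s y‖ₑ ≤ eLpNorm (fun ζ => O.Vξ s ζ x - O.Vξ s ζ y) 2 (O.Q s (x, y)) := by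
    rw [← e1, ← e2, ← integral_sub i1 i2]
    refine (enorm_integral_le_lintegral_enorm _).trans ?_
    rw [← eLpNorm_one_eq_lintegral_enorm]
    exact eLpNorm_le_eLpNorm_of_exponent_le (by norm_num) (i1.sub i2).aestronglyMeasurable
  have h2 : ‖V s x - V s y‖ₑ ^ 2 ≤ ENNReal.ofReal (O.L s ^ 2 * ‖x - y‖ ^ 2) := by
    refine le_trans ?_ (O.mean_lipschitz s x hx y hy)
    refine (pow_le_pow_left' h1 2).trans (le_of_eq ?_)
    rw [eLpNorm_eq_lintegral_rpow_enorm_toReal (by norm_num) (by norm_num), ← ENNReal.rpow_natCast,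
      ← ENNReal.rpow_mul]
    simp
  have hL := (O.L_pos s).le
  rw [← ofReal_norm, ← ENNReal.ofReal_pow (norm_nonneg _),
    ENNReal.ofReal_le_ofReal_iff (by positivity), ← mul_pow] at h2
  exact le_of_sq_le_sq h2 (by positivity)

namespace MirrorProxRun

variable {P : HVI X} {d : X → EReal} {d' : X → StrongDual ℝ X} {α : ℝ} {τ β : ℕ → ℝ} {x₀ : X}
  {K : ℕ} {O : StochasticOracle.{u, v} P.Z (fun s => P.V (β s))}
  (r : MirrorProxRun.{u, v, w} P d d' α τ β x₀ K O)

/-- The inner iterates of the previous epoch, with the starting point before the first epoch. -/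
def prev : ℕ → ℕ → r.Ω → X
  | 0, _, _ => x₀
  | s + 1, j, ω => r.x s j ω

/-- The oracle difference `V^ξ(y) - V^ξ(w)` at an inner iteration. -/
def oracleDiff (s k : ℕ) (ω : r.Ω) : StrongDual ℝ X :=
  O.Vξ s (r.ξ s k ω) (r.y s (k + 1) ω) - O.Vξ s (r.ξ s k ω) (r.w s ω)

/-- The stochastic error `A - V(y)` of the update direction. -/
def noise (s k : ℕ) (ω : r.Ω) : StrongDual ℝ X :=
  P.V (β s) (r.w s ω) + O.Vξ s (r.ξ s k ω) (r.y s (k + 1) ω) - O.Vξ s (r.ξ s k ω) (r.w s ω)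
    - P.V (β s) (r.y s (k + 1) ω)

theorem w_eq (hK : 1 ≤ K) (s : ℕ) (ω : r.Ω) :
    r.w s ω = (K : ℝ)⁻¹ • ∑ j ∈ Finset.Icc 1 K, r.prev s j ω := by
  have hK' : (K : ℝ) ≠ 0 := by positivity
  cases s with
  | zero =>
    simp [prev, r.init_w, ← Nat.cast_smul_eq_nsmul ℝ, smul_smul, inv_mul_cancel₀ hK']
  | succ s => exact r.epoch_w s ω

theorem dual_wbar_eq (hK : 1 ≤ K) (s : ℕ) (ω : r.Ω) :
    d' (r.wbar s ω) = (K : ℝ)⁻¹ • ∑ j ∈ Finset.Icc 1 K, d' (r.prev s j ω) := by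
  have hK' : (K : ℝ) ≠ 0 := by positivity
  cases s with
  | zero =>
    simp [prev, r.init_wbar, ← Nat.cast_smul_eq_nsmul ℝ, smul_smul, inv_mul_cancel₀ hK']
  | succ s => exact r.epoch_wbar s ω

theorem prev_mem_subdiffDom (hx₀' : x₀ ∈ subdiffDom d) (s : ℕ) {j : ℕ} (hj : j ≤ K) (ω : r.Ω) :
    r.prev s j ω ∈ subdiffDom d := by
  cases s with
  | zero => exact hx₀'
  | succ s => exact r.x_mem s j ω hj

theorem prev_mem_Z (hx₀ : x₀ ∈ P.Z) (s : ℕ) {j : ℕ} (hj1 : 1 ≤ j) (hj : j ≤ K) (ω : r.Ω) :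
    r.prev s j ω ∈ P.Z := by
  cases s with
  | zero => exact hx₀
  | succ s =>
    obtain ⟨k, rfl⟩ := Nat.exists_eq_add_of_le' hj1
    exact (r.step_x s k ω (by omega)).1

theorem w_mem_Z (hP : P.Standing) (hK : 1 ≤ K) (hx₀ : x₀ ∈ P.Z) (s : ℕ) (ω : r.Ω) :
    r.w s ω ∈ P.Z := by
  have hK' : (K : ℝ) ≠ 0 := by positivity
  rw [r.w_eq hK, Finset.smul_sum]
  refine hP.convex_Z.sum_mem (fun _ _ => by positivity) (by simp [hK']) fun j hj => ?_
  rw [Finset.mem_Icc] at hj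
  exact r.prev_mem_Z hx₀ s hj.1 hj.2 ω

theorem y_mem_Z (s : ℕ) {k : ℕ} (hk : k < K) (ω : r.Ω) : r.y s (k + 1) ω ∈ P.Z :=
  (r.step_y s k ω hk).1

theorem measurable_prev (s : ℕ) {j : ℕ} (hj : j ≤ K) : Measurable (r.prev s j) := by
  cases s with
  | zero => exact measurable_const
  | succ s => exact r.measurable_x s j hj

theorem measurable_w (hK : 1 ≤ K) (s : ℕ) : Measurable (r.w s) := by
  have : r.w s = fun ω => (K : ℝ)⁻¹ • ∑ j ∈ Finset.Icc 1 K, r.prev s j ω :=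
    funext fun ω => r.w_eq hK s ω
  rw [this]
  refine Measurable.const_smul (Finset.measurable_sum _ fun j hj => ?_) _
  exact r.measurable_prev s (Finset.mem_Icc.1 hj).2

/-! #### Measurability with respect to the history -/

/-- The past of the sample drawn at the inner iteration `(s, k)`. -/
@[reducible] def past (s k : ℕ) : MeasurableSpace r.Ω := history K r.ξ r.x r.y s k

theorem past_le (s : ℕ) {k : ℕ} (hk : k < K) : r.past s k ≤ r.mΩ := by
  refine sup_le (iSup_le fun t => iSup_le fun j => iSup_le fun h => ?_)
    (r.measurable_y s k hk).comap_le
  have hj : j < K := by omega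
  exact sup_le (sup_le (r.measurable_ξ t j hj).comap_le
    (r.measurable_x t (j + 1) (by omega)).comap_le) (r.measurable_y t j hj).comap_le

theorem comap_le_past {s k t j : ℕ} (h : (t < s ∧ j < K) ∨ (t = s ∧ j < k)) :
    MeasurableSpace.comap (r.ξ t j) inferInstance ⊔
      MeasurableSpace.comap (r.x t (j + 1)) inferInstance ⊔
      MeasurableSpace.comap (r.y t (j + 1)) inferInstance ≤ r.past s k :=
  le_trans (le_iSup_of_le t (le_iSup_of_le j (le_iSup_of_le (f := fun _ => _) h le_rfl))) le_sup_left

theorem measurable_past_ξ {s k t j : ℕ} (h : (t < s ∧ j < K) ∨ (t = s ∧ j < k)) :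
    Measurable[r.past s k] (r.ξ t j) :=
  Measurable.of_comap_le (le_trans (le_trans le_sup_left le_sup_left) (r.comap_le_past h))

theorem measurable_past_x {s k t j : ℕ} (h : (t < s ∧ j < K) ∨ (t = s ∧ j < k)) :
    Measurable[r.past s k] (r.x t (j + 1)) :=
  Measurable.of_comap_le (le_trans (le_trans le_sup_right le_sup_left) (r.comap_le_past h))

theorem measurable_past_y {s k t j : ℕ} (h : (t < s ∧ j < K) ∨ (t = s ∧ j < k)) :
    Measurable[r.past s k] (r.y t (j + 1)) :=
  Measurable.of_comap_le (le_trans le_sup_right (r.comap_le_past h))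

theorem measurable_past_y_self (s k : ℕ) : Measurable[r.past s k] (r.y s (k + 1)) :=
  Measurable.of_comap_le le_sup_right

theorem measurable_past_w (hK : 1 ≤ K) {s k t : ℕ} (ht : t ≤ s) :
    Measurable[r.past s k] (r.w t) := by
  have : r.w t = fun ω => (K : ℝ)⁻¹ • ∑ j ∈ Finset.Icc 1 K, r.prev t j ω :=
    funext fun ω => r.w_eq hK t ω
  rw [this]
  refine Measurable.const_smul (Finset.measurable_sum _ fun j hj => ?_) _
  rw [Finset.mem_Icc] at hj
  cases t with
  | zero => exact measurable_const
  | succ t =>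
    obtain ⟨i, rfl⟩ := Nat.exists_eq_add_of_le' hj.1
    exact r.measurable_past_x (Or.inl ⟨by omega, by omega⟩)

theorem measurable_noise_of {m : MeasurableSpace r.Ω} (hP : P.Standing) {s k : ℕ}
    (hξ : Measurable[m] (r.ξ s k)) (hy : Measurable[m] (r.y s (k + 1)))
    (hw : Measurable[m] (r.w s)) : Measurable[m] (r.noise s k) := by
  have hV := (hP.continuous_V (β s)).measurable
  have h1 : Measurable[m] fun ω => O.Vξ s (r.ξ s k ω) (r.y s (k + 1) ω) :=
    (O.measurable_Vξ s).comp (hξ.prodMk hy)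
  have h2 : Measurable[m] fun ω => O.Vξ s (r.ξ s k ω) (r.w s ω) :=
    (O.measurable_Vξ s).comp (hξ.prodMk hw)
  exact (((hV.comp hw).add h1).sub h2).sub (hV.comp hy)

theorem measurable_noise (hP : P.Standing) (hK : 1 ≤ K) (s : ℕ) {k : ℕ} (hk : k < K) :
    Measurable (r.noise s k) :=
  r.measurable_noise_of hP (r.measurable_ξ s k hk) (r.measurable_y s k hk) (r.measurable_w hK s)

theorem measurable_past_noise (hP : P.Standing) (hK : 1 ≤ K) {s k t j : ℕ}
    (h : (t < s ∧ j < K) ∨ (t = s ∧ j < k)) : Measurable[r.past s k] (r.noise t j) :=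
  r.measurable_noise_of hP (r.measurable_past_ξ h) (r.measurable_past_y h)
    (r.measurable_past_w hK (by omega))

theorem measurable_oracleDiff (hK : 1 ≤ K) (s : ℕ) {k : ℕ} (hk : k < K) :
    Measurable (r.oracleDiff s k) :=
  ((O.measurable_Vξ s).comp ((r.measurable_ξ s k hk).prodMk (r.measurable_y s k hk))).sub
    ((O.measurable_Vξ s).comp ((r.measurable_ξ s k hk).prodMk (r.measurable_w hK s)))

/-! #### Conditional expectations -/

/-- Joint law of a history-measurable variable and of the sample. -/
theorem map_sample (hK : 1 ≤ K) (s : ℕ) {k : ℕ} (hk : k < K) {T : Type*} [MeasurableSpace T]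
    {v : r.Ω → T} (hv : Measurable[r.past s k] v) :
    r.μ.map (fun ω => ((v ω, (r.y s (k + 1) ω, r.w s ω)), r.ξ s k ω))
      = (r.μ.map fun ω => (v ω, (r.y s (k + 1) ω, r.w s ω)))
        ⊗ₘ ((O.Q s).comap Prod.snd measurable_snd) := by
  have := r.prob
  have := O.markov s
  have hW : Measurable[r.past s k] fun ω => (v ω, (r.y s (k + 1) ω, r.w s ω)) :=
    hv.prodMk ((r.measurable_past_y_self s k).prodMk (r.measurable_past_w hK le_rfl))
  have hW' := hW.mono (r.past_le s hk) le_rfl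
  have hξ := r.measurable_ξ s k hk
  have : IsProbabilityMeasure
      (r.μ.map (fun ω => ((v ω, (r.y s (k + 1) ω, r.w s ω)), r.ξ s k ω))) :=
    (Measure.isProbabilityMeasure_map (hW'.prodMk hξ).aemeasurable)
  have : IsProbabilityMeasure (r.μ.map fun ω => (v ω, (r.y s (k + 1) ω, r.w s ω))) :=
    Measure.isProbabilityMeasure_map hW'.aemeasurable
  -- On rectangles the claim is the sampling rule applied to the past event that the conditioning
  -- variables lie in `E`.
  refine Measure.ext_prod fun {E A} hE hA => ?_
  rw [Measure.map_apply (hW'.prodMk hξ) (hE.prod hA), Measure.compProd_apply_prod hE hA,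
    setLIntegral_map hE (Kernel.measurable_coe _ hA) hW']
  exact r.sample s k hk A _ hA (hW hE)

/-- Disintegrate over the sample and use the mean-square Lipschitz bound for each fixed pair (y, w).
Working with extended nonnegative integrals avoids assuming integrability, which is deduced from
this bound later. -/
theorem lintegral_oracleDiff_sq_le (hP : P.Standing) (hx₀ : x₀ ∈ P.Z) (hK : 1 ≤ K) (s : ℕ) {k : ℕ}
    (hk : k < K) :
    ∫⁻ ω, ‖r.oracleDiff s k ω‖ₑ ^ 2 ∂r.μ
      ≤ ENNReal.ofReal (O.L s ^ 2) * ∫⁻ ω, ‖r.y s (k + 1) ω - r.w s ω‖ₑ ^ 2 ∂r.μ := by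
  have := r.prob
  have := O.markov s
  have hv : Measurable[r.past s k] fun _ : r.Ω => () := measurable_const
  have hmap := r.map_sample hK s hk hv
  have hW' : Measurable fun ω => ((), (r.y s (k + 1) ω, r.w s ω)) :=
    measurable_const.prodMk ((r.measurable_y s k hk).prodMk (r.measurable_w hK s))
  have : IsProbabilityMeasure (r.μ.map fun ω => ((), (r.y s (k + 1) ω, r.w s ω))) :=
    Measure.isProbabilityMeasure_map hW'.aemeasurable
  set f : (Unit × (X × X)) × O.Ξ → ENNReal :=
    fun q => ‖O.Vξ s q.2 q.1.2.1 - O.Vξ s q.2 q.1.2.2‖ₑ ^ 2 with hf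
  have hfm : Measurable f := by
    have h1 : Measurable fun q : (Unit × (X × X)) × O.Ξ => O.Vξ s q.2 q.1.2.1 :=
      (O.measurable_Vξ s).comp (measurable_snd.prodMk
        (measurable_fst.comp (measurable_snd.comp measurable_fst)))
    have h2 : Measurable fun q : (Unit × (X × X)) × O.Ξ => O.Vξ s q.2 q.1.2.2 :=
      (O.measurable_Vξ s).comp (measurable_snd.prodMk
        (measurable_snd.comp (measurable_snd.comp measurable_fst)))
    exact (h1.sub h2).enorm.pow_const 2
  calc ∫⁻ ω, ‖r.oracleDiff s k ω‖ₑ ^ 2 ∂r.μ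
      = ∫⁻ q, f q ∂(r.μ.map (fun ω => (((), (r.y s (k + 1) ω, r.w s ω)), r.ξ s k ω))) := by
        rw [lintegral_map hfm (hW'.prodMk (r.measurable_ξ s k hk))]; rfl
    _ = ∫⁻ ω, ∫⁻ ζ, f (((), (r.y s (k + 1) ω, r.w s ω)), ζ)
          ∂(O.Q s (r.y s (k + 1) ω, r.w s ω)) ∂r.μ := by
        rw [hmap, Measure.lintegral_compProd hfm, lintegral_map hfm.lintegral_kernel_prod_right' hW']
        rfl
    _ ≤ ∫⁻ ω, ENNReal.ofReal (O.L s ^ 2) * ‖r.y s (k + 1) ω - r.w s ω‖ₑ ^ 2 ∂r.μ := by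
        refine lintegral_mono fun ω => ?_
        refine (O.mean_lipschitz s _ (r.y_mem_Z s hk ω) _ (r.w_mem_Z hP hK hx₀ s ω)).trans_eq ?_
        rw [ENNReal.ofReal_mul (sq_nonneg _), ENNReal.ofReal_pow (norm_nonneg _),
          ofReal_norm]
    _ = _ := lintegral_const_mul' _ _ ENNReal.ofReal_ne_top

/-- The stochastic error is conditionally centred given the past. -/
theorem integral_noise_apply (hP : P.Standing) (hx₀ : x₀ ∈ P.Z) (hK : 1 ≤ K) (s : ℕ) {k : ℕ}
    (hk : k < K) {v : r.Ω → X} (hv : Measurable[r.past s k] v)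
    (hint : Integrable (fun ω => r.noise s k ω (v ω)) r.μ) :
    ∫ ω, r.noise s k ω (v ω) ∂r.μ = 0 := by
  have := r.prob
  have := O.markov s
  have hmap := r.map_sample hK s hk hv
  have hW' : Measurable fun ω => (v ω, (r.y s (k + 1) ω, r.w s ω)) :=
    (hv.mono (r.past_le s hk) le_rfl).prodMk
      ((r.measurable_y s k hk).prodMk (r.measurable_w hK s))
  have : IsProbabilityMeasure (r.μ.map fun ω => (v ω, (r.y s (k + 1) ω, r.w s ω))) :=
    Measure.isProbabilityMeasure_map hW'.aemeasurable
  set f : (X × (X × X)) × O.Ξ → ℝ :=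
    fun q => (P.V (β s) q.1.2.2 + O.Vξ s q.2 q.1.2.1 - O.Vξ s q.2 q.1.2.2 - P.V (β s) q.1.2.1) q.1.1
    with hf
  have hfm : Measurable f := by
    have hp1 : Measurable fun q : (X × (X × X)) × O.Ξ => q.1.2.1 :=
      measurable_fst.comp (measurable_snd.comp measurable_fst)
    have hp2 : Measurable fun q : (X × (X × X)) × O.Ξ => q.1.2.2 :=
      measurable_snd.comp (measurable_snd.comp measurable_fst)
    have h1 : Measurable fun q : (X × (X × X)) × O.Ξ => O.Vξ s q.2 q.1.2.1 :=
      (O.measurable_Vξ s).comp (measurable_snd.prodMk hp1)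
    have h2 : Measurable fun q : (X × (X × X)) × O.Ξ => O.Vξ s q.2 q.1.2.2 :=
      (O.measurable_Vξ s).comp (measurable_snd.prodMk hp2)
    have hV := (hP.continuous_V (β s)).measurable
    exact measurable_dual_apply ((((hV.comp hp2).add h1).sub h2).sub (hV.comp hp1))
      (measurable_fst.comp measurable_fst)
  have hJ := hW'.prodMk (r.measurable_ξ s k hk)
  have hfi : Integrable f (r.μ.map
      (fun ω => ((v ω, (r.y s (k + 1) ω, r.w s ω)), r.ξ s k ω))) :=
    (integrable_map_measure hfm.aestronglyMeasurable hJ.aemeasurable).2 hint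
  have e1 : ∫ ω, r.noise s k ω (v ω) ∂r.μ
      = ∫ q, f q ∂(r.μ.map (fun ω => ((v ω, (r.y s (k + 1) ω, r.w s ω)), r.ξ s k ω))) := by
    rw [integral_map hJ.aemeasurable hfm.aestronglyMeasurable]; rfl
  rw [e1, hmap, Measure.integral_compProd (hmap ▸ hfi), integral_map hW'.aemeasurable]
  · refine integral_eq_zero_of_ae (Filter.Eventually.of_forall fun ω => ?_)
    obtain ⟨i1, m1⟩ := O.unbiased_left s _ (r.y_mem_Z s hk ω) _ (r.w_mem_Z hP hK hx₀ s ω)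
    obtain ⟨i2, m2⟩ := O.unbiased_right s _ (r.y_mem_Z s hk ω) _ (r.w_mem_Z hP hK hx₀ s ω)
    have i0 := (integrable_const (μ := O.Q s (r.y s (k + 1) ω, r.w s ω)) (P.V (β s) (r.w s ω)))
    have i3 := (integrable_const (μ := O.Q s (r.y s (k + 1) ω, r.w s ω))
      (P.V (β s) (r.y s (k + 1) ω)))
    have hi := ((i0.add i1).sub i2).sub i3
    change ∫ ζ, (P.V (β s) (r.w s ω) + O.Vξ s ζ (r.y s (k + 1) ω) - O.Vξ s ζ (r.w s ω)
      - P.V (β s) (r.y s (k + 1) ω)) (v ω) ∂(O.Q s (r.y s (k + 1) ω, r.w s ω)) = 0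
    have := ContinuousLinearMap.integral_apply hi (v ω)
    refine this.symm.trans ?_
    have e2 : ∫ ζ, (P.V (β s) (r.w s ω) + O.Vξ s ζ (r.y s (k + 1) ω) - O.Vξ s ζ (r.w s ω)
      - P.V (β s) (r.y s (k + 1) ω)) ∂(O.Q s (r.y s (k + 1) ω, r.w s ω)) = 0 := by
      refine (integral_sub ((i0.add i1).sub i2) i3).trans ?_
      rw [integral_sub' (i0.add i1) i2, integral_add' i0 i1, m1, m2]
      simp
    exact congrArg (fun u : StrongDual ℝ X => u (v ω)) e2
  · have hsm : StronglyMeasurable f := hfm.stronglyMeasurable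
    exact (hsm.integral_kernel_prod_right'
      (κ := (O.Q s).comap Prod.snd measurable_snd)).aestronglyMeasurable

end MirrorProxRun

end Stochastic

/-! ### Integrability along a run -/

section SquareIntegrable

theorem memLp_two_of_sq_le {Ω E : Type*} [MeasurableSpace Ω] {μ : Measure Ω}
    [NormedAddCommGroup E] {f : Ω → E} {g : Ω → ℝ}
    (hf : AEStronglyMeasurable f μ) (hg : Integrable g μ) (h : ∀ ω, ‖f ω‖ ^ 2 ≤ g ω) :
    MemLp f 2 μ := by
  rw [memLp_two_iff_integrable_sq_norm hf]
  refine hg.mono' (hf.norm.pow 2) (Filter.Eventually.of_forall fun ω => ?_)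
  rw [Real.norm_of_nonneg (by positivity)]
  exact h ω

theorem integrable_of_le_of_le {Ω : Type*} [MeasurableSpace Ω] {μ : Measure Ω} {f g h : Ω → ℝ}
    (hf : AEStronglyMeasurable f μ) (hg : Integrable g μ) (hh : Integrable h μ)
    (h1 : ∀ ω, g ω ≤ f ω) (h2 : ∀ ω, f ω ≤ h ω) : Integrable f μ := by
  refine (hg.norm.add hh.norm).mono' hf (Filter.Eventually.of_forall fun ω => ?_)
  simp only [Real.norm_eq_abs, Pi.add_apply]
  refine abs_le.2 ⟨?_, ?_⟩
  · linarith [h1 ω, neg_abs_le (g ω), abs_nonneg (h ω)]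
  · linarith [h2 ω, le_abs_self (h ω), abs_nonneg (g ω)]

theorem ofReal_integral_norm_sq {Ω E : Type*} [MeasurableSpace Ω] {μ : Measure Ω}
    [NormedAddCommGroup E] {f : Ω → E} (hf : MemLp f 2 μ) :
    ENNReal.ofReal (∫ ω, ‖f ω‖ ^ 2 ∂μ) = ∫⁻ ω, ‖f ω‖ₑ ^ 2 ∂μ := by
  rw [ofReal_integral_eq_lintegral_ofReal
    ((memLp_two_iff_integrable_sq_norm hf.1).1 hf) (Filter.Eventually.of_forall fun ω => by positivity)]
  refine lintegral_congr fun ω => ?_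
  rw [ENNReal.ofReal_pow (norm_nonneg _), ofReal_norm]

theorem memLp_two_of_lintegral_lt_top {Ω E : Type*} [MeasurableSpace Ω] {μ : Measure Ω}
    [NormedAddCommGroup E] {f : Ω → E} (hf : AEStronglyMeasurable f μ)
    (h : ∫⁻ ω, ‖f ω‖ₑ ^ 2 ∂μ < ⊤) : MemLp f 2 μ := by
  refine ⟨hf, ?_⟩
  rw [eLpNorm_lt_top_iff_lintegral_rpow_enorm_lt_top (by norm_num) (by norm_num)]
  simpa using h

end SquareIntegrable

section Run

variable {X : Type u} [NormedAddCommGroup X] [NormedSpace ℝ X]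
  [FiniteDimensional ℝ X] [MeasurableSpace X] [BorelSpace X]

theorem IsDGF.measurable_breg {Z : Set X} {d : X → EReal} {d' : X → StrongDual ℝ X}
    (hd : IsDGF Z d d') {Ω : Type*} [MeasurableSpace Ω] {f : Ω → X} (hf : Measurable f)
    (hfd : ∀ ω, f ω ∈ subdiffDom d) (z : X) : Measurable fun ω => breg d d' z (f ω) := by
  have h1 : Measurable fun ω => d' (f ω) :=
    (continuousOn_iff_continuous_domRestrict.1 hd.selection_cont).measurable.comp
      (hf.subtype_mk (h := hfd))
  exact (measurable_const.sub (hd.gamma.measurable_toReal.comp hf)).sub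
    (measurable_dual_apply h1 (measurable_const.sub hf))

namespace MirrorProxRun

variable {P : HVI X} {d : X → EReal} {d' : X → StrongDual ℝ X} {α : ℝ} {τ β : ℕ → ℝ} {x₀ : X}
  {K : ℕ} {O : StochasticOracle.{u, v} P.Z (fun s => P.V (β s))}
  (r : MirrorProxRun.{u, v, w} P d d' α τ β x₀ K O) {xs : X} {ps : StrongDual ℝ X}

/-- The assumptions under which a run is analysed, for a solution `xs` with multiplier `ps`. -/
structure Admissible (P : HVI X) (d : X → EReal) (d' : X → StrongDual ℝ X) (α : ℝ) (τ β : ℕ → ℝ)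
    (x₀ : X) (K : ℕ) (O : StochasticOracle.{u, v} P.Z (fun s => P.V (β s)))
    (xs : X) (ps : StrongDual ℝ X) : Prop where
  standing : P.Standing
  dgf : IsDGF P.Z d d'
  α_pos : 0 < α
  α_lt : α < 1
  τ_pos : ∀ s, 0 < τ s
  β_pos : ∀ s, 0 < β s
  start_mem : x₀ ∈ P.Z
  start_subdiff : x₀ ∈ subdiffDom d
  one_le : 1 ≤ K
  step_le : ∀ s, τ s ≤ √(1 - α) / (2 * O.L s)
  multiplier : P.IsMultiplier xs ps
  h_ne_top : ∀ s, P.h (β s • ps) ≠ ⊤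

/-- Average divergence to the inner iterates of the previous epoch. -/
noncomputable def avgBreg (s : ℕ) (z : X) (ω : r.Ω) : ℝ :=
  (K : ℝ)⁻¹ * ∑ j ∈ Finset.Icc 1 K, breg d d' z (r.prev s j ω)

/-- The energy at the beginning of an epoch. -/
noncomputable def energy (s : ℕ) (z : X) (ω : r.Ω) : ℝ :=
  α * breg d d' z (r.x s 0 ω) + (1 - α) * ∑ j ∈ Finset.Icc 1 K, breg d d' z (r.prev s j ω)

/-- The regularized residual `⟨V(y), y - z⟩ + G(y) - G(z)` at an inner iteration. -/
noncomputable def resid (s k : ℕ) (z : X) (ω : r.Ω) : ℝ :=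
  P.V (β s) (r.y s (k + 1) ω) (r.y s (k + 1) ω - z) + P.G (β s) (r.y s (k + 1) ω) - P.G (β s) z

/-- The variance of the direction, net of the gain of the extrapolation. -/
noncomputable def excess (s k : ℕ) (ω : r.Ω) : ℝ :=
  τ s ^ 2 / 2 * ‖r.oracleDiff s k ω‖ ^ 2 - (1 - α) / 4 * ‖r.y s (k + 1) ω - r.w s ω‖ ^ 2

variable {r}

theorem Admissible.sq_step_mul_le (H : Admissible P d d' α τ β x₀ K O xs ps) (s : ℕ) :
    τ s ^ 2 * O.L s ^ 2 ≤ (1 - α) / 4 := by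
  have hL := O.L_pos s
  have h1 := H.step_le s
  rw [le_div_iff₀ (by positivity)] at h1
  have h2 : (τ s * (2 * O.L s)) ^ 2 ≤ 1 - α := by
    rw [← Real.sq_sqrt (sub_nonneg.2 H.α_lt.le)]
    exact pow_le_pow_left₀ (by have := H.τ_pos s; positivity) h1 2
  nlinarith

theorem Admissible.xs_mem_Z (H : Admissible P d d' α τ β x₀ K O xs ps) : xs ∈ P.Z :=
  H.multiplier.mem_Z H.standing

/-! ### Inequalities along a single trajectory. -/

section Pathwise

variable (H : Admissible P d d' α τ β x₀ K O xs ps)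
include H

theorem prev_breg_nonneg (s : ℕ) {j : ℕ} (hj : j ≤ K) {z : X} (hz : z ∈ edom d) (ω : r.Ω) :
    0 ≤ breg d d' z (r.prev s j ω) :=
  H.dgf.breg_nonneg hz (r.prev_mem_subdiffDom H.start_subdiff s hj ω)

theorem breg_wbar_le (s : ℕ) (z : X) (ω : r.Ω) :
    breg d d' z (r.wbar s ω) + ‖r.wbar s ω - r.w s ω‖ ^ 2 / 2 ≤ r.avgBreg s z ω := by
  have := H.dgf.breg_mirrorAverage_le H.one_le (p := fun j => r.prev s j ω)
    (fun j hj => r.prev_mem_subdiffDom H.start_subdiff s (Finset.mem_Icc.1 hj).2 ω)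
    (r.wbar_mem s ω) (r.dual_wbar_eq H.one_le s ω) (z := z)
  rw [r.w_eq H.one_le]
  exact this

theorem step_le (s : ℕ) {k : ℕ} (hk : k < K) {z : X} (hz : z ∈ P.Z) (ω : r.Ω) :
    τ s * r.resid s k z ω + breg d d' z (r.x s (k + 1) ω)
      ≤ α * breg d d' z (r.x s k ω) + (1 - α) * r.avgBreg s z ω
        + (τ s * r.noise s k ω (z - r.y s (k + 1) ω) + r.excess s k ω) := by
  have := HVI.innerStep_le H.standing H.dgf H.α_pos.le H.α_lt.le (H.τ_pos s).le (H.β_pos s).le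
    (r.x_mem s k ω hk.le) (r.wbar_mem s ω) (r.breg_wbar_le H s z ω) (r.step_y s k ω hk)
    (r.step_x s k ω hk) (r.x_mem s (k + 1) ω hk) hz
  unfold resid noise excess oracleDiff
  linarith

theorem neg_h_le_resid (s : ℕ) {k : ℕ} (hk : k < K) (ω : r.Ω) :
    -(P.h (β s • ps)).toReal ≤ r.resid s k xs ω :=
  H.multiplier.neg_toReal_h_le H.standing (H.β_pos s).le (H.h_ne_top s) (r.y_mem_Z s hk ω)

/-- The divergence controls the distance from z to `wbar`, and the gain of dual averaging controls
the distance from `wbar` to `w`. -/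
theorem sq_norm_w_sub_le (s : ℕ) {z : X} (hz : z ∈ P.Z) (ω : r.Ω) :
    ‖r.w s ω - z‖ ^ 2 ≤ 4 * r.avgBreg s z ω := by
  have h1 := r.breg_wbar_le H s z ω
  have h2 := H.dgf.half_sq_le_breg (H.dgf.feasible hz) (r.wbar_mem s ω)
  have h3 : ‖r.w s ω - z‖ ≤ ‖z - r.wbar s ω‖ + ‖r.wbar s ω - r.w s ω‖ := by
    rw [norm_sub_rev]; exact norm_sub_le_norm_sub_add_norm_sub _ _ _
  nlinarith [sq_nonneg (‖z - r.wbar s ω‖ - ‖r.wbar s ω - r.w s ω‖), norm_nonneg (r.w s ω - z),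
    norm_nonneg (z - r.wbar s ω), norm_nonneg (r.wbar s ω - r.w s ω)]

theorem extrapolation_le (s : ℕ) {k : ℕ} (hk : k < K) {z : X} (hz : z ∈ P.Z) (ω : r.Ω) :
    ‖r.y s (k + 1) ω - z‖ ^ 2 / 2 + τ s * (P.G (β s) (r.y s (k + 1) ω) - P.G (β s) z)
      ≤ τ s * ‖P.V (β s) (r.w s ω)‖ * ‖r.y s (k + 1) ω - z‖ + α * breg d d' z (r.x s k ω)
        + (1 - α) * r.avgBreg s z ω :=
  HVI.extrapolation_le H.standing H.dgf H.α_pos.le H.α_lt.le (H.τ_pos s).le (H.β_pos s).le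
    (r.x_mem s k ω hk.le) (r.wbar_mem s ω)
    ((le_add_of_nonneg_right (by positivity)).trans (r.breg_wbar_le H s z ω))
    (r.step_y s k ω hk) hz

/-- Telescoped inequality over one epoch. -/
theorem epoch_le (s : ℕ) {z : X} (hz : z ∈ P.Z) (ω : r.Ω) :
    ∑ k ∈ Finset.range K, τ s * r.resid s k z ω
      ≤ r.energy s z ω - r.energy (s + 1) z ω
        + ∑ k ∈ Finset.range K,
          (τ s * r.noise s k ω (z - r.y s (k + 1) ω) + r.excess s k ω) := by
  have hK' : (K : ℝ) ≠ 0 := by have := H.one_le; positivity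
  have h := Finset.sum_le_sum fun k hk => r.step_le H s (Finset.mem_range.1 hk) hz ω
  rw [Finset.sum_add_distrib, Finset.sum_add_distrib, Finset.sum_add_distrib, ← Finset.mul_sum,
    ← Finset.mul_sum (f := fun k => breg d d' z (r.x s k ω))] at h
  simp only [Finset.sum_const, Finset.card_range, nsmul_eq_mul] at h
  have e1 : ∑ k ∈ Finset.range K, breg d d' z (r.x s (k + 1) ω)
      = ∑ j ∈ Finset.Icc 1 K, breg d d' z (r.prev (s + 1) j ω) := by
    rw [Finset.range_eq_Ico, Finset.sum_Ico_add' (fun j => breg d d' z (r.x s j ω)) 0 K 1]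
    rfl
  -- Shifting the index by one exchanges the endpoint x_0^s for x_K^s, which is the start of the
  -- next epoch.
  have e2 : ∑ k ∈ Finset.range K, breg d d' z (r.x s k ω)
      = ∑ j ∈ Finset.Icc 1 K, breg d d' z (r.prev (s + 1) j ω) + breg d d' z (r.x s 0 ω)
        - breg d d' z (r.x s K ω) := by
    rw [← e1]
    have h1 := Finset.sum_range_succ (fun k => breg d d' z (r.x s k ω)) K
    have h2 := Finset.sum_range_succ' (fun k => breg d d' z (r.x s k ω)) K
    linarith
  have e3 : K * ((1 - α) * r.avgBreg s z ω)
      = (1 - α) * ∑ j ∈ Finset.Icc 1 K, breg d d' z (r.prev s j ω) := by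
    unfold avgBreg
    field_simp
  rw [e1, e2, e3] at h
  unfold energy
  rw [r.epoch_x, ← Finset.mul_sum]
  linarith

end Pathwise

/-! ### Moments of the iterates, by induction along the run. -/

section Integrability

variable (H : Admissible P d d' α τ β x₀ K O xs ps)
include H

theorem measurable_breg_x (s : ℕ) {k : ℕ} (hk : k ≤ K) (z : X) :
    Measurable fun ω => breg d d' z (r.x s k ω) :=
  H.dgf.measurable_breg (r.measurable_x s k hk) (fun ω => r.x_mem s k ω hk) z

theorem memLp_w_of (s : ℕ) (hA : Integrable (r.avgBreg s xs) r.μ) :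
    MemLp (fun ω => r.w s ω - xs) 2 r.μ :=
  memLp_two_of_sq_le ((r.measurable_w H.one_le s).sub_const xs).aestronglyMeasurable
    (hA.const_mul 4) fun ω => r.sq_norm_w_sub_le H s H.xs_mem_Z ω

/-- In the extrapolation inequality everything besides the divergences is linear in ‖y − x*‖, with a
coefficient affine in ‖w − x*‖. Young's inequality absorbs it, and `w` is already square integrable.
-/
theorem memLp_y_of (s : ℕ) {k : ℕ} (hk : k < K) (hA : Integrable (r.avgBreg s xs) r.μ)
    (hx : Integrable (fun ω => breg d d' xs (r.x s k ω)) r.μ) :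
    MemLp (fun ω => r.y s (k + 1) ω - xs) 2 r.μ := by
  have := r.prob
  obtain ⟨C, hC0, hC⟩ := H.standing.exists_norm_V_le (β s) xs
  set c := ‖β s • (P.F₁ xs + ps) + P.F₂ xs‖
  have hτ := H.τ_pos s
  refine memLp_two_of_sq_le ((r.measurable_y s k hk).sub_const xs).aestronglyMeasurable
    (g := fun ω => 4 * τ s ^ 2 * (2 * (C + c) ^ 2 + 2 * C ^ 2 * (4 * r.avgBreg s xs ω))
      + 4 * (α * breg d d' xs (r.x s k ω) + (1 - α) * r.avgBreg s xs ω)) ?_ fun ω => ?_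
  · exact (((integrable_const _).add ((hA.const_mul 4).const_mul _)).const_mul _).add
      (((hx.const_mul α).add (hA.const_mul _)).const_mul 4)
  · have h1 := r.extrapolation_le H s hk H.xs_mem_Z ω
    have h2 := H.multiplier.G_sub_le H.standing (H.β_pos s).le (r.y_mem_Z s hk ω)
    have h3 := r.sq_norm_w_sub_le H s H.xs_mem_Z ω
    have h4 := hC (r.w s ω)
    set N := ‖r.y s (k + 1) ω - xs‖
    set W := ‖r.w s ω - xs‖
    have hN : 0 ≤ N := norm_nonneg _
    have h5 : τ s * ‖P.V (β s) (r.w s ω)‖ * N ≤ τ s * (C * (1 + W)) * N := by gcongr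
    have h6 := mul_le_mul_of_nonneg_left h2 hτ.le
    -- Half of the available N²/2 is spent here; the remaining N²/4 explains the factor 4 in the
    -- majorant.
    have h7 : τ s * (C * (1 + W) + c) * N ≤ N ^ 2 / 4 + τ s ^ 2 * (C * (1 + W) + c) ^ 2 := by
      nlinarith [sq_nonneg (N / 2 - τ s * (C * (1 + W) + c))]
    have h8 : (C * (1 + W) + c) ^ 2 ≤ 2 * (C + c) ^ 2 + 2 * C ^ 2 * W ^ 2 := by
      nlinarith [sq_nonneg ((C + c) - C * W)]
    have h9 : 2 * C ^ 2 * W ^ 2 ≤ 2 * C ^ 2 * (4 * r.avgBreg s xs ω) := by gcongr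
    have h10 : τ s ^ 2 * (C * (1 + W) + c) ^ 2
        ≤ τ s ^ 2 * (2 * (C + c) ^ 2 + 2 * C ^ 2 * (4 * r.avgBreg s xs ω)) := by
      gcongr; linarith
    linarith

/-- Subgradients at x* bound `G` from below, the extrapolation inequality bounds it from above, and
both bounds are integrable. -/
theorem integrable_G_of (s : ℕ) {k : ℕ} (hk : k < K) (hA : Integrable (r.avgBreg s xs) r.μ)
    (hx : Integrable (fun ω => breg d d' xs (r.x s k ω)) r.μ) :
    Integrable (fun ω => P.G (β s) (r.y s (k + 1) ω)) r.μ := by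
  have := r.prob
  obtain ⟨C, hC0, hC⟩ := H.standing.exists_norm_V_le (β s) xs
  set c := ‖β s • (P.F₁ xs + ps) + P.F₂ xs‖
  have hτ := H.τ_pos s
  have hy := r.memLp_y_of H s hk hA hx
  have hw := r.memLp_w_of H s hA
  have hy1 := (hy.integrable (by norm_num)).norm
  have hm : Measurable fun ω => P.G (β s) (r.y s (k + 1) ω) :=
    ((H.standing.gamma₁.measurable_toReal.comp (r.measurable_y s k hk)).const_mul _).add
      (H.standing.gamma₂.measurable_toReal.comp (r.measurable_y s k hk))
  have hyw : Integrable (fun ω => ‖r.w s ω - xs‖ * ‖r.y s (k + 1) ω - xs‖) r.μ :=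
    hw.norm.integrable_mul hy.norm
  refine integrable_of_le_of_le hm.aestronglyMeasurable
    (g := fun ω => P.G (β s) xs - c * ‖r.y s (k + 1) ω - xs‖)
    (h := fun ω => P.G (β s) xs + (C * ‖r.y s (k + 1) ω - xs‖
      + C * (‖r.w s ω - xs‖ * ‖r.y s (k + 1) ω - xs‖))
      + (τ s)⁻¹ * (α * breg d d' xs (r.x s k ω) + (1 - α) * r.avgBreg s xs ω)) ?_ ?_
    (fun ω => ?_) (fun ω => ?_)
  · exact (integrable_const _).sub (hy1.const_mul c)
  · exact ((integrable_const _).add ((hy1.const_mul C).add (hyw.const_mul C))).add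
      (((hx.const_mul α).add (hA.const_mul _)).const_mul _)
  · have h2 := H.multiplier.G_sub_le H.standing (H.β_pos s).le (r.y_mem_Z s hk ω)
    linarith
  · have h1 := r.extrapolation_le H s hk H.xs_mem_Z ω
    have h4 := hC (r.w s ω)
    have h5 : τ s * ‖P.V (β s) (r.w s ω)‖ * ‖r.y s (k + 1) ω - xs‖
        ≤ τ s * (C * (1 + ‖r.w s ω - xs‖)) * ‖r.y s (k + 1) ω - xs‖ := by gcongr
    have h6 : τ s * (P.G (β s) (r.y s (k + 1) ω) - P.G (β s) xs) ≤
        τ s * ((C * ‖r.y s (k + 1) ω - xs‖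
      + C * (‖r.w s ω - xs‖ * ‖r.y s (k + 1) ω - xs‖))
      + (τ s)⁻¹ * (α * breg d d' xs (r.x s k ω) + (1 - α) * r.avgBreg s xs ω)) := by
      rw [mul_add, mul_inv_cancel_left₀ hτ.ne']
      have := sq_nonneg ‖r.y s (k + 1) ω - xs‖
      linarith
    have := le_of_mul_le_mul_left h6 hτ
    linarith

omit H in
theorem memLp_diff_of (s : ℕ) {k : ℕ} (hy : MemLp (fun ω => r.y s (k + 1) ω - xs) 2 r.μ)
    (hw : MemLp (fun ω => r.w s ω - xs) 2 r.μ) :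
    MemLp (fun ω => r.y s (k + 1) ω - r.w s ω) 2 r.μ := by
  simpa [Pi.sub_def] using hy.sub hw

theorem memLp_oracleDiff_of (s : ℕ) {k : ℕ} (hk : k < K)
    (hyw : MemLp (fun ω => r.y s (k + 1) ω - r.w s ω) 2 r.μ) :
    MemLp (r.oracleDiff s k) 2 r.μ ∧ ∫ ω, ‖r.oracleDiff s k ω‖ ^ 2 ∂r.μ
      ≤ O.L s ^ 2 * ∫ ω, ‖r.y s (k + 1) ω - r.w s ω‖ ^ 2 ∂r.μ := by
  have h1 := r.lintegral_oracleDiff_sq_le H.standing H.start_mem H.one_le s hk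
  rw [← ofReal_integral_norm_sq hyw, ← ENNReal.ofReal_mul (sq_nonneg _)] at h1
  have h2 : MemLp (r.oracleDiff s k) 2 r.μ :=
    memLp_two_of_lintegral_lt_top (r.measurable_oracleDiff H.one_le s hk).aestronglyMeasurable
      (h1.trans_lt ENNReal.ofReal_lt_top)
  refine ⟨h2, ?_⟩
  rw [← ofReal_integral_norm_sq h2] at h1
  refine (ENNReal.ofReal_le_ofReal_iff ?_).1 h1
  exact mul_nonneg (sq_nonneg _) (integral_nonneg fun ω => by positivity)

theorem norm_noise_sq_le (s : ℕ) {k : ℕ} (hk : k < K) (ω : r.Ω) :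
    ‖r.noise s k ω‖ ^ 2 ≤ 2 * ‖r.oracleDiff s k ω‖ ^ 2
      + 2 * (O.L s ^ 2 * ‖r.y s (k + 1) ω - r.w s ω‖ ^ 2) := by
  have h1 := O.norm_sub_le s (r.y_mem_Z s hk ω) (r.w_mem_Z H.standing H.one_le H.start_mem s ω)
  have h2 : r.noise s k ω
      = r.oracleDiff s k ω - (P.V (β s) (r.y s (k + 1) ω) - P.V (β s) (r.w s ω)) := by
    unfold noise oracleDiff; abel
  have h3 : ‖r.noise s k ω‖ ≤ ‖r.oracleDiff s k ω‖ + O.L s * ‖r.y s (k + 1) ω - r.w s ω‖ := by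
    rw [h2]; exact (norm_sub_le _ _).trans (by gcongr)
  have h4 := pow_le_pow_left₀ (norm_nonneg _) h3 2
  nlinarith [sq_nonneg (‖r.oracleDiff s k ω‖ - O.L s * ‖r.y s (k + 1) ω - r.w s ω‖)]

theorem memLp_noise_of (s : ℕ) {k : ℕ} (hk : k < K)
    (hyw : MemLp (fun ω => r.y s (k + 1) ω - r.w s ω) 2 r.μ) :
    MemLp (r.noise s k) 2 r.μ ∧ ∫ ω, ‖r.noise s k ω‖ ^ 2 ∂r.μ
      ≤ 4 * O.L s ^ 2 * ∫ ω, ‖r.y s (k + 1) ω - r.w s ω‖ ^ 2 ∂r.μ := by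
  obtain ⟨h1, h2⟩ := r.memLp_oracleDiff_of H s hk hyw
  have i1 := (memLp_two_iff_integrable_sq_norm h1.1).1 h1
  have i2 := (memLp_two_iff_integrable_sq_norm hyw.1).1 hyw
  have i3 := (i1.const_mul 2).add ((i2.const_mul (O.L s ^ 2)).const_mul 2)
  have h3 : MemLp (r.noise s k) 2 r.μ :=
    memLp_two_of_sq_le (r.measurable_noise H.standing H.one_le s hk).aestronglyMeasurable i3
      fun ω => r.norm_noise_sq_le H s hk ω
  refine ⟨h3, (integral_mono ((memLp_two_iff_integrable_sq_norm h3.1).1 h3) i3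
    fun ω => r.norm_noise_sq_le H s hk ω).trans ?_⟩
  simp only [Pi.add_apply]
  rw [integral_add (i1.const_mul 2) ((i2.const_mul (O.L s ^ 2)).const_mul 2)]
  simp only [integral_const_mul]
  linarith

omit H in
theorem integrable_noise_apply (s : ℕ) {k : ℕ} (hn : MemLp (r.noise s k) 2 r.μ)
    (hnm : Measurable (r.noise s k)) {v : r.Ω → X} (hvm : Measurable v) (hv : MemLp v 2 r.μ) :
    Integrable (fun ω => r.noise s k ω (v ω)) r.μ := by
  have h : Integrable (fun ω => ‖r.noise s k ω‖ * ‖v ω‖) r.μ := hn.norm.integrable_mul hv.norm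
  exact h.mono' (measurable_dual_apply hnm hvm).aestronglyMeasurable
    (Filter.Eventually.of_forall fun ω => (r.noise s k ω).le_opNorm _)

/-- At x* the residual cannot fall below −h, so the one-step inequality majorizes the next
divergence by integrable quantities. -/
theorem integrable_breg_succ_of (s : ℕ) {k : ℕ} (hk : k < K)
    (hA : Integrable (r.avgBreg s xs) r.μ)
    (hx : Integrable (fun ω => breg d d' xs (r.x s k ω)) r.μ) :
    Integrable (fun ω => breg d d' xs (r.x s (k + 1) ω)) r.μ := by
  have := r.prob
  have hy := r.memLp_y_of H s hk hA hx
  have hyw := r.memLp_diff_of s hy (r.memLp_w_of H s hA)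
  have hn := r.memLp_noise_of H s hk hyw
  have ho := r.memLp_oracleDiff_of H s hk hyw
  have hny := r.integrable_noise_apply s hn.1 (r.measurable_noise H.standing H.one_le s hk)
    ((r.measurable_y s k hk).sub_const xs) hy
  have i1 := (memLp_two_iff_integrable_sq_norm ho.1.1).1 ho.1
  have i2 := (memLp_two_iff_integrable_sq_norm hyw.1).1 hyw
  refine integrable_of_le_of_le (r.measurable_breg_x H s hk xs).aestronglyMeasurable
    (g := fun _ => 0)
    (h := fun ω => τ s * (P.h (β s • ps)).toReal + (α * breg d d' xs (r.x s k ω)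
      + (1 - α) * r.avgBreg s xs ω + (-(τ s * r.noise s k ω (r.y s (k + 1) ω - xs))
      + r.excess s k ω))) (integrable_const 0) ?_ (fun ω => ?_) (fun ω => ?_)
  · exact (integrable_const _).add (((hx.const_mul α).add (hA.const_mul _)).add
      ((hny.const_mul _).neg.add ((i1.const_mul _).sub (i2.const_mul _))))
  · exact H.dgf.breg_nonneg (H.dgf.feasible H.xs_mem_Z) (r.x_mem s (k + 1) ω hk)
  · have h1 := r.step_le H s hk H.xs_mem_Z ω
    have h2 := mul_le_mul_of_nonneg_left (r.neg_h_le_resid H s hk ω) (H.τ_pos s).le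
    have h3 : r.noise s k ω (xs - r.y s (k + 1) ω) = -r.noise s k ω (r.y s (k + 1) ω - xs) := by
      rw [← map_neg, neg_sub]
    rw [h3] at h1
    linarith

omit H in
theorem integrable_avgBreg_of (s : ℕ)
    (h : ∀ j ≤ K, Integrable (fun ω => breg d d' xs (r.prev s j ω)) r.μ) :
    Integrable (r.avgBreg s xs) r.μ :=
  (integrable_finsetSum _ fun j hj => h j (Finset.mem_Icc.1 hj).2).const_mul _

/-- Two nested inductions: over the inner steps for a given epoch, then over epochs. Both families
are carried along since a step uses the current iterate and the average over the previous epoch. -/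
theorem integrable_breg_prev_and_x (s : ℕ) :
    (∀ j ≤ K, Integrable (fun ω => breg d d' xs (r.prev s j ω)) r.μ) ∧
      ∀ k ≤ K, Integrable (fun ω => breg d d' xs (r.x s k ω)) r.μ := by
  have := r.prob
  have inner : ∀ s, (∀ j ≤ K, Integrable (fun ω => breg d d' xs (r.prev s j ω)) r.μ) →
      Integrable (fun ω => breg d d' xs (r.x s 0 ω)) r.μ →
      ∀ k ≤ K, Integrable (fun ω => breg d d' xs (r.x s k ω)) r.μ := by
    intro s hp h0 k
    induction k with
    | zero => exact fun _ => h0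
    | succ k ih =>
      exact fun hk => r.integrable_breg_succ_of H s hk (r.integrable_avgBreg_of s hp)
        (ih (by omega))
  induction s with
  | zero =>
    have hp : ∀ j ≤ K, Integrable (fun ω => breg d d' xs (r.prev 0 j ω)) r.μ :=
      fun j _ => integrable_const (breg d d' xs x₀)
    refine ⟨hp, inner 0 hp ?_⟩
    simp only [r.init_x]
    exact integrable_const _
  | succ s ih =>
    refine ⟨ih.2, inner (s + 1) ih.2 ?_⟩
    simp only [r.epoch_x]
    exact ih.2 K le_rfl

theorem integrable_breg_x (s : ℕ) {k : ℕ} (hk : k ≤ K) :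
    Integrable (fun ω => breg d d' xs (r.x s k ω)) r.μ :=
  (r.integrable_breg_prev_and_x H s).2 k hk

theorem integrable_breg_prev (s : ℕ) {j : ℕ} (hj : j ≤ K) :
    Integrable (fun ω => breg d d' xs (r.prev s j ω)) r.μ :=
  (r.integrable_breg_prev_and_x H s).1 j hj

theorem integrable_avgBreg (s : ℕ) : Integrable (r.avgBreg s xs) r.μ :=
  r.integrable_avgBreg_of s fun _ hj => r.integrable_breg_prev H s hj

theorem integrable_energy (s : ℕ) : Integrable (r.energy s xs) r.μ :=
  ((r.integrable_breg_x H s (Nat.zero_le K)).const_mul α).add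
    ((integrable_finsetSum _ fun _ hj =>
      r.integrable_breg_prev H s (Finset.mem_Icc.1 hj).2).const_mul _)

theorem memLp_w (s : ℕ) : MemLp (fun ω => r.w s ω - xs) 2 r.μ :=
  r.memLp_w_of H s (r.integrable_avgBreg H s)

theorem memLp_y (s : ℕ) {k : ℕ} (hk : k < K) : MemLp (fun ω => r.y s (k + 1) ω - xs) 2 r.μ :=
  r.memLp_y_of H s hk (r.integrable_avgBreg H s) (r.integrable_breg_x H s hk.le)

theorem memLp_diff (s : ℕ) {k : ℕ} (hk : k < K) :
    MemLp (fun ω => r.y s (k + 1) ω - r.w s ω) 2 r.μ :=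
  r.memLp_diff_of s (r.memLp_y H s hk) (r.memLp_w H s)

theorem integrable_sq_diff (s : ℕ) {k : ℕ} (hk : k < K) :
    Integrable (fun ω => ‖r.y s (k + 1) ω - r.w s ω‖ ^ 2) r.μ :=
  (memLp_two_iff_integrable_sq_norm (r.memLp_diff H s hk).1).1 (r.memLp_diff H s hk)

theorem memLp_noise (s : ℕ) {k : ℕ} (hk : k < K) : MemLp (r.noise s k) 2 r.μ :=
  (r.memLp_noise_of H s hk (r.memLp_diff H s hk)).1

theorem integral_norm_noise_sq_le (s : ℕ) {k : ℕ} (hk : k < K) :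
    ∫ ω, ‖r.noise s k ω‖ ^ 2 ∂r.μ
      ≤ 4 * O.L s ^ 2 * ∫ ω, ‖r.y s (k + 1) ω - r.w s ω‖ ^ 2 ∂r.μ :=
  (r.memLp_noise_of H s hk (r.memLp_diff H s hk)).2

theorem integrable_G (s : ℕ) {k : ℕ} (hk : k < K) :
    Integrable (fun ω => P.G (β s) (r.y s (k + 1) ω)) r.μ :=
  r.integrable_G_of H s hk (r.integrable_avgBreg H s) (r.integrable_breg_x H s hk.le)

theorem integrable_norm_y_sub (s : ℕ) {k : ℕ} (hk : k < K) :
    Integrable (fun ω => ‖r.y s (k + 1) ω - xs‖) r.μ := by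
  have := r.prob
  exact ((r.memLp_y H s hk).integrable (by norm_num)).norm

/-- Only βg₁ + g₂ is controlled from above. Since g₂ has a linear minorant, subtracting it yields an
upper bound for g₁; then g₂ is a difference of integrable functions. -/
theorem integrable_g (s : ℕ) {k : ℕ} (hk : k < K) :
    Integrable (fun ω => (P.g₁ (r.y s (k + 1) ω)).toReal) r.μ ∧
      Integrable (fun ω => (P.g₂ (r.y s (k + 1) ω)).toReal) r.μ := by
  have := r.prob
  have hN := r.integrable_norm_y_sub H s hk
  have hG := r.integrable_G H s hk
  have m1 := H.standing.gamma₁.measurable_toReal.comp (r.measurable_y s k hk)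
  have hβ := H.β_pos s
  have l1 : ∀ ω, (P.g₁ xs).toReal - ‖P.F₁ xs + ps‖ * ‖r.y s (k + 1) ω - xs‖
      ≤ (P.g₁ (r.y s (k + 1) ω)).toReal := fun ω => by
    have h1 := H.multiplier.neg_apply_le H.standing (r.y_mem_Z s hk ω).1
    have h2 := (le_abs_self _).trans ((P.F₁ xs + ps).le_opNorm (r.y s (k + 1) ω - xs))
    rw [add_apply] at h2
    linarith
  have l2 : ∀ ω, (P.g₂ xs).toReal - ‖P.F₂ xs‖ * ‖r.y s (k + 1) ω - xs‖
      ≤ (P.g₂ (r.y s (k + 1) ω)).toReal := fun ω => by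
    have h1 := H.standing.bifun₂_nonneg (r.y_mem_Z s hk ω).2 H.multiplier.mem_S₂
    have h2 := (le_abs_self _).trans ((P.F₂ xs).le_opNorm (r.y s (k + 1) ω - xs))
    linarith
  have i1 : Integrable (fun ω => (P.g₁ (r.y s (k + 1) ω)).toReal) r.μ := by
    refine integrable_of_le_of_le m1.aestronglyMeasurable
      (g := fun ω => (P.g₁ xs).toReal - ‖P.F₁ xs + ps‖ * ‖r.y s (k + 1) ω - xs‖)
      (h := fun ω => (β s)⁻¹ * (P.G (β s) (r.y s (k + 1) ω)
        - ((P.g₂ xs).toReal - ‖P.F₂ xs‖ * ‖r.y s (k + 1) ω - xs‖)))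
      ((integrable_const _).sub (hN.const_mul _))
      ((hG.sub ((integrable_const _).sub (hN.const_mul _))).const_mul _) l1 fun ω => ?_
    rw [inv_mul_eq_div, le_div_iff₀ hβ]
    have := l2 ω
    unfold HVI.G
    linarith
  refine ⟨i1, ?_⟩
  have : (fun ω => (P.g₂ (r.y s (k + 1) ω)).toReal)
      = fun ω => P.G (β s) (r.y s (k + 1) ω) - β s * (P.g₁ (r.y s (k + 1) ω)).toReal := by
    funext ω; unfold HVI.G; ring
  rw [this]
  exact hG.sub (i1.const_mul _)

theorem integrable_excess (s : ℕ) {k : ℕ} (hk : k < K) : Integrable (r.excess s k) r.μ := by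
  have ho := (r.memLp_oracleDiff_of H s hk (r.memLp_diff H s hk)).1
  exact (((memLp_two_iff_integrable_sq_norm ho.1).1 ho).const_mul _).sub
    ((r.integrable_sq_diff H s hk).const_mul _)

/-- The sampling variance costs at most τ²L²/2 ≤ (1−α)/8 of the mean squared displacement, half of
the gain (1−α)/4. The other half survives. -/
theorem integral_excess_le (s : ℕ) {k : ℕ} (hk : k < K) :
    ∫ ω, r.excess s k ω ∂r.μ ≤ -((1 - α) / 8 * ∫ ω, ‖r.y s (k + 1) ω - r.w s ω‖ ^ 2 ∂r.μ) := by
  have ho := r.memLp_oracleDiff_of H s hk (r.memLp_diff H s hk)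
  have i1 := (memLp_two_iff_integrable_sq_norm ho.1.1).1 ho.1
  unfold excess
  rw [integral_sub (i1.const_mul _) ((r.integrable_sq_diff H s hk).const_mul _),
    integral_const_mul, integral_const_mul]
  have h1 := mul_le_mul_of_nonneg_left ho.2 (by positivity : 0 ≤ τ s ^ 2 / 2)
  have h2 : 0 ≤ ∫ ω, ‖r.y s (k + 1) ω - r.w s ω‖ ^ 2 ∂r.μ :=
    integral_nonneg fun ω => by positivity
  have h3 := mul_le_mul_of_nonneg_right (H.sq_step_mul_le s) h2
  linarith

theorem integrable_noise_y (s : ℕ) {k : ℕ} (hk : k < K) :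
    Integrable (fun ω => r.noise s k ω (xs - r.y s (k + 1) ω)) r.μ := by
  refine r.integrable_noise_apply s (r.memLp_noise H s hk)
    (r.measurable_noise H.standing H.one_le s hk) ((r.measurable_y s k hk).const_sub xs) ?_
  simpa [Pi.neg_def] using (r.memLp_y H s hk).neg

/-- The extrapolation point is known before the sample is drawn, so the direction is measurable with
respect to the past. -/
theorem integral_noise_y (s : ℕ) {k : ℕ} (hk : k < K) :
    ∫ ω, r.noise s k ω (xs - r.y s (k + 1) ω) ∂r.μ = 0 :=
  r.integral_noise_apply H.standing H.start_mem H.one_le s hk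
    ((r.measurable_past_y_self s k).const_sub xs) (r.integrable_noise_y H s hk)

end Integrability

end MirrorProxRun

end Run

/-! ### Energy and noise bounds in expectation -/

section Bounds

variable {X : Type u} [NormedAddCommGroup X] [NormedSpace ℝ X]
  [FiniteDimensional ℝ X] [MeasurableSpace X] [BorelSpace X]

namespace MirrorProxRun

variable {P : HVI X} {d : X → EReal} {d' : X → StrongDual ℝ X} {α : ℝ} {τ β : ℕ → ℝ} {x₀ : X}
  {K : ℕ} {O : StochasticOracle.{u, v} P.Z (fun s => P.V (β s))}
  (r : MirrorProxRun.{u, v, w} P d d' α τ β x₀ K O) {xs : X} {ps : StrongDual ℝ X}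

theorem energy_zero (z : X) (ω : r.Ω) : r.energy 0 z ω = energy₀ d d' α x₀ K z := by
  simp [energy, energy₀, prev, r.init_x]

/-- The partial sums of the stochastic errors in a fixed direction. -/
noncomputable def noiseSum (θ : ℕ → ℝ) (e : X) (s k : ℕ) (ω : r.Ω) : ℝ :=
  ∑ t ∈ Finset.range s, ∑ j ∈ Finset.range K, θ t * r.noise t j ω e
    + ∑ j ∈ Finset.range k, θ s * r.noise s j ω e

theorem noiseSum_succ (θ : ℕ → ℝ) (e : X) (s k : ℕ) (ω : r.Ω) :
    r.noiseSum θ e s (k + 1) ω = r.noiseSum θ e s k ω + θ s * r.noise s k ω e := by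
  rw [noiseSum, noiseSum, Finset.sum_range_succ _ k, add_assoc]

theorem noiseSum_epoch (θ : ℕ → ℝ) (e : X) (s : ℕ) :
    r.noiseSum θ e (s + 1) 0 = r.noiseSum θ e s K := by
  funext ω
  rw [noiseSum, noiseSum, Finset.sum_range_succ _ s, Finset.sum_range_zero, add_zero]

variable {r}

variable (H : Admissible P d d' α τ β x₀ K O xs ps)
include H

/-- Test at x*: the error is centred, and the residual loses at most h per inner step. The
displacement term is retained because it controls the second moments of the extrapolation points. -/
theorem integral_energy_le (S : ℕ) :
    ∫ ω, r.energy S xs ω ∂r.μ + (1 - α) / 8 * ∑ s ∈ Finset.range S, ∑ k ∈ Finset.range K,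
        ∫ ω, ‖r.y s (k + 1) ω - r.w s ω‖ ^ 2 ∂r.μ
      ≤ energy₀ d d' α x₀ K xs + K * ∑ s ∈ Finset.range S, τ s * (P.h (β s • ps)).toReal := by
  have := r.prob
  induction S with
  | zero => simp [energy_zero]
  | succ s ih =>
    have hpt : ∀ ω, r.energy (s + 1) xs ω ≤ r.energy s xs ω
        + K * (τ s * (P.h (β s • ps)).toReal) + ∑ k ∈ Finset.range K,
          (τ s * r.noise s k ω (xs - r.y s (k + 1) ω) + r.excess s k ω) := fun ω => by
      have h1 := r.epoch_le H s H.xs_mem_Z ω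
      have h2 : ∑ k ∈ Finset.range K, τ s * -(P.h (β s • ps)).toReal
          ≤ ∑ k ∈ Finset.range K, τ s * r.resid s k xs ω :=
        Finset.sum_le_sum fun k hk => mul_le_mul_of_nonneg_left
          (r.neg_h_le_resid H s (Finset.mem_range.1 hk) ω) (H.τ_pos s).le
      rw [Finset.sum_const, Finset.card_range, nsmul_eq_mul] at h2
      linarith
    have i1 : ∀ k ∈ Finset.range K, Integrable (fun ω =>
        τ s * r.noise s k ω (xs - r.y s (k + 1) ω) + r.excess s k ω) r.μ := fun k hk =>
      ((r.integrable_noise_y H s (Finset.mem_range.1 hk)).const_mul _).add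
        (r.integrable_excess H s (Finset.mem_range.1 hk))
    have i2 : Integrable (fun ω => r.energy s xs ω + K * (τ s * (P.h (β s • ps)).toReal)) r.μ :=
      (r.integrable_energy H s).add (integrable_const _)
    have h3 := integral_mono (r.integrable_energy H (s + 1)) (i2.add (integrable_finsetSum _ i1)) hpt
    simp only [Pi.add_apply] at h3
    rw [integral_add i2 (integrable_finsetSum _ i1),
      integral_add (r.integrable_energy H s) (integrable_const _), integral_finsetSum _ i1,
      integral_const] at h3
    have h4 : ∑ k ∈ Finset.range K, ∫ ω,
        (τ s * r.noise s k ω (xs - r.y s (k + 1) ω) + r.excess s k ω) ∂r.μ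
        ≤ ∑ k ∈ Finset.range K,
          -((1 - α) / 8 * ∫ ω, ‖r.y s (k + 1) ω - r.w s ω‖ ^ 2 ∂r.μ) := by
      refine Finset.sum_le_sum fun k hk => ?_
      rw [Finset.mem_range] at hk
      rw [integral_add ((r.integrable_noise_y H s hk).const_mul _) (r.integrable_excess H s hk),
        integral_const_mul, r.integral_noise_y H s hk, mul_zero, zero_add]
      exact r.integral_excess_le H s hk
    rw [Finset.sum_neg_distrib, ← Finset.mul_sum] at h4
    rw [Finset.sum_range_succ, Finset.sum_range_succ]
    simp only [probReal_univ, one_smul] at h3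
    linarith

theorem measurable_past_noiseSum (θ : ℕ → ℝ) (e : X) (s k : ℕ) :
    Measurable[r.past s k] (r.noiseSum θ e s k) := by
  refine Measurable.add ?_ ?_
  · refine Finset.measurable_sum _ fun t ht => Finset.measurable_sum _ fun j hj => ?_
    rw [Finset.mem_range] at ht hj
    exact (measurable_dual_apply (r.measurable_past_noise H.standing H.one_le (Or.inl ⟨ht, hj⟩))
      measurable_const).const_mul _
  · refine Finset.measurable_sum _ fun j hj => ?_
    rw [Finset.mem_range] at hj
    exact (measurable_dual_apply (r.measurable_past_noise H.standing H.one_le (Or.inr ⟨rfl, hj⟩))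
      measurable_const).const_mul _

theorem memLp_noise_apply (e : X) (s : ℕ) {k : ℕ} (hk : k < K) :
    MemLp (fun ω => r.noise s k ω e) 2 r.μ :=
  memLp_two_of_sq_le
    (measurable_dual_apply (r.measurable_noise H.standing H.one_le s hk)
      measurable_const).aestronglyMeasurable
    (((memLp_two_iff_integrable_sq_norm (r.memLp_noise H s hk).1).1
      (r.memLp_noise H s hk)).const_mul (‖e‖ ^ 2)) fun ω => by
    rw [← mul_pow, mul_comm]
    gcongr
    exact (r.noise s k ω).le_opNorm e

theorem integral_noise_apply_sq_le (e : X) (s : ℕ) {k : ℕ} (hk : k < K) :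
    ∫ ω, (r.noise s k ω e) ^ 2 ∂r.μ
      ≤ ‖e‖ ^ 2 * (4 * O.L s ^ 2 * ∫ ω, ‖r.y s (k + 1) ω - r.w s ω‖ ^ 2 ∂r.μ) := by
  refine le_trans ?_ (mul_le_mul_of_nonneg_left (r.integral_norm_noise_sq_le H s hk)
    (sq_nonneg _))
  rw [← integral_const_mul]
  refine integral_mono (r.memLp_noise_apply H e s hk).integrable_sq
    (((memLp_two_iff_integrable_sq_norm (r.memLp_noise H s hk).1).1
      (r.memLp_noise H s hk)).const_mul (‖e‖ ^ 2)) fun ω => ?_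
  rw [← mul_pow, mul_comm, ← sq_abs]
  exact pow_le_pow_left₀ (abs_nonneg _) ((r.noise s k ω).le_opNorm e) 2

/-- Orthogonality of the stochastic errors. -/
theorem memLp_noiseSum (θ : ℕ → ℝ) (e : X) (s : ℕ) :
    ∀ k ≤ K, MemLp (r.noiseSum θ e s k) 2 r.μ ∧ ∫ ω, (r.noiseSum θ e s k ω) ^ 2 ∂r.μ
      = ∑ t ∈ Finset.range s, ∑ j ∈ Finset.range K, θ t ^ 2 * ∫ ω, (r.noise t j ω e) ^ 2 ∂r.μ
        + ∑ j ∈ Finset.range k, θ s ^ 2 * ∫ ω, (r.noise s j ω e) ^ 2 ∂r.μ := by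
  have := r.prob
  have inner : ∀ s (c : ℝ), (MemLp (r.noiseSum θ e s 0) 2 r.μ ∧
      ∫ ω, (r.noiseSum θ e s 0 ω) ^ 2 ∂r.μ = c) →
      ∀ k ≤ K, MemLp (r.noiseSum θ e s k) 2 r.μ ∧ ∫ ω, (r.noiseSum θ e s k ω) ^ 2 ∂r.μ
        = c + ∑ j ∈ Finset.range k, θ s ^ 2 * ∫ ω, (r.noise s j ω e) ^ 2 ∂r.μ := by
    intro s c h0 k
    induction k with
    | zero => intro _; simpa using h0
    | succ k ih =>
      intro hk
      obtain ⟨ih1, ih2⟩ := ih (by omega)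
      have hk' : k < K := hk
      have hn := r.memLp_noise_apply H e s hk'
      have e1 : r.noiseSum θ e s (k + 1)
          = fun ω => r.noiseSum θ e s k ω + θ s * r.noise s k ω e :=
        funext fun ω => r.noiseSum_succ θ e s k ω
      refine ⟨by rw [e1]; exact ih1.add (hn.const_mul _), ?_⟩
      have hprod : Integrable (fun ω => r.noiseSum θ e s k ω * r.noise s k ω e) r.μ :=
        ih1.integrable_mul hn
      -- The product is the new error evaluated in the random direction `noiseSum • e`, which
      -- belongs to the past.
      have hzero : ∫ ω, r.noiseSum θ e s k ω * r.noise s k ω e ∂r.μ = 0 := by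
        have hm : Measurable[r.past s k] fun ω => r.noiseSum θ e s k ω • e :=
          (r.measurable_past_noiseSum H θ e s k).smul_const e
        have e2 : ∀ ω, r.noise s k ω (r.noiseSum θ e s k ω • e)
            = r.noiseSum θ e s k ω * r.noise s k ω e := fun ω => by rw [map_smul, smul_eq_mul]
        have := r.integral_noise_apply H.standing H.start_mem H.one_le s hk' hm
          (by simpa only [e2] using hprod)
        simpa only [e2] using this
      have e3 : ∀ ω, (r.noiseSum θ e s (k + 1) ω) ^ 2 = (r.noiseSum θ e s k ω) ^ 2
          + 2 * θ s * (r.noiseSum θ e s k ω * r.noise s k ω e)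
          + θ s ^ 2 * (r.noise s k ω e) ^ 2 := fun ω => by rw [r.noiseSum_succ]; ring
      have i1 : Integrable (fun ω => (r.noiseSum θ e s k ω) ^ 2
          + 2 * θ s * (r.noiseSum θ e s k ω * r.noise s k ω e)) r.μ :=
        ih1.integrable_sq.add (hprod.const_mul _)
      simp only [e3]
      rw [integral_add i1 (hn.integrable_sq.const_mul _),
        integral_add ih1.integrable_sq (hprod.const_mul _), integral_const_mul, integral_const_mul,
        hzero, ih2, Finset.sum_range_succ]
      ring
  induction s with
  | zero =>
    refine inner 0 _ ?_
    have : r.noiseSum θ e 0 0 = fun _ => 0 := by funext ω; simp [noiseSum]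
    rw [this]
    simp
  | succ s ih =>
    refine inner (s + 1) _ ?_
    rw [r.noiseSum_epoch, Finset.sum_range_succ]
    exact ih K le_rfl

/-- Uniform control of the weighted stochastic terms over a bounded set of comparison points.
The additive constant depends neither on the number of inner iterations nor on the oracle. -/
theorem exists_noise_bound {ι : Type*} [Fintype ι] (b : Module.Basis ι ℝ X) {U : Set X} {R : ℝ}
    (hR : ∀ z ∈ U, ∀ i, |b.coord i (z - xs)| ≤ R) {θ : ℕ → ℝ} (hθ : ∀ s, 0 < θ s)
    (hmono : Monotone θ) (S : ℕ) :
    ∃ N : r.Ω → ℝ, Integrable N r.μ ∧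
      ∫ ω, N ω ∂r.μ ≤ Fintype.card ι * (2 * R ^ 2 * (∑ i, ‖b i‖ ^ 2 + 1)) * θ S ∧
      ∀ ω, ∀ z ∈ U, ∑ s ∈ Finset.range (S + 1), θ s * ∑ k ∈ Finset.range K,
        (τ s * r.noise s k ω (z - r.y s (k + 1) ω) + r.excess s k ω) ≤ N ω := by
  have := r.prob
  set M : ℝ := ∑ i, ‖b i‖ ^ 2 + 1 with hM
  have hMpos : 0 < M := by positivity
  have hθS := hθ S
  set ϑ : ℕ → ℝ := fun s => θ s * τ s
  set Q : ι → r.Ω → ℝ := fun i ω => r.noiseSum ϑ (b i) (S + 1) 0 ω with hQ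
  have hQL : ∀ i, MemLp (Q i) 2 r.μ := fun i => (r.memLp_noiseSum H ϑ (b i) (S + 1) 0 (by omega)).1
  set D : ℕ → ℕ → ℝ := fun s k => ∫ ω, ‖r.y s (k + 1) ω - r.w s ω‖ ^ 2 ∂r.μ with hD
  have hD0 : ∀ s k, 0 ≤ D s k := fun s k => integral_nonneg fun ω => by positivity
  set T : ℝ := ∑ s ∈ Finset.range (S + 1), θ s * ∑ k ∈ Finset.range K, D s k with hT
  have hQ2 : ∀ i, ∫ ω, (Q i ω) ^ 2 ∂r.μ ≤ θ S * ((1 - α) * ‖b i‖ ^ 2 * T) := fun i => by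
    rw [(r.memLp_noiseSum H ϑ (b i) (S + 1) 0 (by omega)).2, Finset.sum_range_zero, add_zero, hT,
      Finset.mul_sum, Finset.mul_sum]
    refine Finset.sum_le_sum fun s hs => ?_
    rw [Finset.mul_sum, Finset.mul_sum, Finset.mul_sum]
    refine Finset.sum_le_sum fun k hk => ?_
    have h1 := r.integral_noise_apply_sq_le H (b i) s (Finset.mem_range.1 hk)
    have h2 := H.sq_step_mul_le s
    -- Only one of the two factors θ_s is replaced by θ_S, so the variance is compared with the same
    -- weighted sum `T` that occurs in the excess.
    have h3 : θ s ≤ θ S := hmono (by rw [Finset.mem_range] at hs; omega)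
    have h4 := hθ s
    calc ϑ s ^ 2 * ∫ ω, (r.noise s k ω (b i)) ^ 2 ∂r.μ
        ≤ ϑ s ^ 2 * (‖b i‖ ^ 2 * (4 * O.L s ^ 2 * D s k)) := by gcongr
      _ = θ s * θ s * (4 * (τ s ^ 2 * O.L s ^ 2)) * ‖b i‖ ^ 2 * D s k := by
          simp only [ϑ]; ring
      _ ≤ θ S * θ s * (1 - α) * ‖b i‖ ^ 2 * D s k := by
          have := hD0 s k
          gcongr
          linarith
      _ = θ S * ((1 - α) * ‖b i‖ ^ 2 * (θ s * D s k)) := by ring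
  set E : r.Ω → ℝ := fun ω => ∑ s ∈ Finset.range (S + 1), θ s * ∑ k ∈ Finset.range K,
        (τ s * r.noise s k ω (xs - r.y s (k + 1) ω) + r.excess s k ω) with hE
  have iE' : ∀ s, ∀ k ∈ Finset.range K, Integrable (fun ω =>
      τ s * r.noise s k ω (xs - r.y s (k + 1) ω) + r.excess s k ω) r.μ := fun s k hk =>
    ((r.integrable_noise_y H s (Finset.mem_range.1 hk)).const_mul _).add
      (r.integrable_excess H s (Finset.mem_range.1 hk))
  have iE : ∀ s ∈ Finset.range (S + 1), Integrable (fun ω => θ s * ∑ k ∈ Finset.range K,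
      (τ s * r.noise s k ω (xs - r.y s (k + 1) ω) + r.excess s k ω)) r.μ := fun s _ =>
    (integrable_finsetSum _ (iE' s)).const_mul _
  have hEint : ∫ ω, E ω ∂r.μ ≤ -((1 - α) / 8 * T) := by
    rw [hE, integral_finsetSum _ iE, hT, Finset.mul_sum, ← Finset.sum_neg_distrib]
    refine Finset.sum_le_sum fun s _ => ?_
    rw [integral_const_mul, integral_finsetSum _ (iE' s), mul_left_comm, ← mul_neg]
    refine mul_le_mul_of_nonneg_left ?_ (hθ s).le
    rw [Finset.mul_sum, ← Finset.sum_neg_distrib]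
    refine Finset.sum_le_sum fun k hk => ?_
    rw [Finset.mem_range] at hk
    rw [integral_add ((r.integrable_noise_y H s hk).const_mul _) (r.integrable_excess H s hk),
      integral_const_mul, r.integral_noise_y H s hk, mul_zero, zero_add]
    exact r.integral_excess_le H s hk
  have iQ : ∀ i ∈ (Finset.univ : Finset ι), Integrable (fun ω => 2 * R ^ 2 * M * θ S
      + (8 * M * θ S)⁻¹ * (Q i ω) ^ 2) r.μ := fun i _ =>
    (integrable_const _).add ((hQL i).integrable_sq.const_mul _)
  -- Young's inequality for R|Q_i|, with parameter tuned so that the summed expectations of the Q_i²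
  -- terms are at most (1−α)/8 · T, exactly what the expectation of `E` can absorb.
  refine ⟨fun ω => ∑ i, (2 * R ^ 2 * M * θ S + (8 * M * θ S)⁻¹ * (Q i ω) ^ 2) + E ω,
    (integrable_finsetSum _ iQ).add (integrable_finsetSum _ iE), ?_, fun ω z hz => ?_⟩
  · rw [integral_add (integrable_finsetSum _ iQ) (integrable_finsetSum _ iE),
      integral_finsetSum _ iQ]
    have h1 : ∀ i, ∫ ω, (2 * R ^ 2 * M * θ S + (8 * M * θ S)⁻¹ * (Q i ω) ^ 2) ∂r.μ
        ≤ 2 * R ^ 2 * M * θ S + (8 * M)⁻¹ * ((1 - α) * ‖b i‖ ^ 2 * T) := fun i => by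
      rw [integral_add (integrable_const _) ((hQL i).integrable_sq.const_mul _), integral_const,
        integral_const_mul]
      simp only [probReal_univ, one_smul]
      have := mul_le_mul_of_nonneg_left (hQ2 i) (by positivity : 0 ≤ (8 * M * θ S)⁻¹)
      have e : (8 * M * θ S)⁻¹ * (θ S * ((1 - α) * ‖b i‖ ^ 2 * T))
          = (8 * M)⁻¹ * ((1 - α) * ‖b i‖ ^ 2 * T) := by
        field_simp
      linarith
    have h2 := Finset.sum_le_sum fun i (_ : i ∈ Finset.univ) => h1 i
    rw [Finset.sum_add_distrib, Finset.sum_const, Finset.card_univ, nsmul_eq_mul, ← Finset.mul_sum,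
      ← Finset.sum_mul, ← Finset.mul_sum] at h2
    have hT0 : 0 ≤ T := Finset.sum_nonneg fun s _ =>
      mul_nonneg (hθ s).le (Finset.sum_nonneg fun k _ => hD0 s k)
    have h3 : (8 * M)⁻¹ * ((1 - α) * (∑ i, ‖b i‖ ^ 2) * T) ≤ (1 - α) / 8 * T := by
      rw [inv_mul_eq_div, div_le_iff₀ (by positivity)]
      have h4 : ∑ i, ‖b i‖ ^ 2 ≤ M := by rw [hM]; linarith
      have h5 := mul_le_mul_of_nonneg_right h4
        (mul_nonneg (sub_nonneg.2 H.α_lt.le) hT0)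
      linarith
    have h6 : ∫ ω, ∑ s ∈ Finset.range (S + 1), θ s * ∑ k ∈ Finset.range K,
        (τ s * r.noise s k ω (xs - r.y s (k + 1) ω) + r.excess s k ω) ∂r.μ
        ≤ -((1 - α) / 8 * T) := hEint
    linarith
  · have e1 : ∑ s ∈ Finset.range (S + 1), θ s * ∑ k ∈ Finset.range K,
        (τ s * r.noise s k ω (z - r.y s (k + 1) ω) + r.excess s k ω)
        = ∑ i, b.coord i (z - xs) * Q i ω + E ω := by
      have h1 : ∀ s k, r.noise s k ω (z - r.y s (k + 1) ω)
          = ∑ i, b.coord i (z - xs) * r.noise s k ω (b i)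
            + r.noise s k ω (xs - r.y s (k + 1) ω) := fun s k => by
        have h2 : r.noise s k ω (z - xs) = ∑ i, b.coord i (z - xs) * r.noise s k ω (b i) := by
          conv_lhs => rw [← b.sum_repr (z - xs)]
          simp [map_sum]
        rw [← h2, ← map_add]
        congr 1; abel
      have h3 : ∑ i, b.coord i (z - xs) * Q i ω = ∑ s ∈ Finset.range (S + 1),
          θ s * ∑ k ∈ Finset.range K, τ s * ∑ i, b.coord i (z - xs) * r.noise s k ω (b i) := by
        simp only [hQ, noiseSum, Finset.sum_range_zero, add_zero, Finset.mul_sum]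
        rw [Finset.sum_comm]
        refine Finset.sum_congr rfl fun s _ => ?_
        rw [Finset.sum_comm]
        refine Finset.sum_congr rfl fun k _ => Finset.sum_congr rfl fun i _ => ?_
        simp only [ϑ]; ring
      rw [h3, hE, ← Finset.sum_add_distrib]
      refine Finset.sum_congr rfl fun s _ => ?_
      rw [← mul_add, ← Finset.sum_add_distrib]
      congr 1
      refine Finset.sum_congr rfl fun k _ => ?_
      rw [h1]; ring
    rw [e1]
    refine add_le_add (Finset.sum_le_sum fun i _ => ?_) le_rfl
    have h1 : b.coord i (z - xs) * Q i ω ≤ R * |Q i ω| := by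
      refine (le_abs_self _).trans ?_
      rw [abs_mul]
      gcongr
      exact hR z hz i
    refine h1.trans ?_
    have h2 : (8 * M * θ S)⁻¹ * (Q i ω) ^ 2 = |Q i ω| ^ 2 / (8 * M * θ S) := by
      rw [sq_abs, inv_mul_eq_div]
    rw [h2, ← sub_le_iff_le_add', le_div_iff₀ (by positivity)]
    nlinarith [sq_nonneg (|Q i ω| - 4 * M * θ S * R)]

end MirrorProxRun

end Bounds

/-! ### Gap functions -/

section Gap

variable {X : Type u} [NormedAddCommGroup X] [NormedSpace ℝ X]

theorem gap_le {g : X → EReal} (hg : IsGammaZero g) (F : X → StrongDual ℝ X) {C : Set X}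
    (hC : C ⊆ edom g) {x : X} (hx : x ∈ edom g) {c : ℝ}
    (h : ∀ z ∈ C, F z (x - z) + (g x).toReal - (g z).toReal ≤ c) : gap F g C x ≤ (c : EReal) := by
  refine iSup₂_le fun z hz => ?_
  rw [hg.bifun_eq F hx (hC hz)]
  exact_mod_cast h z hz

theorem le_gap {g : X → EReal} (hg : IsGammaZero g) (F : X → StrongDual ℝ X) {C : Set X}
    (hC : C ⊆ edom g) {x z : X} (hx : x ∈ edom g) (hz : z ∈ C) :
    ((F z (x - z) + (g x).toReal - (g z).toReal : ℝ) : EReal) ≤ gap F g C x := by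
  rw [← hg.bifun_eq F hx (hC hz)]
  exact le_iSup₂_of_le z hz le_rfl

theorem toReal_gap_le {g : X → EReal} (hg : IsGammaZero g) (F : X → StrongDual ℝ X) {C : Set X}
    (hC : C ⊆ edom g) (hne : C.Nonempty) {x : X} (hx : x ∈ edom g) {c : ℝ}
    (h : ∀ z ∈ C, F z (x - z) + (g x).toReal - (g z).toReal ≤ c) :
    (gap F g C x).toReal ≤ c := by
  obtain ⟨z, hz⟩ := hne
  have h1 := EReal.toReal_le_toReal (gap_le hg F hC hx h)
    (ne_bot_of_le_ne_bot (EReal.coe_ne_bot _) (le_gap hg F hC hx hz)) (EReal.coe_ne_top _)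
  rwa [EReal.toReal_coe] at h1

/-- Semicontinuity gives measurability of the gap even though the supremum may be uncountable. -/
theorem lowerSemicontinuous_gap {g : X → EReal} (hg : IsGammaZero g) (F : X → StrongDual ℝ X)
    {C : Set X} (hC : C ⊆ edom g) : LowerSemicontinuous (gap F g C) := by
  have key : ∀ z ∈ C, LowerSemicontinuous fun x => bifun F g x z := fun z hz => by
    have e : (fun x => bifun F g x z)
        = fun x => ((F z (x - z) - (g z).toReal : ℝ) : EReal) + g x := by
      funext x
      have h (a b c : EReal) : a + b - c = a - c + b := by
        rw [sub_eq_add_neg, sub_eq_add_neg, add_right_comm]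
      rw [bifun, ← hg.coe_toReal (hC hz), EReal.toReal_coe, EReal.coe_sub, h]
    rw [e]
    refine LowerSemicontinuous.add' (Continuous.lowerSemicontinuous ?_) hg.lsc fun x => ?_
    · exact continuous_coe_real_ereal.comp (by fun_prop)
    · exact EReal.continuousAt_add (Or.inl (EReal.coe_ne_top _)) (Or.inl (EReal.coe_ne_bot _))
  exact lowerSemicontinuous_biSup fun z hz => key z hz

/-- A single comparison point bounds the gap from below; the uniform linear growth over `C` bounds
it from above. -/
theorem hasExpectation_gap [MeasurableSpace X] [BorelSpace X] {Ω : Type*} [MeasurableSpace Ω]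
    {μ : Measure Ω} [IsFiniteMeasure μ] {g : X → EReal} (hg : IsGammaZero g)
    (F : X → StrongDual ℝ X) {C : Set X} (hC : C ⊆ edom g) (hne : C.Nonempty) {a : X} {c : ℝ}
    (hc : ∀ z ∈ C, ∀ x, F z (x - z) - (g z).toReal ≤ c * (1 + ‖x - a‖)) {f : Ω → X}
    (hf : Measurable f) (hfg : ∀ ω, f ω ∈ edom g) (hfi : Integrable (fun ω => ‖f ω - a‖) μ)
    (hgi : Integrable (fun ω => (g (f ω)).toReal) μ) :
    HasExpectation μ fun ω => gap F g C (f ω) := by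
  have hub : ∀ ω, ∀ z ∈ C, F z (f ω - z) + (g (f ω)).toReal - (g z).toReal
      ≤ (g (f ω)).toReal + c * (1 + ‖f ω - a‖) := fun ω z hz => by
    linarith [hc z hz (f ω)]
  obtain ⟨z₀, hz₀⟩ := hne
  have hlb := fun ω => le_gap hg F hC (hfg ω) hz₀
  have htop : ∀ ω, gap F g C (f ω) ≠ ⊤ := fun ω =>
    ne_top_of_le_ne_top (EReal.coe_ne_top _) (gap_le hg F hC (hfg ω) (hub ω))
  have hm : Measurable fun ω => (gap F g C (f ω)).toReal :=
    ((lowerSemicontinuous_gap hg F hC).measurable.comp hf).ereal_toReal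
  refine ⟨fun ω => ⟨htop ω, ne_bot_of_le_ne_bot (EReal.coe_ne_bot _) (hlb ω)⟩, ?_⟩
  refine integrable_of_le_of_le hm.aestronglyMeasurable
    (g := fun ω => (g (f ω)).toReal - (‖F z₀‖ * (‖f ω - a‖ + ‖a - z₀‖) + (g z₀).toReal))
    (h := fun ω => (g (f ω)).toReal + c * (1 + ‖f ω - a‖)) ?_ ?_ (fun ω => ?_) (fun ω => ?_)
  · exact hgi.sub (((hfi.add (integrable_const _)).const_mul _).add (integrable_const _))
  · exact hgi.add (((integrable_const _).add hfi).const_mul _)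
  · have h1 := EReal.toReal_le_toReal (hlb ω) (EReal.coe_ne_bot _) (htop ω)
    rw [EReal.toReal_coe] at h1
    have h2 := (abs_le.1 ((F z₀).le_opNorm (f ω - z₀))).1
    have h3 : ‖F z₀‖ * ‖f ω - z₀‖ ≤ ‖F z₀‖ * (‖f ω - a‖ + ‖a - z₀‖) := by
      gcongr; exact norm_sub_le_norm_sub_add_norm_sub _ _ _
    linarith
  · exact toReal_gap_le hg F hC ⟨z₀, hz₀⟩ (hfg ω) (hub ω)

/-- Linear growth, uniformly over a bounded set of comparison points. -/
theorem exists_linear_growth {g : X → EReal} (hg : IsGammaZero g) {F : X → StrongDual ℝ X}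
    {L : NNReal} (hF : LipschitzWith L F) {a : X} {u : StrongDual ℝ X} (hu : u ∈ subdiff g a)
    {C : Set X} (hC : C ⊆ edom g) (hb : Bornology.IsBounded C) :
    ∃ c : ℝ, 0 ≤ c ∧ ∀ z ∈ C, ∀ x, F z (x - z) - (g z).toReal ≤ c * (1 + ‖x - a‖) := by
  obtain ⟨ρ, hρ0, hρ⟩ : ∃ ρ : ℝ, 0 ≤ ρ ∧ ∀ z ∈ C, ‖z - a‖ ≤ ρ := by
    obtain ⟨ρ, hρ⟩ := hb.subset_closedBall a
    exact ⟨max ρ 0, le_max_right _ _, fun z hz =>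
      (mem_closedBall_iff_norm.1 (hρ hz)).trans (le_max_left _ _)⟩
  set M := ‖F a‖ + L * ρ with hM
  have hM0 : 0 ≤ M := by positivity
  refine ⟨M + M * ρ + |(g a).toReal| + ‖u‖ * ρ, by positivity, fun z hz x => ?_⟩
  have h1 : ‖F z‖ ≤ M := by
    have h2 : ‖F z‖ ≤ ‖F a‖ + ‖F z - F a‖ := by
      have := norm_add_le (F a) (F z - F a); rwa [add_sub_cancel] at this
    have h3 : ‖F z - F a‖ ≤ L * ρ := (hF.norm_sub_le z a).trans (by gcongr; exact hρ z hz)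
    linarith
  have h2 : F z (x - z) ≤ M * (‖x - a‖ + ρ) := by
    refine (le_abs_self _).trans (((F z).le_opNorm _).trans ?_)
    gcongr
    refine (norm_sub_le_norm_sub_add_norm_sub x a z).trans ?_
    rw [norm_sub_rev a z]
    linarith [hρ z hz]
  have h3 := hg.le_of_mem_subdiff hu (hC hz)
  have h4 := (abs_le.1 (u.le_opNorm (z - a))).1
  have h5 : ‖u‖ * ‖z - a‖ ≤ ‖u‖ * ρ := by gcongr; exact hρ z hz
  have h6 := neg_abs_le (g a).toReal
  have h7 : 0 ≤ (M * ρ + |(g a).toReal| + ‖u‖ * ρ) * ‖x - a‖ := by positivity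
  linarith

theorem exists_coord_bound [FiniteDimensional ℝ X] {ι : Type*} [Fintype ι]
    (b : Module.Basis ι ℝ X) {C : Set X} (hb : Bornology.IsBounded C) (a : X) :
    ∃ R : ℝ, ∀ z ∈ C, ∀ i, |b.coord i (z - a)| ≤ R := by
  obtain ⟨ρ, hρ⟩ := hb.subset_closedBall a
  refine ⟨(∑ i, ‖LinearMap.toContinuousLinearMap (b.coord i)‖) * ρ, fun z hz i => ?_⟩
  have h1 := (LinearMap.toContinuousLinearMap (b.coord i)).le_opNorm (z - a)
  refine h1.trans ?_
  have h2 : ‖z - a‖ ≤ ρ := mem_closedBall_iff_norm.1 (hρ hz)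
  gcongr
  exact Finset.single_le_sum (f := fun i => ‖LinearMap.toContinuousLinearMap (b.coord i)‖)
    (fun i _ => norm_nonneg _) (Finset.mem_univ i)

/-- The optimality gap is bounded below by a multiple of the distance to the lower-level set. -/
theorem HVI.exists_le_gapOpt {P : HVI X} (hP : P.Standing) (hCQ : P.CQ) {U : Set X}
    (hU : (U ∩ P.S₁).Nonempty) :
    ∃ B : ℝ, 0 < B ∧ ∀ x, ((-B * Metric.infDist x P.S₂ : ℝ) : EReal) ≤ P.gapOpt U x := by
  obtain ⟨z, hzU, hz⟩ := hU
  have hz' := hz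
  rw [hCQ] at hz'
  obtain ⟨p, hp⟩ := hz'
  -- Adding 1 keeps the slope positive when the multiplier vanishes.
  refine ⟨‖p‖ + 1, by positivity, fun x => ?_⟩
  have hz1 := hP.S₁_subset_Z hz
  refine le_iSup₂_of_le z ⟨hzU, hz.1⟩ ?_
  by_cases hx : x ∈ edom P.g₁
  · rw [hP.gamma₁.bifun_eq _ hx hz1.1]
    have h1 := hp.neg_apply_le hP hx
    -- For q ∈ S₂, normality gives p(q − z) ≤ 0, hence p(x − z) ≤ p(x − q).
    have h2 : p (x - z) / (‖p‖ + 1) ≤ Metric.infDist x P.S₂ := by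
      refine (Metric.le_infDist ⟨z, hz.1⟩).2 fun q hq => ?_
      rw [div_le_iff₀ (by positivity), dist_eq_norm]
      have h3 : p (x - z) = p (x - q) + p (q - z) := by rw [← map_add]; congr 1; abel
      have h4 := hp.1.2 q hq
      have h5 := (le_abs_self _).trans (p.le_opNorm (x - q))
      linarith [norm_nonneg (x - q)]
    rw [div_le_iff₀ (by positivity)] at h2
    have h3 : -(‖p‖ + 1) * Metric.infDist x P.S₂
        ≤ P.F₁ z (x - z) + (P.g₁ x).toReal - (P.g₁ z).toReal := by linarith
    exact_mod_cast h3
  · have : P.g₁ x = ⊤ := by simpa [edom] using hx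
    rw [bifun, this, EReal.coe_add_top, ← hP.gamma₁.coe_toReal hz1.1, EReal.top_sub_coe]
    exact le_top

end Gap

/-! ### Bregman divergences on compact sets -/

section Compact

variable {X : Type u} [NormedAddCommGroup X] [NormedSpace ℝ X] {Z : Set X} {d : X → EReal}
  {d' : X → StrongDual ℝ X}

theorem IsDGF.exists_breg_le (hd : IsDGF Z d d') {C : Set X} (hC : IsCompact C)
    (hCd : C ⊆ edom d) (a : X) : ∃ c : ℝ, 0 ≤ c ∧ ∀ z ∈ C, breg d d' z a ≤ c := by
  have hcont : ContinuousOn (fun z => breg d d' z a) C := by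
    unfold breg
    exact ((hd.cont.mono hCd).sub continuousOn_const).sub (by fun_prop)
  obtain ⟨c, hc⟩ := hC.exists_bound_of_continuousOn hcont
  exact ⟨max c 0, le_max_right _ _, fun z hz =>
    (le_abs_self _).trans ((hc z hz).trans (le_max_left _ _))⟩

/-- At a point of the relative interior, the divergence dominates the divergences at the points
of any compact subset of the domain. -/
theorem IsDGF.exists_breg_le_of_mem_intrinsicInterior (hd : IsDGF Z d d') {C : Set X}
    (hC : IsCompact C) (hCd : C ⊆ edom d) {x : X} (hx : x ∈ intrinsicInterior ℝ (edom d)) :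
    ∃ c c' : ℝ, 0 ≤ c ∧ 0 ≤ c' ∧
      ∀ z ∈ C, ∀ a ∈ subdiffDom d, breg d d' z a ≤ c + c' * breg d d' x a := by
  have hxd : x ∈ edom d := intrinsicInterior_subset hx
  obtain ⟨⟨x', hx'⟩, hint, rfl⟩ := mem_intrinsicInterior.1 hx
  obtain ⟨r, hr, hball⟩ := Metric.isOpen_iff.1 isOpen_interior _ hint
  obtain ⟨ρ, hρ⟩ := hC.isBounded.subset_closedBall x'
  -- Small enough for the segment from any z ∈ C through x′ to be prolonged beyond x′ inside the
  -- domain. The subgradient inequality at the prolonged point bounds d′(a)(x′ − z) from above.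
  set ε : ℝ := r / (2 * (|ρ| + 1)) with hε
  have hεpos : 0 < ε := by positivity
  have hmem : ∀ z ∈ C, x' + ε • (x' - z) ∈ edom d := fun z hz => by
    have hspan : x' + ε • (x' - z) ∈ affineSpan ℝ (edom d) := by
      have h1 := AffineMap.lineMap_mem (1 + ε) (subset_affineSpan ℝ _ (hCd hz)) hx'
      have h2 : AffineMap.lineMap z x' (1 + ε) = x' + ε • (x' - z) := by
        rw [AffineMap.lineMap_apply_module']; module
      rwa [h2] at h1
    have h3 : (⟨x' + ε • (x' - z), hspan⟩ : affineSpan ℝ (edom d)) ∈ Metric.ball ⟨x', hx'⟩ r := by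
      rw [Metric.mem_ball, Subtype.dist_eq, dist_eq_norm, add_sub_cancel_left, norm_smul,
        Real.norm_of_nonneg hεpos.le]
      have h4 : ‖x' - z‖ ≤ |ρ| := by
        rw [norm_sub_rev]
        exact (mem_closedBall_iff_norm.1 (hρ hz)).trans (le_abs_self _)
      calc ε * ‖x' - z‖ ≤ ε * (|ρ| + 1) := by gcongr; linarith
        _ = r / 2 := by rw [hε]; field_simp
        _ < r := by linarith
    have h5 : (⟨x' + ε • (x' - z), hspan⟩ : affineSpan ℝ (edom d)) ∈ Subtype.val ⁻¹' edom d :=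
      interior_subset (hball h3)
    exact h5
  obtain ⟨c₁, hc₁⟩ := hC.exists_bound_of_continuousOn (hd.cont.mono hCd)
  obtain ⟨c₂, hc₂⟩ := hC.exists_bound_of_continuousOn
    (f := fun z => (d (x' + ε • (x' - z))).toReal)
    (hd.cont.comp (f := fun z => x' + ε • (x' - z)) (by fun_prop) hmem)
  set m : ℝ := -(d x').toReal with hm
  refine ⟨|c₁ + m| + ε⁻¹ * |c₂ + m|, 1 + ε⁻¹, by positivity,
    by positivity, fun z hz a ha => ?_⟩
  have h1 := (le_abs_self _).trans (hc₁ z hz)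
  have h2 := (le_abs_self _).trans (hc₂ z hz)
  have h3 := hd.le_toReal (hmem z hz) ha
  have h4 : d' a (x' + ε • (x' - z) - a) = d' a (x' - a) + ε * d' a (x' - z) := by
    rw [add_sub_right_comm, map_add, map_smul, smul_eq_mul]
  rw [h4] at h3
  have h5 : ε * d' a (x' - z) ≤ |c₂ + m| + breg d d' x' a := by
    have := le_abs_self (c₂ + m)
    have := hm
    unfold breg
    linarith
  have h6 : d' a (x' - z) ≤ ε⁻¹ * (|c₂ + m| + breg d d' x' a) := by
    rw [inv_mul_eq_div, le_div_iff₀ hεpos]; linarith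
  have h7 : breg d d' z a = breg d d' x' a + ((d z).toReal - (d x').toReal) + d' a (x' - z) := by
    have : d' a (z - a) = d' a (x' - a) - d' a (x' - z) := by rw [← map_sub]; congr 1; abel
    unfold breg
    rw [this]; ring
  have h8 := le_abs_self (c₁ + m)
  have h9 := hm
  rw [h7]
  linarith

theorem energy₀_eq (α : ℝ) (x₀ : X) (K : ℕ) (z : X) :
    energy₀ d d' α x₀ K z = (α + (1 - α) * K) * breg d d' z x₀ := by
  simp [energy₀]; ring

theorem energy₀_le {α : ℝ} (hα0 : 0 ≤ α) {x₀ z : X} {K : ℕ} (hK : 1 ≤ K)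
    (h : 0 ≤ breg d d' z x₀) : energy₀ d d' α x₀ K z ≤ K * breg d d' z x₀ := by
  rw [energy₀_eq]
  have hK' : (1 : ℝ) ≤ K := by exact_mod_cast hK
  gcongr
  nlinarith

theorem energy₀_nonneg {α : ℝ} (hα0 : 0 ≤ α) (hα1 : α ≤ 1) {x₀ z : X} {K : ℕ}
    (h : 0 ≤ breg d d' z x₀) : 0 ≤ energy₀ d d' α x₀ K z := by
  rw [energy₀_eq]
  have := sub_nonneg.2 hα1
  positivity

end Compact

/-- For each test point the defining inequality is a sublevel set of a lower semicontinuous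
function, since F₂ is continuous. -/
theorem HVI.Standing.isClosed_S₂ {X : Type u} [NormedAddCommGroup X] [NormedSpace ℝ X]
    {P : HVI X} (hP : P.Standing) : IsClosed P.S₂ := by
  obtain ⟨L, hL⟩ := hP.lip₂
  have e : P.S₂ = ⋂ z, {x | P.g₂ x + ((-P.F₂ x (z - x) : ℝ) : EReal) ≤ P.g₂ z} := by
    ext x
    simp only [Set.mem_iInter]
    exact Iff.rfl
  rw [e]
  refine isClosed_iInter fun z => LowerSemicontinuous.isClosed_preimage ?_ (P.g₂ z)
  refine hP.gamma₂.lsc.add' (Continuous.lowerSemicontinuous ?_) fun x => ?_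
  · refine continuous_coe_real_ereal.comp (Continuous.neg ?_)
    exact hL.continuous.clm_apply (continuous_const.sub continuous_id)
  · exact EReal.continuousAt_add (Or.inr (EReal.coe_ne_bot _)) (Or.inr (EReal.coe_ne_top _))

/-! ### Ergodic averages -/

section Ergodic

variable {X : Type u} [NormedAddCommGroup X] [NormedSpace ℝ X]

theorem sumStep_pos {τ : ℕ → ℝ} (hτ : ∀ s, 0 < τ s) {S : ℕ} (hS : 1 ≤ S) : 0 < sumStep τ S :=
  Finset.sum_pos (fun s _ => hτ s) (by simp; omega)

theorem ergodic_eq_sum {Ω : Type*} (τ : ℕ → ℝ) (K : ℕ) (y : ℕ → ℕ → Ω → X) (S : ℕ) (ω : Ω) :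
    ergodic τ K y S ω = ∑ p ∈ Finset.range S ×ˢ Finset.range K,
      ((K * sumStep τ S)⁻¹ * τ p.1) • y p.1 (p.2 + 1) ω := by
  rw [ergodic, Finset.sum_product, Finset.smul_sum]
  refine Finset.sum_congr rfl fun s _ => ?_
  rw [smul_smul, Finset.smul_sum]

theorem sum_ergodic_weights {τ : ℕ → ℝ} (hτ : ∀ s, 0 < τ s) {K S : ℕ} (hK : 1 ≤ K) (hS : 1 ≤ S) :
    ∑ p ∈ Finset.range S ×ˢ Finset.range K, (K * sumStep τ S)⁻¹ * τ p.1 = 1 := by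
  have hT := sumStep_pos hτ hS
  have hK' : (0 : ℝ) < K := by exact_mod_cast hK
  rw [Finset.sum_product]
  simp only [Finset.sum_const, Finset.card_range, nsmul_eq_mul, ← Finset.mul_sum]
  change (K : ℝ) * ((K * sumStep τ S)⁻¹ * sumStep τ S) = 1
  field_simp

theorem ergodic_mem {Ω : Type*} {Z : Set X} (hZ : Convex ℝ Z) {τ : ℕ → ℝ} (hτ : ∀ s, 0 < τ s)
    {K S : ℕ} (hK : 1 ≤ K) (hS : 1 ≤ S) {y : ℕ → ℕ → Ω → X} {ω : Ω}
    (hy : ∀ s, ∀ k < K, y s (k + 1) ω ∈ Z) : ergodic τ K y S ω ∈ Z := by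
  have hT := sumStep_pos hτ hS
  rw [ergodic_eq_sum]
  refine hZ.sum_mem (fun p _ => ?_) (sum_ergodic_weights hτ hK hS) fun p hp => ?_
  · have := hτ p.1; positivity
  · exact hy _ _ (Finset.mem_range.1 (Finset.mem_product.1 hp).2)

theorem _root_.ConvexOn.map_ergodic_le {Ω : Type*} {Z : Set X} {f : X → ℝ} (hf : ConvexOn ℝ Z f)
    {τ : ℕ → ℝ} (hτ : ∀ s, 0 < τ s) {K S : ℕ} (hK : 1 ≤ K) (hS : 1 ≤ S) {y : ℕ → ℕ → Ω → X} {ω : Ω}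
    (hy : ∀ s, ∀ k < K, y s (k + 1) ω ∈ Z) :
    f (ergodic τ K y S ω) ≤ (K * sumStep τ S)⁻¹ *
      ∑ s ∈ Finset.range S, ∑ k ∈ Finset.range K, τ s * f (y s (k + 1) ω) := by
  have hT := sumStep_pos hτ hS
  rw [ergodic_eq_sum]
  refine (hf.map_sum_le (fun p _ => ?_) (sum_ergodic_weights hτ hK hS) fun p hp => ?_).trans_eq ?_
  · have := hτ p.1; positivity
  · exact hy _ _ (Finset.mem_range.1 (Finset.mem_product.1 hp).2)
  · rw [Finset.sum_product, Finset.mul_sum]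
    refine Finset.sum_congr rfl fun s _ => ?_
    rw [Finset.mul_sum]
    exact Finset.sum_congr rfl fun k _ => by rw [smul_eq_mul, mul_assoc]

end Ergodic

/-! ### Expected gaps of the ergodic average -/

section Core

/-- Abel summation: the weight increments are nonnegative, so each energy may be replaced by a
majorant. In the application the majorant does not depend on the comparison point. -/
theorem sum_mul_sub_succ_le {θ e A : ℕ → ℝ} (hmono : Monotone θ) (h0 : 0 ≤ θ 0)
    (hA : ∀ s, e s ≤ A s) (n : ℕ) :
    ∑ s ∈ Finset.range (n + 1), θ s * (e s - e (s + 1)) + θ n * e (n + 1)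
      ≤ θ 0 * A 0 + ∑ s ∈ Finset.range n, (θ (s + 1) - θ s) * A (s + 1) := by
  induction n with
  | zero =>
    have := mul_le_mul_of_nonneg_left (hA 0) h0
    simp only [zero_add, Finset.sum_range_one, Finset.sum_range_zero]
    linarith
  | succ n ih =>
    rw [Finset.sum_range_succ _ (n + 1),
      Finset.sum_range_succ (fun s => (θ (s + 1) - θ s) * A (s + 1)) n]
    have := mul_le_mul_of_nonneg_left (hA (n + 1)) (sub_nonneg.2 (hmono (Nat.le_succ n)))
    linarith

variable {X : Type u} [NormedAddCommGroup X] [NormedSpace ℝ X]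
  [FiniteDimensional ℝ X] [MeasurableSpace X] [BorelSpace X]

namespace MirrorProxRun

variable {P : HVI X} {d : X → EReal} {d' : X → StrongDual ℝ X} {α : ℝ} {τ β : ℕ → ℝ} {x₀ : X}
  {K : ℕ} {O : StochasticOracle.{u, v} P.Z (fun s => P.V (β s))}
  (r : MirrorProxRun.{u, v, w} P d d' α τ β x₀ K O) {xs : X} {ps : StrongDual ℝ X}

section

variable {r}
variable (H : Admissible P d d' α τ β x₀ K O xs ps)
include H

theorem Admissible.h_nonneg (s : ℕ) : 0 ≤ (P.h (β s • ps)).toReal :=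
  H.multiplier.toReal_h_nonneg H.standing (H.β_pos s).le (H.h_ne_top s)

theorem energy_nonneg (s : ℕ) {z : X} (hz : z ∈ edom d) (ω : r.Ω) : 0 ≤ r.energy s z ω := by
  have h1 := H.dgf.breg_nonneg hz (r.x_mem s 0 ω (Nat.zero_le K))
  have h2 : 0 ≤ ∑ j ∈ Finset.Icc 1 K, breg d d' z (r.prev s j ω) :=
    Finset.sum_nonneg fun j hj => r.prev_breg_nonneg H s (Finset.mem_Icc.1 hj).2 hz ω
  have h3 := H.α_pos.le
  have h4 := sub_nonneg.2 H.α_lt.le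
  unfold energy
  positivity

theorem integral_energy_le' (S : ℕ) :
    ∫ ω, r.energy S xs ω ∂r.μ
      ≤ energy₀ d d' α x₀ K xs + K * ∑ s ∈ Finset.range S, τ s * (P.h (β s • ps)).toReal := by
  refine le_trans (le_add_of_nonneg_right ?_) (r.integral_energy_le H S)
  have h4 := sub_nonneg.2 H.α_lt.le
  have : 0 ≤ ∑ s ∈ Finset.range S, ∑ k ∈ Finset.range K,
        ∫ ω, ‖r.y s (k + 1) ω - r.w s ω‖ ^ 2 ∂r.μ :=
    Finset.sum_nonneg fun s _ => Finset.sum_nonneg fun k _ =>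
      integral_nonneg fun ω => by positivity
  positivity

/-- Split y − x* at the snapshot w. The displacement contributes 2 · 8 and the average divergence 8,
each times the energy bound over 1 − α; together 24. -/
theorem sum_integral_sq_y_le (s : ℕ) :
    ∑ k ∈ Finset.range K, ∫ ω, ‖r.y s (k + 1) ω - xs‖ ^ 2 ∂r.μ
      ≤ 24 / (1 - α) * (energy₀ d d' α x₀ K xs
        + K * ∑ t ∈ Finset.range (s + 1), τ t * (P.h (β t • ps)).toReal) := by
  have := r.prob
  have hα := sub_pos.2 H.α_lt
  have hK' : (K : ℝ) ≠ 0 := by have := H.one_le; positivity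
  set M := energy₀ d d' α x₀ K xs
        + K * ∑ t ∈ Finset.range (s + 1), τ t * (P.h (β t • ps)).toReal with hM
  set D : ℕ → ℕ → ℝ := fun s k => ∫ ω, ‖r.y s (k + 1) ω - r.w s ω‖ ^ 2 ∂r.μ
  have hD0 : ∀ s k, 0 ≤ D s k := fun s k => integral_nonneg fun ω => by positivity
  have hxs := H.dgf.feasible H.xs_mem_Z
  have h1 : (1 - α) / 8 * ∑ k ∈ Finset.range K, D s k ≤ M := by
    refine le_trans ?_ (r.integral_energy_le H (s + 1))
    have h2 : 0 ≤ ∫ ω, r.energy (s + 1) xs ω ∂r.μ :=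
      integral_nonneg fun ω => r.energy_nonneg H (s + 1) hxs ω
    have h3 : ∑ k ∈ Finset.range K, D s k
        ≤ ∑ s ∈ Finset.range (s + 1), ∑ k ∈ Finset.range K, D s k := by
      rw [Finset.sum_range_succ]
      exact le_add_of_nonneg_left (Finset.sum_nonneg fun s _ => Finset.sum_nonneg fun k _ => hD0 s k)
    have := mul_le_mul_of_nonneg_left h3 (by positivity : 0 ≤ (1 - α) / 8)
    linarith
  have h2 : (1 - α) * (K * ∫ ω, r.avgBreg s xs ω ∂r.μ) ≤ M := by
    rw [← integral_const_mul, ← integral_const_mul]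
    refine (integral_mono (((r.integrable_avgBreg H s).const_mul _).const_mul _)
      (r.integrable_energy H s) fun ω => ?_).trans ((r.integral_energy_le' H s).trans ?_)
    · have h3 : K * r.avgBreg s xs ω = ∑ j ∈ Finset.Icc 1 K, breg d d' xs (r.prev s j ω) := by
        unfold avgBreg; field_simp
      have := mul_nonneg H.α_pos.le (H.dgf.breg_nonneg hxs (r.x_mem s 0 ω (Nat.zero_le K)))
      simp only [h3, energy]
      linarith
    · rw [hM, Finset.sum_range_succ]
      have := mul_nonneg (H.τ_pos s).le (H.h_nonneg s)
      gcongr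
      linarith
  have h3 : ∀ k ∈ Finset.range K, ∫ ω, ‖r.y s (k + 1) ω - xs‖ ^ 2 ∂r.μ
      ≤ 2 * D s k + 8 * ∫ ω, r.avgBreg s xs ω ∂r.μ := fun k hk => by
    rw [Finset.mem_range] at hk
    rw [← integral_const_mul, ← integral_const_mul,
      ← integral_add ((r.integrable_sq_diff H s hk).const_mul _)
        ((r.integrable_avgBreg H s).const_mul _)]
    have hy := r.memLp_y H s hk
    refine integral_mono ((memLp_two_iff_integrable_sq_norm hy.1).1 hy)
      (((r.integrable_sq_diff H s hk).const_mul _).add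
        ((r.integrable_avgBreg H s).const_mul _)) fun ω => ?_
    have h4 := r.sq_norm_w_sub_le H s H.xs_mem_Z ω
    have h5 : ‖r.y s (k + 1) ω - xs‖ ≤ ‖r.y s (k + 1) ω - r.w s ω‖ + ‖r.w s ω - xs‖ :=
      norm_sub_le_norm_sub_add_norm_sub _ _ _
    have h6 := pow_le_pow_left₀ (norm_nonneg _) h5 2
    simp only
    nlinarith [sq_nonneg (‖r.y s (k + 1) ω - r.w s ω‖ - ‖r.w s ω - xs‖)]
  have h4 := Finset.sum_le_sum h3
  rw [Finset.sum_add_distrib, Finset.sum_const, Finset.card_range, nsmul_eq_mul,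
    ← Finset.mul_sum] at h4
  rw [div_mul_eq_mul_div, le_div_iff₀ hα]
  have h5 := mul_le_mul_of_nonneg_right h4 hα.le
  linarith

theorem ergodic_mem_Z {S : ℕ} (hS : 1 ≤ S) (ω : r.Ω) : ergodic τ K r.y S ω ∈ P.Z :=
  ergodic_mem H.standing.convex_Z H.τ_pos H.one_le hS fun s _ hk => r.y_mem_Z s hk ω

theorem map_ergodic_le {f : X → ℝ} (hf : ConvexOn ℝ P.Z f) {S : ℕ} (hS : 1 ≤ S) (ω : r.Ω) :
    f (ergodic τ K r.y S ω) ≤ (K * sumStep τ S)⁻¹ *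
      ∑ s ∈ Finset.range S, ∑ k ∈ Finset.range K, τ s * f (r.y s (k + 1) ω) :=
  hf.map_ergodic_le H.τ_pos H.one_le hS fun s _ hk => r.y_mem_Z s hk ω

omit H in
variable (r) in
theorem measurable_ergodic (S : ℕ) : Measurable (ergodic τ K r.y S) := by
  refine Measurable.const_smul (Finset.measurable_sum _ fun s _ => ?_) _
  refine Measurable.const_smul (Finset.measurable_sum _ fun k hk => ?_) _
  exact r.measurable_y s k (Finset.mem_range.1 hk)

omit H in
theorem integrable_average {f : X → ℝ} (S : ℕ)
    (hf : ∀ s, ∀ k < K, Integrable (fun ω => f (r.y s (k + 1) ω)) r.μ) :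
    Integrable (fun ω => (K * sumStep τ S)⁻¹ *
      ∑ s ∈ Finset.range S, ∑ k ∈ Finset.range K, τ s * f (r.y s (k + 1) ω)) r.μ :=
  (integrable_finsetSum _ fun s _ => integrable_finsetSum _ fun k hk =>
    (hf s k (Finset.mem_range.1 hk)).const_mul _).const_mul _

theorem integrable_norm_ergodic_sub {S : ℕ} (hS : 1 ≤ S) :
    Integrable (fun ω => ‖ergodic τ K r.y S ω - xs‖) r.μ := by
  have := r.prob
  have hconv : ConvexOn ℝ P.Z fun z => ‖z - xs‖ := by
    simpa only [dist_eq_norm] using convexOn_dist xs H.standing.convex_Z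
  exact integrable_of_le_of_le ((r.measurable_ergodic S).sub_const xs).norm.aestronglyMeasurable
    (integrable_const 0) (r.integrable_average (f := fun z => ‖z - xs‖) S
      fun s k hk => r.integrable_norm_y_sub H s hk)
    (fun ω => norm_nonneg _) fun ω => r.map_ergodic_le H hconv hS ω

theorem integrable_g_ergodic {S : ℕ} (hS : 1 ≤ S) :
    Integrable (fun ω => (P.g₁ (ergodic τ K r.y S ω)).toReal) r.μ ∧
      Integrable (fun ω => (P.g₂ (ergodic τ K r.y S ω)).toReal) r.μ := by
  have := r.prob
  have hN := r.integrable_norm_ergodic_sub H hS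
  constructor
  · refine integrable_of_le_of_le
      (H.standing.gamma₁.measurable_toReal.comp (r.measurable_ergodic S)).aestronglyMeasurable
      (g := fun ω => (P.g₁ xs).toReal - ‖P.F₁ xs + ps‖ * ‖ergodic τ K r.y S ω - xs‖)
      ((integrable_const _).sub (hN.const_mul _))
      (r.integrable_average (f := fun z => (P.g₁ z).toReal) S
        fun s k hk => (r.integrable_g H s hk).1) (fun ω => ?_) fun ω =>
        r.map_ergodic_le H (H.standing.gamma₁.convexOn.subset Set.inter_subset_left
          H.standing.convex_Z) hS ω
    have h1 := H.multiplier.neg_apply_le H.standing (r.ergodic_mem_Z H hS ω).1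
    have h2 := (le_abs_self _).trans ((P.F₁ xs + ps).le_opNorm (ergodic τ K r.y S ω - xs))
    rw [add_apply] at h2
    linarith
  · refine integrable_of_le_of_le
      (H.standing.gamma₂.measurable_toReal.comp (r.measurable_ergodic S)).aestronglyMeasurable
      (g := fun ω => (P.g₂ xs).toReal - ‖P.F₂ xs‖ * ‖ergodic τ K r.y S ω - xs‖)
      ((integrable_const _).sub (hN.const_mul _))
      (r.integrable_average (f := fun z => (P.g₂ z).toReal) S
        fun s k hk => (r.integrable_g H s hk).2) (fun ω => ?_) fun ω =>
        r.map_ergodic_le H (H.standing.gamma₂.convexOn.subset Set.inter_subset_right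
          H.standing.convex_Z) hS ω
    have h1 := H.standing.bifun₂_nonneg (r.ergodic_mem_Z H hS ω).2 H.multiplier.mem_S₂
    have h2 := (le_abs_self _).trans ((P.F₂ xs).le_opNorm (ergodic τ K r.y S ω - xs))
    linarith

theorem hasExpectation_gapFeas {U : Set X} (hUc : IsCompact U) (hU : U ⊆ P.Z) (hne : U.Nonempty)
    {S : ℕ} (hS : 1 ≤ S) :
    HasExpectation r.μ fun ω => P.gapFeas U (ergodic τ K r.y S ω) := by
  have := r.prob
  obtain ⟨L, hL⟩ := H.standing.lip₂
  have hU2 : U ⊆ edom P.g₂ := fun z hz => (hU hz).2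
  obtain ⟨c, _, hc⟩ := exists_linear_growth H.standing.gamma₂ hL H.multiplier.mem_S₂ hU2
    hUc.isBounded
  exact hasExpectation_gap H.standing.gamma₂ P.F₂ hU2 hne hc (r.measurable_ergodic S)
    (fun ω => (r.ergodic_mem_Z H hS ω).2) (r.integrable_norm_ergodic_sub H hS)
    (r.integrable_g_ergodic H hS).2

theorem hasExpectation_gapOpt {U : Set X} (hUc : IsCompact U) (hU : U ⊆ edom P.g₁)
    (hne : (U ∩ P.S₂).Nonempty) {S : ℕ} (hS : 1 ≤ S) :
    HasExpectation r.μ fun ω => P.gapOpt U (ergodic τ K r.y S ω) := by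
  have := r.prob
  obtain ⟨L, hL⟩ := H.standing.lip₁
  have hU1 : U ∩ P.S₂ ⊆ edom P.g₁ := Set.inter_subset_left.trans hU
  obtain ⟨c, _, hc⟩ := exists_linear_growth H.standing.gamma₁ hL H.multiplier.2 hU1
    (hUc.isBounded.subset Set.inter_subset_left)
  exact hasExpectation_gap H.standing.gamma₁ P.F₁ hU1 hne hc (r.measurable_ergodic S)
    (fun ω => (r.ergodic_mem_Z H hS ω).1) (r.integrable_norm_ergodic_sub H hS)
    (r.integrable_g_ergodic H hS).1

theorem integrable_infDist {S : ℕ} (hS : 1 ≤ S) :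
    Integrable (fun ω => Metric.infDist (ergodic τ K r.y S ω) P.S₂) r.μ := by
  have := r.prob
  refine integrable_of_le_of_le
    ((Metric.continuous_infDist_pt P.S₂).measurable.comp
      (r.measurable_ergodic S)).aestronglyMeasurable
    (integrable_const 0) (r.integrable_norm_ergodic_sub H hS) (fun ω => Metric.infDist_nonneg)
    fun ω => ?_
  rw [← dist_eq_norm]
  exact Metric.infDist_le_dist_of_mem H.multiplier.mem_S₂

/-- Weighted telescoping over the epochs. -/
theorem weighted_sum_resid_le {θ : ℕ → ℝ} (hθ : ∀ s, 0 < θ s) (S : ℕ) {z : X} (hz : z ∈ P.Z)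
    (ω : r.Ω) :
    ∑ s ∈ Finset.range S, θ s * ∑ k ∈ Finset.range K, τ s * r.resid s k z ω
      ≤ ∑ s ∈ Finset.range S, θ s * (r.energy s z ω - r.energy (s + 1) z ω)
        + ∑ s ∈ Finset.range S, θ s * ∑ k ∈ Finset.range K,
          (τ s * r.noise s k ω (z - r.y s (k + 1) ω) + r.excess s k ω) := by
  rw [← Finset.sum_add_distrib]
  refine Finset.sum_le_sum fun s _ => ?_
  rw [← mul_add]
  exact mul_le_mul_of_nonneg_left (r.epoch_le H s hz ω) (hθ s).le

end

theorem convexOn_bifun {Z : Set X} {g : X → ℝ} (hg : ConvexOn ℝ Z g) (u : StrongDual ℝ X) (z : X)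
    (c : ℝ) : ConvexOn ℝ Z fun x => u (x - z) + g x - c := by
  refine ⟨hg.1, fun x hx y hy a b ha hb hab => ?_⟩
  have h1 := hg.2 hx hy ha hb hab
  have h2 : a • x + b • y - z = a • (x - z) + b • (y - z) := by
    obtain rfl : b = 1 - a := by linarith
    module
  simp only [h2, map_add, map_smul, smul_eq_mul] at h1 ⊢
  obtain rfl : b = 1 - a := by linarith
  linarith

end MirrorProxRun

open MirrorProxRun

variable {P : HVI X} {d : X → EReal} {d' : X → StrongDual ℝ X} {α : ℝ} {x₀ xs : X}
  {ps : StrongDual ℝ X}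

/-- In the feasibility estimate the upper-level part of the residual has no sign and must be
discarded at a controlled price. -/
theorem exists_neg_bifun₁_le (hP : P.Standing) (hVar : P.FiniteVariation)
    (hps : P.IsMultiplier xs ps) {U : Set X} (hUc : IsCompact U) (hU : U ⊆ P.Z) :
    ∃ c : ℝ, 0 ≤ c ∧ ∀ z ∈ U, ∀ y ∈ P.Z,
      -(P.F₁ z (y - z) + (P.g₁ y).toReal - (P.g₁ z).toReal) ≤ c * (1 + ‖y - xs‖) := by
  obtain ⟨L, hL⟩ := hP.lip₁
  obtain ⟨c, hc0, hc⟩ := exists_linear_growth (F := fun z => -P.F₁ z) hP.gamma₁ hL.neg hps.2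
    (fun z hz => (hU hz).1) hUc.isBounded
  obtain ⟨m, hm⟩ := hVar.2 U {xs} hUc isCompact_singleton hU
    (Set.singleton_subset_iff.2 (hps.mem_Z hP))
  -- The growth bound leaves 2g₁(z) − g₁(y): finite variation replaces each g₁(z) by g₁(x*) + m, and
  -- the multiplier bounds g₁(y) from below.
  refine ⟨c + 2 * |m| + |(P.g₁ xs).toReal| + ‖P.F₁ xs + ps‖, by positivity, fun z hz y hy => ?_⟩
  have h1 := hc z hz y
  rw [neg_apply] at h1
  have h2 : |(P.g₁ z).toReal - (P.g₁ xs).toReal| ≤ m := hm ⟨z, hz, xs, rfl, rfl⟩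
  have h3 := (le_abs_self _).trans h2
  have h4 := hps.neg_apply_le hP hy.1
  have h5 := (le_abs_self _).trans ((P.F₁ xs + ps).le_opNorm (y - xs))
  rw [add_apply] at h5
  have h6 := le_abs_self m
  have h7 := le_abs_self (P.g₁ xs).toReal
  have h8 : 0 ≤ (2 * |m| + |(P.g₁ xs).toReal|) * ‖y - xs‖ := by positivity
  have h9 := norm_nonneg (P.F₁ xs + ps)
  linarith

/-- Expected feasibility gap: apart from the initial energy, the constants depend only on a bound
for the accumulated values of `h`. -/
theorem exists_expect_gapFeas_le (hP : P.Standing) (hVar : P.FiniteVariation)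
    (hd : IsDGF P.Z d d') (hα0 : 0 < α) (hα1 : α < 1) (hx₀ : x₀ ∈ subdiffDom d)
    (hps : P.IsMultiplier xs ps) {U : Set X} (hUc : IsCompact U) (hU : U ⊆ P.Z) (hne : U.Nonempty)
    (M₀ : ℝ) :
    ∃ c : ℝ, 0 < c ∧ ∀ (τ β : ℕ → ℝ) (K : ℕ)
      (O : StochasticOracle.{u, v} P.Z (fun s => P.V (β s))),
      Admissible P d d' α τ β x₀ K O xs ps →
      (∀ S, ∑ s ∈ Finset.range S, τ s * (P.h (β s • ps)).toReal ≤ M₀) →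
      ∀ (r : MirrorProxRun.{u, v, w} P d d' α τ β x₀ K O) (S : ℕ), 1 ≤ S →
        expect r.μ (fun ω => P.gapFeas U (ergodic τ K r.y S ω))
          ≤ (K * sumStep τ S)⁻¹ * (sSup (energy₀ d d' α x₀ K '' U) + c
            + c * (K * ∑ s ∈ Finset.range S, β s * τ s)) := by
  obtain ⟨c₁, hc₁0, hc₁⟩ := exists_neg_bifun₁_le hP hVar hps hUc hU
  obtain ⟨R, hR⟩ := exists_coord_bound (Module.finBasis ℝ X) hUc.isBounded xs
  obtain ⟨c₂, hc₂0, hc₂⟩ := hd.exists_breg_le hUc (hU.trans hd.feasible) x₀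
  set N₀ : ℝ := Fintype.card (Fin (Module.finrank ℝ X))
    * (2 * R ^ 2 * (∑ i, ‖Module.finBasis ℝ X i‖ ^ 2 + 1)) with hN₀
  have hN₀0 : 0 ≤ N₀ := by positivity
  have hα := sub_pos.2 hα1
  have hD0 : 0 ≤ breg d d' xs x₀ := hd.breg_nonneg (hd.feasible (hps.mem_Z hP)) hx₀
  -- A bound for E‖y − x*‖² averaged over one epoch: both the initial energy and the h-terms are at
  -- most proportional to K, so the factor K divides out.
  set c₃ : ℝ := 24 / (1 - α) * (breg d d' xs x₀ + |M₀|) with hc₃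
  have hc₃0 : 0 ≤ c₃ := by positivity
  refine ⟨N₀ + 2 * c₁ * (1 + c₃) + 1, by positivity, fun τ β K O H hM r S hS => ?_⟩
  have := r.prob
  have hT := sumStep_pos H.τ_pos hS
  have hK : (0 : ℝ) < K := by exact_mod_cast H.one_le
  obtain ⟨S, rfl⟩ := Nat.exists_eq_add_of_le' hS
  obtain ⟨N, hNi, hNle, hNz⟩ := r.exists_noise_bound H (Module.finBasis ℝ X) hR
    (θ := fun _ => 1) (fun _ => one_pos) monotone_const S
  rw [← hN₀, mul_one] at hNle
  set A : ℝ := sSup (energy₀ d d' α x₀ K '' U) with hA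
  have hAz : ∀ z ∈ U, energy₀ d d' α x₀ K z ≤ A := fun z hz => by
    refine le_csSup ⟨K * c₂, ?_⟩ ⟨z, hz, rfl⟩
    rintro _ ⟨q, hq, rfl⟩
    refine (energy₀_le hα0.le H.one_le
      (hd.breg_nonneg (hd.feasible (hU hq)) hx₀)).trans ?_
    gcongr
    exact hc₂ q hq
  set Y : r.Ω → ℝ := fun ω => ∑ s ∈ Finset.range (S + 1), ∑ k ∈ Finset.range K,
    β s * τ s * (2 * c₁ * (1 + ‖r.y s (k + 1) ω - xs‖ ^ 2)) with hY
  have hU2 : U ⊆ edom P.g₂ := fun z hz => (hU hz).2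
  have hpt : ∀ ω, (P.gapFeas U (ergodic τ K r.y (S + 1) ω)).toReal
      ≤ (K * sumStep τ (S + 1))⁻¹ * (A + N ω + Y ω) := fun ω => by
    refine toReal_gap_le hP.gamma₂ P.F₂ hU2 hne (r.ergodic_mem_Z H hS ω).2 fun z hz => ?_
    refine (r.map_ergodic_le H (convexOn_bifun (hP.gamma₂.convexOn.subset Set.inter_subset_right
      hP.convex_Z) (P.F₂ z) z (P.g₂ z).toReal) hS ω).trans ?_
    refine mul_le_mul_of_nonneg_left ?_ (by positivity)
    have h1 : ∑ s ∈ Finset.range (S + 1), ∑ k ∈ Finset.range K,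
        τ s * (P.F₂ z (r.y s (k + 1) ω - z) + (P.g₂ (r.y s (k + 1) ω)).toReal - (P.g₂ z).toReal)
        ≤ ∑ s ∈ Finset.range (S + 1), (1 : ℝ) * ∑ k ∈ Finset.range K, τ s * r.resid s k z ω
          + Y ω := by
      rw [hY, ← Finset.sum_add_distrib]
      refine Finset.sum_le_sum fun s _ => ?_
      rw [one_mul, ← Finset.sum_add_distrib]
      refine Finset.sum_le_sum fun k hk => ?_
      have hy := r.y_mem_Z s (Finset.mem_range.1 hk) ω
      have h2 := hP.regularized_le (H.β_pos s).le (r.y s (k + 1) ω) z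
      have h3 := hc₁ z hz _ hy
      -- Linear growth is traded for quadratic growth, since second moments are what the energy
      -- controls.
      have h4 : 1 + ‖r.y s (k + 1) ω - xs‖ ≤ 2 * (1 + ‖r.y s (k + 1) ω - xs‖ ^ 2) := by
        nlinarith [sq_nonneg (‖r.y s (k + 1) ω - xs‖ - 1)]
      have h5 := mul_le_mul_of_nonneg_left (h3.trans (mul_le_mul_of_nonneg_left h4 hc₁0))
        (H.β_pos s).le
      have h6 : P.F₂ z (r.y s (k + 1) ω - z) + (P.g₂ (r.y s (k + 1) ω)).toReal - (P.g₂ z).toReal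
          ≤ r.resid s k z ω + β s * (2 * c₁ * (1 + ‖r.y s (k + 1) ω - xs‖ ^ 2)) := by
        unfold resid
        linarith
      have := mul_le_mul_of_nonneg_left h6 (H.τ_pos s).le
      linarith
    have h2 := r.weighted_sum_resid_le H (θ := fun _ => 1) (fun _ => one_pos) (S + 1) (hU hz) ω
    have h3 := hNz ω z hz
    have h4 : ∑ s ∈ Finset.range (S + 1), (1 : ℝ) * (r.energy s z ω - r.energy (s + 1) z ω)
        = r.energy 0 z ω - r.energy (S + 1) z ω := by
      simp only [one_mul]
      rw [Finset.sum_range_sub']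
    have h5 := r.energy_nonneg H (S + 1) (hd.feasible (hU hz)) ω
    have h6 := hAz z hz
    rw [h4, r.energy_zero] at h2
    linarith
  have hyi : ∀ s, ∀ k ∈ Finset.range K, Integrable (fun ω => β s * τ s *
      (2 * c₁ * (1 + ‖r.y s (k + 1) ω - xs‖ ^ 2))) r.μ := fun s k hk => by
    have hy := r.memLp_y H s (Finset.mem_range.1 hk)
    exact (((integrable_const _).add ((memLp_two_iff_integrable_sq_norm hy.1).1 hy)).const_mul
      _).const_mul _
  have hYi : Integrable Y r.μ := integrable_finsetSum _ fun s _ => integrable_finsetSum _ (hyi s)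
  have hYle : ∫ ω, Y ω ∂r.μ
      ≤ 2 * c₁ * (1 + c₃) * (K * ∑ s ∈ Finset.range (S + 1), β s * τ s) := by
    rw [hY, integral_finsetSum _ fun s _ => integrable_finsetSum _ (hyi s), Finset.mul_sum,
      Finset.mul_sum]
    refine Finset.sum_le_sum fun s _ => ?_
    rw [integral_finsetSum _ (hyi s)]
    have h1 : ∀ k ∈ Finset.range K, ∫ ω, β s * τ s *
        (2 * c₁ * (1 + ‖r.y s (k + 1) ω - xs‖ ^ 2)) ∂r.μ
        = β s * τ s * (2 * c₁ * (1 + ∫ ω, ‖r.y s (k + 1) ω - xs‖ ^ 2 ∂r.μ)) := fun k hk => by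
      have hy := r.memLp_y H s (Finset.mem_range.1 hk)
      rw [integral_const_mul, integral_const_mul, integral_add (integrable_const _)
        ((memLp_two_iff_integrable_sq_norm hy.1).1 hy), integral_const]
      simp
    rw [Finset.sum_congr rfl h1, ← Finset.mul_sum, ← Finset.mul_sum, Finset.sum_add_distrib,
      Finset.sum_const, Finset.card_range, nsmul_eq_mul, mul_one]
    have h2 : ∑ k ∈ Finset.range K, ∫ ω, ‖r.y s (k + 1) ω - xs‖ ^ 2 ∂r.μ ≤ K * c₃ := by
      refine (r.sum_integral_sq_y_le H s).trans ?_
      have h3 := energy₀_le hα0.le H.one_le hD0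
      have h4 := (hM (s + 1)).trans (le_abs_self M₀)
      calc _ ≤ 24 / (1 - α) * (K * breg d d' xs x₀ + K * |M₀|) := by gcongr
        _ = K * c₃ := by rw [hc₃]; ring
    have h3 := (H.β_pos s).le
    have h4 := (H.τ_pos s).le
    calc _ ≤ β s * τ s * (2 * c₁ * (K + K * c₃)) := by gcongr
      _ = _ := by ring
  have hfin := integral_mono (r.hasExpectation_gapFeas H hUc hU hne hS).2
    ((((integrable_const A).add hNi).add hYi).const_mul (K * sumStep τ (S + 1))⁻¹) hpt
  rw [integral_const_mul, integral_add' ((integrable_const A).add hNi) hYi,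
    integral_add' (integrable_const A) hNi, integral_const] at hfin
  simp only [probReal_univ, one_smul] at hfin
  refine hfin.trans (mul_le_mul_of_nonneg_left ?_ (by positivity))
  have h1 : 0 ≤ K * ∑ s ∈ Finset.range (S + 1), β s * τ s :=
    mul_nonneg hK.le (Finset.sum_nonneg fun s _ => mul_nonneg (H.β_pos s).le (H.τ_pos s).le)
  have h2 : 0 ≤ 2 * c₁ * (1 + c₃) := by positivity
  have h3 := mul_nonneg hN₀0 h1
  linarith

/-- Expected optimality gap, when the reference solution is in the relative interior of the domain
of the distance-generating function. -/
theorem exists_expect_gapOpt_le (hP : P.Standing) (hd : IsDGF P.Z d d') (hα0 : 0 < α)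
    (hα1 : α < 1) (hx₀ : x₀ ∈ subdiffDom d) (hps : P.IsMultiplier xs ps)
    (hri : xs ∈ intrinsicInterior ℝ (edom d)) {U : Set X} (hUc : IsCompact U)
    (hU : U ⊆ edom P.g₁) (hne : (U ∩ P.S₂).Nonempty) (M₀ : ℝ) :
    ∃ c : ℝ, 0 < c ∧ ∀ (τ β : ℕ → ℝ) (K : ℕ)
      (O : StochasticOracle.{u, v} P.Z (fun s => P.V (β s))),
      Admissible P d d' α τ β x₀ K O xs ps → Antitone β →
      (∀ S, ∑ s ∈ Finset.range S, τ s * (P.h (β s • ps)).toReal ≤ M₀) →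
      ∀ (r : MirrorProxRun.{u, v, w} P d d' α τ β x₀ K O) (S : ℕ),
        expect r.μ (fun ω => P.gapOpt U (ergodic τ K r.y (S + 1) ω))
          ≤ (K * sumStep τ (S + 1))⁻¹ * (c * K * (β S)⁻¹) := by
  have hU' : U ∩ P.S₂ ⊆ P.Z := fun z hz => ⟨hU hz.1, hP.S₂_subset hz.2⟩
  have hUc' : IsCompact (U ∩ P.S₂) := hUc.inter_right hP.isClosed_S₂
  have hU1 : U ∩ P.S₂ ⊆ edom P.g₁ := Set.inter_subset_left.trans hU
  obtain ⟨R, hR⟩ := exists_coord_bound (Module.finBasis ℝ X) hUc'.isBounded xs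
  obtain ⟨a, a', ha0, ha0', ha⟩ := hd.exists_breg_le_of_mem_intrinsicInterior hUc'
    (hU'.trans hd.feasible) hri
  set N₀ : ℝ := Fintype.card (Fin (Module.finrank ℝ X))
    * (2 * R ^ 2 * (∑ i, ‖Module.finBasis ℝ X i‖ ^ 2 + 1)) with hN₀
  have hN₀0 : 0 ≤ N₀ := by positivity
  have hα := sub_pos.2 hα1
  have hD0 : 0 ≤ breg d d' xs x₀ := hd.breg_nonneg (hd.feasible (hps.mem_Z hP)) hx₀
  set c₃ : ℝ := a + a' * (breg d d' xs x₀ + |M₀|) with hc₃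
  have hc₃0 : 0 ≤ c₃ := by positivity
  refine ⟨N₀ + c₃ + 1, by positivity, fun τ β K O H hanti hM r S => ?_⟩
  have := r.prob
  have hS : 1 ≤ S + 1 := by omega
  have hT := sumStep_pos H.τ_pos hS
  have hK1 : (1 : ℝ) ≤ K := by exact_mod_cast H.one_le
  have hK : (0 : ℝ) < K := by linarith
  set θ : ℕ → ℝ := fun s => (β s)⁻¹ with hθ
  have hθpos : ∀ s, 0 < θ s := fun s => inv_pos.2 (H.β_pos s)
  have hmono : Monotone θ := fun s t hst => inv_anti₀ (H.β_pos t) (hanti hst)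
  obtain ⟨N, hNi, hNle, hNz⟩ := r.exists_noise_bound H (Module.finBasis ℝ X) hR hθpos hmono S
  rw [← hN₀] at hNle
  -- A majorant of the energies, uniform over the comparison points, whose expectation is O(K). The
  -- relative-interior assumption is used to obtain it.
  set A : ℕ → r.Ω → ℝ := fun s ω => K * a + a' * r.energy s xs ω with hA
  have hAi : ∀ s, Integrable (A s) r.μ := fun s =>
    (integrable_const _).add ((r.integrable_energy H s).const_mul _)
  have hAle : ∀ s, ∫ ω, A s ω ∂r.μ ≤ K * c₃ := fun s => by
    have h1 := r.integral_energy_le' H s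
    have h3 := energy₀_le hα0.le H.one_le hD0
    have h4 := (hM s).trans (le_abs_self M₀)
    rw [hA, integral_add (integrable_const _) ((r.integrable_energy H s).const_mul _),
      integral_const, integral_const_mul]
    simp only [probReal_univ, one_smul]
    calc _ ≤ K * a + a' * (K * breg d d' xs x₀ + K * |M₀|) := by
          gcongr
          refine h1.trans ?_
          gcongr
      _ = K * c₃ := by rw [hc₃]; ring
  have hEA : ∀ s, ∀ z ∈ U ∩ P.S₂, ∀ ω, r.energy s z ω ≤ A s ω := fun s z hz ω => by
    have h1 := mul_le_mul_of_nonneg_left (ha z hz _ (r.x_mem s 0 ω (Nat.zero_le K))) hα0.le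
    have h2 : ∑ j ∈ Finset.Icc 1 K, breg d d' z (r.prev s j ω)
        ≤ K * a + a' * ∑ j ∈ Finset.Icc 1 K, breg d d' xs (r.prev s j ω) := by
      refine (Finset.sum_le_sum fun j hj => ha z hz _
        (r.prev_mem_subdiffDom hx₀ s (Finset.mem_Icc.1 hj).2 ω)).trans_eq ?_
      rw [Finset.sum_add_distrib, ← Finset.mul_sum]
      simp
    have h3 := mul_le_mul_of_nonneg_left h2 hα.le
    have h4 : α * a ≤ α * (K * a) := by
      have : a ≤ K * a := le_mul_of_one_le_left ha0 hK1
      gcongr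
    simp only [hA, energy]
    linarith
  set W : r.Ω → ℝ := fun ω => θ 0 * A 0 ω
    + ∑ s ∈ Finset.range S, (θ (s + 1) - θ s) * A (s + 1) ω with hW
  have hsi : ∀ s ∈ Finset.range S, Integrable (fun ω => (θ (s + 1) - θ s) * A (s + 1) ω) r.μ :=
    fun s _ => (hAi (s + 1)).const_mul _
  have hWi : Integrable W r.μ := ((hAi 0).const_mul _).add (integrable_finsetSum _ hsi)
  have hWle : ∫ ω, W ω ∂r.μ ≤ θ S * (K * c₃) := by
    rw [hW, integral_add ((hAi 0).const_mul _) (integrable_finsetSum _ hsi), integral_const_mul,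
      integral_finsetSum _ hsi]
    have h1 := mul_le_mul_of_nonneg_left (hAle 0) (hθpos 0).le
    have h2 : ∑ s ∈ Finset.range S, ∫ ω, (θ (s + 1) - θ s) * A (s + 1) ω ∂r.μ
        ≤ ∑ s ∈ Finset.range S, (θ (s + 1) - θ s) * (K * c₃) := by
      refine Finset.sum_le_sum fun s _ => ?_
      rw [integral_const_mul]
      exact mul_le_mul_of_nonneg_left (hAle (s + 1)) (sub_nonneg.2 (hmono (Nat.le_succ s)))
    rw [← Finset.sum_mul, Finset.sum_range_sub] at h2
    linarith
  have hpt : ∀ ω, (P.gapOpt U (ergodic τ K r.y (S + 1) ω)).toReal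
      ≤ (K * sumStep τ (S + 1))⁻¹ * (W ω + N ω) := fun ω => by
    refine toReal_gap_le hP.gamma₁ P.F₁ hU1 hne (r.ergodic_mem_Z H hS ω).1 fun z hz => ?_
    refine (r.map_ergodic_le H (convexOn_bifun (hP.gamma₁.convexOn.subset Set.inter_subset_left
      hP.convex_Z) (P.F₁ z) z (P.g₁ z).toReal) hS ω).trans ?_
    refine mul_le_mul_of_nonneg_left ?_ (by positivity)
    have h1 : ∑ s ∈ Finset.range (S + 1), ∑ k ∈ Finset.range K,
        τ s * (P.F₁ z (r.y s (k + 1) ω - z) + (P.g₁ (r.y s (k + 1) ω)).toReal - (P.g₁ z).toReal)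
        ≤ ∑ s ∈ Finset.range (S + 1), θ s * ∑ k ∈ Finset.range K, τ s * r.resid s k z ω := by
      refine Finset.sum_le_sum fun s _ => ?_
      rw [Finset.mul_sum]
      refine Finset.sum_le_sum fun k hk => ?_
      have hy := r.y_mem_Z s (Finset.mem_range.1 hk) ω
      have h2 := hP.regularized_le (H.β_pos s).le (r.y s (k + 1) ω) z
      -- Since z ∈ S₂ the lower-level part is nonnegative, and the weight 1/β_s turns the rest into
      -- the upper-level bifunction.
      have h3 := hP.bifun₂_nonneg hy.2 hz.2
      have h4 : P.F₁ z (r.y s (k + 1) ω - z) + (P.g₁ (r.y s (k + 1) ω)).toReal - (P.g₁ z).toReal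
          ≤ θ s * r.resid s k z ω := by
        rw [hθ]
        simp only
        rw [inv_mul_eq_div, le_div_iff₀ (H.β_pos s)]
        unfold resid
        linarith
      have := mul_le_mul_of_nonneg_left h4 (H.τ_pos s).le
      linarith
    have h2 := r.weighted_sum_resid_le H hθpos (S + 1) (hU' hz) ω
    have h3 := hNz ω z hz
    have h4 := sum_mul_sub_succ_le (e := fun s => r.energy s z ω) (A := fun s => A s ω) hmono
      (hθpos 0).le (fun s => hEA s z hz ω) S
    have h5 := mul_nonneg (hθpos S).le (r.energy_nonneg H (S + 1) (hd.feasible (hU' hz)) ω)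
    simp only [hW]
    linarith
  have hfin := integral_mono (r.hasExpectation_gapOpt H hUc hU hne hS).2
    ((hWi.add hNi).const_mul (K * sumStep τ (S + 1))⁻¹) hpt
  rw [integral_const_mul, integral_add' hWi hNi] at hfin
  refine hfin.trans (mul_le_mul_of_nonneg_left ?_ (by positivity))
  have h1 : N₀ * θ S ≤ N₀ * K * θ S := by
    have : N₀ ≤ N₀ * K := le_mul_of_one_le_right hN₀0 hK1
    have := (hθpos S).le
    gcongr
  have h2 : 0 ≤ K * θ S := mul_nonneg hK.le (hθpos S).le
  change _ ≤ (N₀ + c₃ + 1) * K * θ S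
  linarith

end Core

/-! ### Weak sharpness -/

section WeakSharpness

/-- Jensen's inequality for t ↦ t^ρ; the pointwise bound also supplies integrability of f^ρ. -/
theorem integral_le_rpow_of_mul_rpow_le {Ω : Type*} [MeasurableSpace Ω] {μ : Measure Ω}
    [IsProbabilityMeasure μ] {f G : Ω → ℝ} {κ ρ W : ℝ} (hκ : 0 < κ) (hρ : 1 ≤ ρ)
    (hf0 : ∀ ω, 0 ≤ f ω) (hf : Integrable f μ) (hG : Integrable G μ)
    (h : ∀ ω, κ / ρ * f ω ^ ρ ≤ G ω) (hW : ∫ ω, G ω ∂μ ≤ W) :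
    ∫ ω, f ω ∂μ ≤ (ρ / κ * W) ^ (1 / ρ) := by
  have hρ0 : 0 < ρ := by linarith
  have hle : ∀ ω, f ω ^ ρ ≤ ρ / κ * G ω := fun ω => by
    have := mul_le_mul_of_nonneg_left (h ω) (by positivity : 0 ≤ ρ / κ)
    rwa [← mul_assoc, div_mul_div_comm, mul_comm κ ρ, div_self (by positivity), one_mul] at this
  have hcont : ContinuousOn (fun t : ℝ => t ^ ρ) (Set.Ici 0) :=
    (Real.continuous_rpow_const hρ0.le).continuousOn
  have hfρ : Integrable (fun ω => f ω ^ ρ) μ := by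
    refine (hG.const_mul (ρ / κ)).mono'
      ((Real.continuous_rpow_const hρ0.le).comp_aestronglyMeasurable hf.1)
      (Filter.Eventually.of_forall fun ω => ?_)
    rw [Real.norm_of_nonneg (Real.rpow_nonneg (hf0 ω) _)]
    exact hle ω
  have h1 := (convexOn_rpow hρ).map_integral_le hcont isClosed_Ici
    (Filter.Eventually.of_forall fun ω => hf0 ω) hf hfρ
  have h2 : ∫ ω, f ω ^ ρ ∂μ ≤ ρ / κ * W := by
    refine (integral_mono hfρ (hG.const_mul (ρ / κ)) hle).trans ?_
    rw [integral_const_mul]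
    gcongr
  have h0 : 0 ≤ ∫ ω, f ω ∂μ := integral_nonneg hf0
  calc ∫ ω, f ω ∂μ = ((∫ ω, f ω ∂μ) ^ ρ) ^ (1 / ρ) := by
        rw [one_div, Real.rpow_rpow_inv h0 hρ0.ne']
    _ ≤ (ρ / κ * W) ^ (1 / ρ) := by
        refine Real.rpow_le_rpow (Real.rpow_nonneg h0 _) (h1.trans h2) (by positivity)

variable {X : Type u} [NormedAddCommGroup X] [NormedSpace ℝ X] {P : HVI X}

/-- Under weak sharpness, `h` grows at most like the conjugate power of the norm. -/
theorem HVI.WeaklySharp.h_le (hP : P.Standing) {κ ρ : ℝ} (hw : P.WeaklySharp κ ρ) (hρ : 1 < ρ)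
    {x : X} {p : StrongDual ℝ X} (hp : P.IsMultiplier x p) {β : ℝ} (hβ : 0 ≤ β) :
    P.h (β • p) ≤ (((κ ^ (-(1 / ρ)) * (β * ‖p‖)) ^ (ρ / (ρ - 1)) / (ρ / (ρ - 1)) : ℝ) : EReal) := by
  obtain ⟨hκ, -, hws⟩ := hw
  set c : ℝ := (κ ^ (-(1 / ρ)) * (β * ‖p‖)) ^ (ρ / (ρ - 1)) / (ρ / (ρ - 1)) with hc
  have hρ0 : 0 < ρ := by linarith
  unfold HVI.h
  rw [hp.supp_eq hβ, EReal.sub_le_iff_le_add (Or.inl (EReal.coe_ne_bot _))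
    (Or.inl (EReal.coe_ne_top _))]
  refine iSup₂_le fun z hz => iSup₂_le fun y hy => ?_
  rw [hP.gamma₂.bifun_eq _ (hP.S₂_subset hz) hy, ← EReal.coe_add, ← EReal.coe_add,
    EReal.coe_le_coe_iff]
  have h1 := hws z hz y hy
  rw [hP.gamma₂.bifun_eq _ hy (hP.S₂_subset hz), EReal.coe_le_coe_iff] at h1
  -- Monotonicity gives H(z, y) ≤ −H(y, z), so weak sharpness makes the bifunction in `h` at most
  -- −(κ/ρ) dist(y, S₂)^ρ.
  have h2 := hP.mono₂.apply_sub_le z y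
  have h3 : P.F₂ z (z - y) = -P.F₂ z (y - z) := by rw [← map_neg, neg_sub]
  have h4 : β * (p y - p x) ≤ β * (‖p‖ * Metric.infDist y P.S₂) := by
    gcongr
    rcases (norm_nonneg p).eq_or_lt with h0 | h0
    · have : p = 0 := norm_eq_zero.1 h0.symm
      simp [this]
    rw [mul_comm, ← div_le_iff₀ h0]
    refine (Metric.le_infDist ⟨z, hz⟩).2 fun q hq => ?_
    rw [div_le_iff₀ h0, dist_eq_norm, mul_comm]
    have h5 := hp.1.2 q hq
    have h6 := (le_abs_self _).trans (p.le_opNorm (y - q))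
    rw [map_sub] at h5 h6
    linarith
  -- The scaling by κ^{1/ρ} makes the first Young term equal to the weak-sharpness term, which then
  -- cancels.
  have hy := Real.young_inequality_of_nonneg (a := κ ^ (1 / ρ) * Metric.infDist y P.S₂)
    (b := κ ^ (-(1 / ρ)) * (β * ‖p‖)) (mul_nonneg (by positivity) Metric.infDist_nonneg)
    (by positivity) (Real.HolderConjugate.conjExponent hρ)
  have h5 : (κ ^ (1 / ρ) * Metric.infDist y P.S₂) ^ ρ = κ * Metric.infDist y P.S₂ ^ ρ := by
    rw [Real.mul_rpow (by positivity) Metric.infDist_nonneg, ← Real.rpow_mul hκ.le,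
      one_div_mul_cancel hρ0.ne', Real.rpow_one]
  have h6 : κ ^ (1 / ρ) * Metric.infDist y P.S₂ * (κ ^ (-(1 / ρ)) * (β * ‖p‖))
      = β * (‖p‖ * Metric.infDist y P.S₂) := by
    have : κ ^ (1 / ρ) * κ ^ (-(1 / ρ)) = 1 := by
      rw [← Real.rpow_add hκ, add_neg_cancel, Real.rpow_zero]
    linear_combination β * (‖p‖ * Metric.infDist y P.S₂) * this
  rw [h5, h6] at hy
  have h7 : Real.conjExponent ρ = ρ / (ρ - 1) := rfl
  rw [h7, ← hc] at hy
  have h8 : κ * Metric.infDist y P.S₂ ^ ρ / ρ = κ / ρ * Metric.infDist y P.S₂ ^ ρ := by ring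
  rw [smul_apply, smul_eq_mul]
  linarith

end WeakSharpness

/-! ### Polynomial regularization -/

section Polynomial

/-- Weighted AM–GM for n and n + 1 shows that n^{1−δ} grows by at least (1−δ)(n+1)^{−δ} per step; δ
< 1/2 makes the factor 2 sufficient. -/
theorem sum_rpow_neg_le {δ : ℝ} (h0 : 0 < δ) (h1 : δ < 1 / 2) (S : ℕ) :
    ∑ s ∈ Finset.range S, ((s : ℝ) + 1) ^ (-δ) ≤ 2 * (S : ℝ) ^ (1 - δ) := by
  induction S with
  | zero => simp [Real.zero_rpow (by linarith : 1 - δ ≠ 0)]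
  | succ n ih =>
    rw [Finset.sum_range_succ]
    have hn : (0 : ℝ) < (n : ℝ) + 1 := by positivity
    have h2 := Real.geom_mean_le_arith_mean2_weighted (by linarith : 0 ≤ 1 - δ) h0.le
      (Nat.cast_nonneg n) hn.le (by ring : 1 - δ + δ = 1)
    have h3 : ((n : ℝ) + 1) ^ (1 - δ) = ((n : ℝ) + 1) * ((n : ℝ) + 1) ^ (-δ) := by
      rw [sub_eq_add_neg, Real.rpow_add hn, Real.rpow_one]
    have h4 : ((n : ℝ) + 1) ^ δ * ((n : ℝ) + 1) ^ (-δ) = 1 := by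
      rw [← Real.rpow_add hn, add_neg_cancel, Real.rpow_zero]
    have h5 := mul_le_mul_of_nonneg_right h2 (Real.rpow_nonneg hn.le (-δ))
    have h6 : 0 < ((n : ℝ) + 1) ^ (-δ) := Real.rpow_pos_of_pos hn _
    rw [mul_assoc, h4] at h5
    push_cast
    rw [h3]
    nlinarith

theorem one_div_rpow_eq {K : ℕ} (δ : ℝ) (s : ℕ) :
    1 / ((K : ℝ) * (s + 1)) ^ δ = (K : ℝ) ^ (-δ) * ((s : ℝ) + 1) ^ (-δ) := by
  have : (0 : ℝ) ≤ (s : ℝ) + 1 := by positivity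
  rw [one_div, ← Real.rpow_neg (by positivity), Real.mul_rpow (by positivity) this]

end Polynomial

/-! ### Complexity bounds -/

section Final

open MirrorProxRun

variable {X : Type u} [NormedAddCommGroup X] [NormedSpace ℝ X] {P : HVI X} {d : X → EReal}
  {d' : X → StrongDual ℝ X} {α : ℝ} {x₀ xs : X} {ps : StrongDual ℝ X}

theorem toReal_le_of_le_coe {x : EReal} {c : ℝ} (hc : 0 ≤ c) (h : x ≤ (c : EReal)) :
    x.toReal ≤ c := by
  induction x with
  | bot => simpa using hc
  | coe r => simpa using h
  | top => simp at h

theorem sSup_breg_nonneg (hd : IsDGF P.Z d d') (hx₀ : x₀ ∈ subdiffDom d) {U : Set X}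
    (hU : U ⊆ P.Z) : 0 ≤ sSup ((fun x => breg d d' x x₀) '' U) := by
  refine Real.sSup_nonneg ?_
  rintro _ ⟨z, hz, rfl⟩
  exact hd.breg_nonneg (hd.feasible (hU hz)) hx₀

theorem sSup_energy₀_le_Rsq (hd : IsDGF P.Z d d') (hα0 : 0 ≤ α) (hα1 : α ≤ 1)
    (hx₀ : x₀ ∈ subdiffDom d) {U : Set X} (hU : U ⊆ P.Z) (hxs : xs ∈ P.Z) (K : ℕ) :
    sSup (energy₀ d d' α x₀ K '' U) ≤ Rsq d d' α x₀ U K xs := by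
  have h1 := sSup_breg_nonneg hd hx₀ hU
  have h2 := energy₀_nonneg hα0 hα1 (K := K) (hd.breg_nonneg (hd.feasible hxs) hx₀)
  unfold Rsq
  linarith

theorem hTilde_nonneg {κ ρ δ : ℝ} (hκ : 0 ≤ κ) (hρ : 1 < ρ) (hδ : 1 < δ * (ρ / (ρ - 1)))
    (p : StrongDual ℝ X) : 0 ≤ hTilde κ ρ δ p := by
  have h1 : 0 < ρ - 1 := by linarith
  have h2 : 0 < δ * (ρ / (ρ - 1)) - 1 := by linarith
  have h3 : 0 < ρ := by linarith
  unfold hTilde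
  positivity

/-! ### Consequences of summability of τ_s h(β_s p*). -/

section Summability

variable {τ β : ℕ → ℝ} (hτ : ∀ s, 0 < τ s)
  (hsum : (∑' s, ENNReal.ofReal (τ s) * (P.h (β s • ps)).toENNReal) ≠ ⊤)
include hτ hsum

theorem h_ne_top_of_tsum_ne_top (s : ℕ) : P.h (β s • ps) ≠ ⊤ := by
  intro h
  have h1 := ENNReal.ne_top_of_tsum_ne_top hsum s
  rw [h, EReal.toENNReal_top, ENNReal.mul_top (by simpa using hτ s)] at h1
  exact h1 rfl

theorem sum_toReal_h_le_tsum (hh : ∀ s, 0 ≤ (P.h (β s • ps)).toReal) (S : ℕ) :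
    ∑ s ∈ Finset.range S, τ s * (P.h (β s • ps)).toReal
      ≤ (∑' s, ENNReal.ofReal (τ s) * (P.h (β s • ps)).toENNReal).toReal := by
  rw [← ENNReal.ofReal_le_iff_le_toReal hsum,
    ENNReal.ofReal_sum_of_nonneg fun s _ => mul_nonneg (hτ s).le (hh s)]
  refine le_trans (le_of_eq (Finset.sum_congr rfl fun s _ => ?_)) (ENNReal.sum_le_tsum _)
  rw [ENNReal.ofReal_mul (hτ s).le,
    EReal.toENNReal_of_ne_top (h_ne_top_of_tsum_ne_top hτ hsum s)]

end Summability

/-- The accumulated values of `h` along polynomial regularization are bounded uniformly in the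
epoch length. -/
theorem exists_sum_h_polynomial_le (hP : P.Standing) (hps : P.IsMultiplier xs ps) {κ ρ δ : ℝ}
    (hw : P.WeaklySharp κ ρ) (hρ : 1 < ρ) (hδ0 : 0 < δ) (hδ : 1 < δ * (ρ / (ρ - 1))) :
    ∃ M : ℝ, ∀ (K : ℕ) (β : ℕ → ℝ), 1 ≤ K → (∀ s, β s = 1 / ((K : ℝ) * (s + 1)) ^ δ) →
      ∀ S, ∑ s ∈ Finset.range S, (P.h (β s • ps)).toReal ≤ M := by
  have hκ := hw.1
  set q := ρ / (ρ - 1) with hq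
  have hq0 : 0 < q := div_pos (by linarith) (by linarith)
  have hsummable : Summable fun s : ℕ => ((s : ℝ) + 1) ^ (-(δ * q)) := by
    have h1 := (summable_nat_add_iff 1).2 (Real.summable_nat_rpow.2 (by linarith : -(δ * q) < -1))
    simpa using h1
  set a : ℝ := (κ ^ (-(1 / ρ)) * ‖ps‖) ^ q / q with ha
  have ha0 : 0 ≤ a := by positivity
  refine ⟨a * ∑' s : ℕ, ((s : ℝ) + 1) ^ (-(δ * q)), fun K β hK hβ S => ?_⟩
  have hK' : (1 : ℝ) ≤ K := by exact_mod_cast hK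
  have hterm : ∀ s, (P.h (β s • ps)).toReal ≤ a * ((s : ℝ) + 1) ^ (-(δ * q)) := fun s => by
    have hs : (0 : ℝ) < (s : ℝ) + 1 := by positivity
    have hβs : β s = (K : ℝ) ^ (-δ) * ((s : ℝ) + 1) ^ (-δ) := by rw [hβ, one_div_rpow_eq]
    have hβ0 : 0 ≤ β s := by rw [hβs]; positivity
    have h1 := toReal_le_of_le_coe (by positivity) (hw.h_le hP hρ hps hβ0)
    refine h1.trans ?_
    -- Dropping the factor K^{−δ} ≤ 1 makes the bound uniform in K.
    have h2 : β s ≤ ((s : ℝ) + 1) ^ (-δ) := by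
      rw [hβs]
      refine mul_le_of_le_one_left (by positivity) ?_
      exact Real.rpow_le_one_of_one_le_of_nonpos hK' (by linarith)
    have h3 : κ ^ (-(1 / ρ)) * (β s * ‖ps‖)
        ≤ (κ ^ (-(1 / ρ)) * ‖ps‖) * ((s : ℝ) + 1) ^ (-δ) := by
      rw [mul_assoc, mul_comm ‖ps‖]; gcongr
    have h4 := Real.rpow_le_rpow (by positivity) h3 hq0.le
    have e : ((κ ^ (-(1 / ρ)) * ‖ps‖) * ((s : ℝ) + 1) ^ (-δ)) ^ q
        = (κ ^ (-(1 / ρ)) * ‖ps‖) ^ q * ((s : ℝ) + 1) ^ (-(δ * q)) := by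
      rw [Real.mul_rpow (x := κ ^ (-(1 / ρ)) * ‖ps‖) (by positivity) (by positivity),
        ← Real.rpow_mul hs.le, neg_mul]
    rw [e] at h4
    rw [ha, div_mul_eq_mul_div]
    exact div_le_div_of_nonneg_right h4 hq0.le
  calc ∑ s ∈ Finset.range S, (P.h (β s • ps)).toReal
      ≤ ∑ s ∈ Finset.range S, a * ((s : ℝ) + 1) ^ (-(δ * q)) :=
        Finset.sum_le_sum fun s _ => hterm s
    _ ≤ a * ∑' s : ℕ, ((s : ℝ) + 1) ^ (-(δ * q)) := by
        rw [← Finset.mul_sum]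
        gcongr
        exact hsummable.sum_le_tsum _ fun s _ => by positivity

variable [FiniteDimensional ℝ X] [MeasurableSpace X] [BorelSpace X]

namespace MirrorProxRun

variable {τ β : ℕ → ℝ} {K : ℕ} {O : StochasticOracle.{u, v} P.Z (fun s => P.V (β s))}
  (H : Admissible P d d' α τ β x₀ K O xs ps)
include H

/-- The additive noise constant is absorbed into the regularization term, because K Σ β_s τ_s ≥ β_0
τ_0. This explains the shape of the constant, which is free of K and S. -/
theorem Admissible.le_WFeas {U : Set X} (hU : U ⊆ P.Z) {c : ℝ} (hc : 0 ≤ c) {S : ℕ} (hS : 1 ≤ S) :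
    (K * sumStep τ S)⁻¹ * (sSup (energy₀ d d' α x₀ K '' U) + c
        + c * (K * ∑ s ∈ Finset.range S, β s * τ s))
      ≤ WFeas P d d' α τ β x₀ U xs ps (c + c / (β 0 * τ 0)) K S := by
  have hT := sumStep_pos H.τ_pos hS
  have hK1 : (1 : ℝ) ≤ K := by exact_mod_cast H.one_le
  have hK : (0 : ℝ) < K := by linarith
  have hA := sSup_energy₀_le_Rsq H.dgf H.α_pos.le H.α_lt.le H.start_subdiff hU H.xs_mem_Z K
  have hb : 0 < β 0 * τ 0 := mul_pos (H.β_pos 0) (H.τ_pos 0)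
  set B := ∑ s ∈ Finset.range S, β s * τ s with hB
  have hB0 : β 0 * τ 0 ≤ B :=
    Finset.single_le_sum (f := fun s => β s * τ s)
      (fun s _ => mul_nonneg (H.β_pos s).le (H.τ_pos s).le) (Finset.mem_range.2 hS)
  have hh : 0 ≤ (∑ s ∈ Finset.range S, τ s * (P.h (β s • ps)).toReal) / (2 * sumStep τ S) :=
    div_nonneg (Finset.sum_nonneg fun s _ => mul_nonneg (H.τ_pos s).le (H.h_nonneg s))
      (by positivity)
  have h1 : c ≤ K * B * (c / (β 0 * τ 0)) := by
    have : β 0 * τ 0 ≤ K * B := hB0.trans (le_mul_of_one_le_left (hb.le.trans hB0) hK1)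
    calc c = β 0 * τ 0 * (c / (β 0 * τ 0)) := by rw [mul_div_cancel₀ _ hb.ne']
      _ ≤ _ := by gcongr
  have h2 : B / sumStep τ S * (c + c / (β 0 * τ 0))
      = (K * sumStep τ S)⁻¹ * (c * (K * B) + K * B * (c / (β 0 * τ 0))) := by
    field_simp
  have h3 : Rsq d d' α x₀ U K xs / (K * sumStep τ S)
      = (K * sumStep τ S)⁻¹ * Rsq d d' α x₀ U K xs := by rw [inv_mul_eq_div]
  unfold WFeas
  rw [h2, h3]
  have h4 : (K * sumStep τ S)⁻¹ * (sSup (energy₀ d d' α x₀ K '' U) + c + c * (K * B))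
      ≤ (K * sumStep τ S)⁻¹ * (Rsq d d' α x₀ U K xs
        + (c * (K * B) + K * B * (c / (β 0 * τ 0)))) := by
    refine mul_le_mul_of_nonneg_left ?_ (by positivity)
    linarith
  linarith

/-- The last weight among S + 1 epochs is 1/β_S, and monotonicity passes to 1/β_{S+1}; the other
terms of the bound are nonnegative. -/
theorem Admissible.le_WOpt (hanti : Antitone β) {U : Set X} (hU : U ⊆ edom P.g₁) {c : ℝ}
    (hc : 0 ≤ c) (S : ℕ) :
    (K * sumStep τ (S + 1))⁻¹ * (c * K * (β S)⁻¹)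
      ≤ WOpt P d d' α τ β x₀ U xs ps (c * K) K (S + 1) := by
  have hT := sumStep_pos H.τ_pos (Nat.le_add_left 1 S)
  have hK : (0 : ℝ) < K := by exact_mod_cast H.one_le
  have hβ := H.β_pos (S + 1)
  have hβ' := H.β_pos S
  have hsup := sSup_breg_nonneg H.dgf H.start_subdiff (U := U ∩ P.S₂)
    fun z hz => ⟨hU hz.1, H.standing.S₂_subset hz.2⟩
  have hE := energy₀_nonneg H.α_pos.le H.α_lt.le (K := K)
    (H.dgf.breg_nonneg (H.dgf.feasible H.xs_mem_Z) H.start_subdiff)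
  have hh : 0 ≤ ∑ s ∈ Finset.range (S + 1), τ s * (P.h (β s • ps)).toReal :=
    Finset.sum_nonneg fun s _ => mul_nonneg (H.τ_pos s).le (H.h_nonneg s)
  unfold WOpt
  have h1 : (K * sumStep τ (S + 1))⁻¹ * (c * K * (β S)⁻¹)
      ≤ c * K / (β (S + 1) * K * sumStep τ (S + 1)) := by
    have h2 : (β S)⁻¹ ≤ (β (S + 1))⁻¹ := inv_anti₀ hβ (hanti (Nat.le_succ S))
    calc _ ≤ (K * sumStep τ (S + 1))⁻¹ * (c * K * (β (S + 1))⁻¹) := by gcongr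
      _ = _ := by field_simp
  have h3 : 0 ≤ sSup ((fun x => breg d d' x x₀) '' (U ∩ P.S₂)) / (K * sumStep τ (S + 1)) := by
    positivity
  have h4 : 0 ≤ energy₀ d d' α x₀ K xs / (2 * K * β (S + 1) ^ 2 * sumStep τ (S + 1)) := by
    positivity
  have h5 : 0 ≤ (∑ s ∈ Finset.range (S + 1), τ s * (P.h (β s • ps)).toReal)
      / (2 * β (S + 1) ^ 2 * sumStep τ (S + 1)) := by positivity
  linarith

theorem integral_infDist_le {κ ρ : ℝ} (hw : P.WeaklySharp κ ρ) {U : Set X} (hUc : IsCompact U)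
    (hU : U ⊆ P.Z) (hne : (U ∩ P.S₂).Nonempty) (r : MirrorProxRun.{u, v, w} P d d' α τ β x₀ K O)
    {S : ℕ} (hS : 1 ≤ S) {W : ℝ}
    (hW : expect r.μ (fun ω => P.gapFeas U (ergodic τ K r.y S ω)) ≤ W) :
    ∫ ω, Metric.infDist (ergodic τ K r.y S ω) P.S₂ ∂r.μ ≤ (ρ / κ * W) ^ (1 / ρ) := by
  have := r.prob
  obtain ⟨z, hzU, hz⟩ := hne
  have hE := r.hasExpectation_gapFeas H hUc hU ⟨z, hzU⟩ hS
  refine integral_le_rpow_of_mul_rpow_le hw.1 hw.2.1 (fun ω => Metric.infDist_nonneg)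
    (r.integrable_infDist H hS) hE.2 (fun ω => ?_) hW
  have h1 := hw.2.2 z hz _ (r.ergodic_mem_Z H hS ω).2
  have h2 : bifun P.F₂ P.g₂ (ergodic τ K r.y S ω) z ≤ P.gapFeas U (ergodic τ K r.y S ω) :=
    le_iSup₂_of_le z hzU le_rfl
  have h3 := EReal.toReal_le_toReal (h1.trans h2) (EReal.coe_ne_bot _) (hE.1 ω).1
  rwa [EReal.toReal_coe] at h3

theorem neg_mul_integral_infDist_le {U : Set X} (hUc : IsCompact U) (hU : U ⊆ edom P.g₁)
    (hne : (U ∩ P.S₂).Nonempty) {B : ℝ}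
    (hB : ∀ x : X, ((-B * Metric.infDist x P.S₂ : ℝ) : EReal) ≤ P.gapOpt U x)
    (r : MirrorProxRun.{u, v, w} P d d' α τ β x₀ K O) {S : ℕ} (hS : 1 ≤ S) :
    -B * ∫ ω, Metric.infDist (ergodic τ K r.y S ω) P.S₂ ∂r.μ
      ≤ expect r.μ (fun ω => P.gapOpt U (ergodic τ K r.y S ω)) := by
  have hE := r.hasExpectation_gapOpt H hUc hU hne hS
  rw [← integral_const_mul]
  refine integral_mono ((r.integrable_infDist H hS).const_mul _) hE.2 fun ω => ?_
  have h3 := EReal.toReal_le_toReal (hB (ergodic τ K r.y S ω)) (EReal.coe_ne_bot _) (hE.1 ω).1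
  rwa [EReal.toReal_coe] at h3

end MirrorProxRun

theorem sumStep_const (t : ℝ) (S : ℕ) : sumStep (fun _ => t) S = S * t := by
  simp [sumStep]

/-- The additive constant decays like 1/(KS), hence at least as fast as (KS)^{−δ}. The computation
yields c/t + 2c, so the factor 4 is not tight. -/
theorem polynomial_feas_le {K S : ℕ} (hK : 1 ≤ K) (hS : 1 ≤ S) {δ t c A R : ℝ} (hδ0 : 0 < δ)
    (hδ1 : δ < 1 / 2) (ht : 0 < t) (hc : 0 ≤ c) (hAR : A ≤ R) {β : ℕ → ℝ}
    (hβ : ∀ s, β s = 1 / ((K : ℝ) * (s + 1)) ^ δ) :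
    (K * (S * t))⁻¹ * (A + c + c * (K * ∑ s ∈ Finset.range S, β s * t))
      ≤ R / (t * K * S) + 4 * (c / t + c) / ((K : ℝ) * S) ^ δ := by
  have hK' : (1 : ℝ) ≤ K := by exact_mod_cast hK
  have hS' : (1 : ℝ) ≤ S := by exact_mod_cast hS
  have hK0 : (0 : ℝ) < K := by linarith
  have hS0 : (0 : ℝ) < S := by linarith
  have hp : 0 < ((K : ℝ) * S) ^ δ := by positivity
  have hsum : ∑ s ∈ Finset.range S, β s * t ≤ t * ((K : ℝ) ^ (-δ) * (2 * (S : ℝ) ^ (1 - δ))) := by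
    rw [← Finset.sum_mul, mul_comm t]
    gcongr
    simp only [hβ, one_div_rpow_eq, ← Finset.mul_sum]
    gcongr
    exact sum_rpow_neg_le hδ0 hδ1 S
  have e : (K : ℝ) ^ (-δ) * (S : ℝ) ^ (1 - δ) = S / ((K : ℝ) * S) ^ δ := by
    rw [Real.mul_rpow hK0.le hS0.le, Real.rpow_neg hK0.le, Real.rpow_sub hS0, Real.rpow_one]
    field_simp
  have hle : ((K : ℝ) * S) ^ δ ≤ K * S := by
    have h1 : (1 : ℝ) ≤ K * S := one_le_mul_of_one_le_of_one_le hK' hS'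
    simpa using Real.rpow_le_rpow_of_exponent_le h1 (by linarith : δ ≤ 1)
  have h1 : c * (K * ∑ s ∈ Finset.range S, β s * t) ≤ K * (S * t) * (2 * c / ((K : ℝ) * S) ^ δ) := by
    calc _ ≤ c * (K * (t * ((K : ℝ) ^ (-δ) * (2 * (S : ℝ) ^ (1 - δ))))) := by gcongr
      _ = 2 * c * K * t * ((K : ℝ) ^ (-δ) * (S : ℝ) ^ (1 - δ)) := by ring
      _ = _ := by rw [e]; ring
  have h2 : c ≤ K * (S * t) * (c / t / ((K : ℝ) * S) ^ δ) := by
    have : K * (S * t) * (c / t / ((K : ℝ) * S) ^ δ) = c * (K * S / ((K : ℝ) * S) ^ δ) := by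
      field_simp
    rw [this]
    exact le_mul_of_one_le_right hc ((one_le_div hp).2 hle)
  have h3 : (K * (S * t))⁻¹ * (A + c + c * (K * ∑ s ∈ Finset.range S, β s * t))
      ≤ (K * (S * t))⁻¹ * (R + K * (S * t) * (c / t / ((K : ℝ) * S) ^ δ)
        + K * (S * t) * (2 * c / ((K : ℝ) * S) ^ δ)) := by
    gcongr
  refine h3.trans ?_
  have h4 : (K * (S * t))⁻¹ * (R + K * (S * t) * (c / t / ((K : ℝ) * S) ^ δ)
        + K * (S * t) * (2 * c / ((K : ℝ) * S) ^ δ))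
      = R / (t * K * S) + (c / t + 2 * c) / ((K : ℝ) * S) ^ δ := by
    field_simp
    ring
  rw [h4]
  have h5 : 0 ≤ c / t := by positivity
  gcongr
  linarith

theorem polynomial_opt_eq {K : ℕ} (hK : 1 ≤ K) (S : ℕ) {δ t c : ℝ} (ht : 0 < t) {β : ℕ → ℝ}
    (hβ : ∀ s, β s = 1 / ((K : ℝ) * (s + 1)) ^ δ) :
    (K * ((S + 1 : ℕ) * t))⁻¹ * (c * K * (β S)⁻¹)
      = c * K / (t * ((K : ℝ) * (S + 1 : ℕ)) ^ (1 - δ)) := by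
  have hK0 : (0 : ℝ) < K := by exact_mod_cast hK
  have hp : (0 : ℝ) < (K : ℝ) * (S + 1 : ℕ) := by positivity
  rw [hβ, one_div, inv_inv, Real.rpow_sub hp, Real.rpow_one]
  push_cast
  have : ((K : ℝ) * (S + 1)) ^ δ ≠ 0 := by positivity
  field_simp

end Final

end HierMP

/-! ### Assembly of the bounds. -/

theorem theorem2 {X : Type u} [NormedAddCommGroup X] [NormedSpace ℝ X]
    [FiniteDimensional ℝ X] [MeasurableSpace X] [BorelSpace X]
    (P : HVI X) (hP : P.Standing) (hVar : P.FiniteVariation) (hCQ : P.CQ)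
    (d : X → EReal) (d' : X → StrongDual ℝ X) (hd : IsDGF P.Z d d')
    (α : ℝ) (hα0 : 0 < α) (hα1 : α < 1)
    (x₀ : X) (hx₀ : x₀ ∈ P.Z) (hx₀' : x₀ ∈ subdiffDom d)
    (U₁ U₂ : Set X)
    (hU₁c : IsCompact U₁) (hU₁ : U₁ ⊆ edom P.g₁) (hU₁S : (U₁ ∩ P.S₁).Nonempty)
    (hU₂c : IsCompact U₂) (hU₂ : U₂ ⊆ P.Z) (hU₂S : (U₂ ∩ P.S₂).Nonempty)
    (xs : X) (hxs : xs ∈ P.S₁) (ps : StrongDual ℝ X) (hps : P.IsMultiplier xs ps) :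
    ∃ B : ℝ, 0 < B ∧
      (∀ x : X, ((-B * Metric.infDist x P.S₂ : ℝ) : EReal) ≤ P.gapOpt U₁ x) ∧
      -- complexity bounds for general step sizes and regularization parameters
      (∀ τ β : ℕ → ℝ, (∀ s, 0 < τ s) → (∀ s, 0 < β s) → Antitone β →
        (∑' s, ENNReal.ofReal (τ s) * (P.h (β s • ps)).toENNReal) ≠ ⊤ →
        ∃ C₁ C₂ : ℝ, 0 < C₁ ∧ 0 < C₂ ∧
          ∀ K : ℕ, 1 ≤ K →
          ∀ O : StochasticOracle.{u, v} P.Z (fun s => P.V (β s)),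
          (∀ s, τ s ≤ √(1 - α) / (2 * O.L s)) →
          ∀ r : MirrorProxRun.{u, v, w} P d d' α τ β x₀ K O,
          ∀ S : ℕ, 1 ≤ S →
            HasExpectation r.μ (fun ω => P.gapFeas U₂ (ergodic τ K r.y S ω)) ∧
            HasExpectation r.μ (fun ω => P.gapOpt U₁ (ergodic τ K r.y S ω)) ∧
            Integrable (fun ω => Metric.infDist (ergodic τ K r.y S ω) P.S₂) r.μ ∧
            expect r.μ (fun ω => P.gapFeas U₂ (ergodic τ K r.y S ω))
              ≤ WFeas P d d' α τ β x₀ U₂ xs ps C₂ K S ∧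
            -B * ∫ ω, Metric.infDist (ergodic τ K r.y S ω) P.S₂ ∂r.μ
              ≤ expect r.μ (fun ω => P.gapOpt U₁ (ergodic τ K r.y S ω)) ∧
            (xs ∈ intrinsicInterior ℝ (edom d) →
              expect r.μ (fun ω => P.gapOpt U₁ (ergodic τ K r.y S ω))
                ≤ WOpt P d d' α τ β x₀ U₁ xs ps (C₁ * K) K S) ∧
            (∀ κ ρ : ℝ, P.WeaklySharp κ ρ →
              -B * (ρ / κ * WFeas P d d' α τ β x₀ U₂ xs ps C₂ K S) ^ (1 / ρ)
                ≤ expect r.μ (fun ω => P.gapOpt U₁ (ergodic τ K r.y S ω)))) ∧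
      -- rates for constant step size and polynomial regularization
      (∀ κ ρ δ τbar : ℝ, P.WeaklySharp κ ρ → 1 < ρ → 0 < δ → δ < 1 / 2 →
        1 < δ * (ρ / (ρ - 1)) → 0 < τbar →
        ∃ C₁ C₂ : ℝ, 0 < C₁ ∧ 0 < C₂ ∧
          ∀ (K : ℕ) (β : ℕ → ℝ), 1 ≤ K → (∀ s, β s = 1 / ((K : ℝ) * (s + 1)) ^ δ) →
          ∀ O : StochasticOracle.{u, v} P.Z (fun s => P.V (β s)),
          (∀ s, τbar ≤ √(1 - α) / (2 * O.L s)) →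
          ∀ r : MirrorProxRun.{u, v, w} P d d' α (fun _ => τbar) β x₀ K O,
          ∀ S : ℕ, 1 ≤ S →
            HasExpectation r.μ (fun ω => P.gapFeas U₂ (ergodic (fun _ => τbar) K r.y S ω)) ∧
            HasExpectation r.μ (fun ω => P.gapOpt U₁ (ergodic (fun _ => τbar) K r.y S ω)) ∧
            expect r.μ (fun ω => P.gapFeas U₂ (ergodic (fun _ => τbar) K r.y S ω))
              ≤ Rsq d d' α x₀ U₂ K xs / (τbar * K * S)
                + 4 * C₂ / ((K : ℝ) * S) ^ δ
                + hTilde κ ρ δ ps / (2 * K * S) ∧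
            (xs ∈ intrinsicInterior ℝ (edom d) →
              expect r.μ (fun ω => P.gapOpt U₁ (ergodic (fun _ => τbar) K r.y S ω))
                ≤ C₁ * K / (τbar * ((K : ℝ) * S) ^ (1 - δ))
                  + sSup ((fun x => breg d d' x x₀) '' (U₁ ∩ P.S₂)) / (τbar * K * S)
                  + energy₀ d d' α x₀ K xs / (2 * τbar * ((K : ℝ) * S) ^ (1 - 2 * δ))
                  + hTilde κ ρ δ ps / (2 * ((K : ℝ) * S) ^ (1 - 2 * δ)))) := by
  have hxsZ := hps.mem_Z hP
  have hne₁ : (U₁ ∩ P.S₂).Nonempty := hU₁S.mono fun z hz => ⟨hz.1, hz.2.1⟩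
  have hne₂ : U₂.Nonempty := hU₂S.mono Set.inter_subset_left
  obtain ⟨B, hB0, hB⟩ := HVI.exists_le_gapOpt hP hCQ hU₁S
  -- The constant must be chosen before the relative-interior hypothesis is available; when it
  -- fails, the value 1 is an arbitrary default.
  have hOpt : ∀ M₀ : ℝ, ∃ c : ℝ, 0 < c ∧ (xs ∈ intrinsicInterior ℝ (edom d) →
      ∀ (τ β : ℕ → ℝ) (K : ℕ) (O : StochasticOracle.{u, v} P.Z (fun s => P.V (β s))),
      MirrorProxRun.Admissible P d d' α τ β x₀ K O xs ps → Antitone β →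
      (∀ S, ∑ s ∈ Finset.range S, τ s * (P.h (β s • ps)).toReal ≤ M₀) →
      ∀ (r : MirrorProxRun.{u, v, w} P d d' α τ β x₀ K O) (S : ℕ),
        expect r.μ (fun ω => P.gapOpt U₁ (ergodic τ K r.y (S + 1) ω))
          ≤ (K * sumStep τ (S + 1))⁻¹ * (c * K * (β S)⁻¹)) := by
    intro M₀
    by_cases hri : xs ∈ intrinsicInterior ℝ (edom d)
    · obtain ⟨c, hc0, hc⟩ := exists_expect_gapOpt_le.{u, v, w} hP hd hα0 hα1 hx₀' hps hri hU₁c hU₁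
        hne₁ M₀
      exact ⟨c, hc0, fun _ => hc⟩
    · exact ⟨1, one_pos, fun h => absurd h hri⟩
  refine ⟨B, hB0, hB, ?_, ?_⟩
  · intro τ β hτ hβ hanti hsum
    have htop := h_ne_top_of_tsum_ne_top hτ hsum
    have hM := sum_toReal_h_le_tsum hτ hsum
      fun s => hps.toReal_h_nonneg hP (hβ s).le (htop s)
    obtain ⟨c, hc0, hc⟩ := exists_expect_gapFeas_le.{u, v, w} hP hVar hd hα0 hα1 hx₀' hps hU₂c
      hU₂ hne₂ (∑' s, ENNReal.ofReal (τ s) * (P.h (β s • ps)).toENNReal).toReal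
    obtain ⟨c', hc'0, hc'⟩ := hOpt
      (∑' s, ENNReal.ofReal (τ s) * (P.h (β s • ps)).toENNReal).toReal
    have hb : 0 < β 0 * τ 0 := mul_pos (hβ 0) (hτ 0)
    refine ⟨c', c + c / (β 0 * τ 0), hc'0, by positivity, fun K hK O hL r S hS => ?_⟩
    have H : MirrorProxRun.Admissible P d d' α τ β x₀ K O xs ps :=
      ⟨hP, hd, hα0, hα1, hτ, hβ, hx₀, hx₀', hK, hL, hps, htop⟩
    have hfeas := (hc τ β K O H hM r S hS).trans (H.le_WFeas hU₂ hc0.le hS)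
    have hlow := MirrorProxRun.neg_mul_integral_infDist_le H hU₁c hU₁ hne₁ hB r hS
    refine ⟨r.hasExpectation_gapFeas H hU₂c hU₂ hne₂ hS,
      r.hasExpectation_gapOpt H hU₁c hU₁ hne₁ hS, r.integrable_infDist H hS, hfeas, hlow,
      fun hri => ?_, fun κ ρ hw => ?_⟩
    · obtain ⟨S, rfl⟩ := Nat.exists_eq_add_of_le' hS
      exact (hc' hri τ β K O H hanti hM r S).trans (H.le_WOpt hanti hU₁ hc'0.le S)
    · refine le_trans ?_ hlow
      have h1 := MirrorProxRun.integral_infDist_le H hw hU₂c hU₂ hU₂S r hS hfeas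
      have h2 := mul_le_mul_of_nonneg_left h1 hB0.le
      linarith
  · intro κ ρ δ τbar hw hρ hδ0 hδ1 hδ hτ
    obtain ⟨M, hMsum⟩ := exists_sum_h_polynomial_le hP hps hw hρ hδ0 hδ
    obtain ⟨c, hc0, hc⟩ := exists_expect_gapFeas_le.{u, v, w} hP hVar hd hα0 hα1 hx₀' hps hU₂c
      hU₂ hne₂ (τbar * M)
    obtain ⟨c', hc'0, hc'⟩ := hOpt (τbar * M)
    -- Here β depends on K, so the general statement cannot simply be specialized; the constants
    -- come from the bound τ̄M, which is uniform in K.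
    refine ⟨c', c / τbar + c, hc'0, by positivity, fun K β hK hβ O hL r S hS => ?_⟩
    have hK0 : (0 : ℝ) < K := by exact_mod_cast hK
    have hβpos : ∀ s, 0 < β s := fun s => by rw [hβ]; positivity
    have hanti : Antitone β := fun s t hst => by
      rw [hβ, hβ]
      gcongr
    have H : MirrorProxRun.Admissible P d d' α (fun _ => τbar) β x₀ K O xs ps :=
      ⟨hP, hd, hα0, hα1, fun _ => hτ, hβpos, hx₀, hx₀', hK, hL, hps, fun s =>
        ne_top_of_le_ne_top (EReal.coe_ne_top _) (hw.h_le hP hρ hps (hβpos s).le)⟩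
    have hM : ∀ S, ∑ s ∈ Finset.range S, τbar * (P.h (β s • ps)).toReal ≤ τbar * M := fun S => by
      rw [← Finset.mul_sum]
      exact mul_le_mul_of_nonneg_left (hMsum K β hK hβ S) hτ.le
    have hS0 : (0 : ℝ) < S := by exact_mod_cast hS
    have hh0 := hTilde_nonneg hw.1.le hρ hδ ps
    refine ⟨r.hasExpectation_gapFeas H hU₂c hU₂ hne₂ hS,
      r.hasExpectation_gapOpt H hU₁c hU₁ hne₁ hS, ?_, fun hri => ?_⟩
    · have h1 := hc _ β K O H hM r S hS
      rw [sumStep_const] at h1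
      have h2 := polynomial_feas_le hK hS hδ0 hδ1 hτ hc0.le
        (sSup_energy₀_le_Rsq hd hα0.le hα1.le hx₀' hU₂ hxsZ K) hβ
      have h3 : 0 ≤ hTilde κ ρ δ ps / (2 * K * S) := by positivity
      linarith
    · obtain ⟨S, rfl⟩ := Nat.exists_eq_add_of_le' hS
      have h1 := hc' hri _ β K O H hanti hM r S
      rw [sumStep_const, polynomial_opt_eq hK S hτ hβ] at h1
      have hsup := sSup_breg_nonneg hd hx₀' (U := U₁ ∩ P.S₂)
        fun z hz => ⟨hU₁ hz.1, hP.S₂_subset hz.2⟩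
      have hE := energy₀_nonneg hα0.le hα1.le (K := K)
        (hd.breg_nonneg (hd.feasible hxsZ) hx₀')
      have h3 : 0 ≤ sSup ((fun x => breg d d' x x₀) '' (U₁ ∩ P.S₂)) / (τbar * K * (S + 1 : ℕ)) := by
        positivity
      have h4 : 0 ≤ energy₀ d d' α x₀ K xs
          / (2 * τbar * ((K : ℝ) * (S + 1 : ℕ)) ^ (1 - 2 * δ)) := by positivity
      have h5 : 0 ≤ hTilde κ ρ δ ps / (2 * ((K : ℝ) * (S + 1 : ℕ)) ^ (1 - 2 * δ)) := by
        positivity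
      linarith
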